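/- Let $R_\alpha=\mathbb Z[\alpha_0,\alpha_1]$, $A_\alpha=R_\alpha[X]/((X-\alpha_0)(X-\alpha_1))$ and $R_{\alpha\mathcal D}=R_\alpha[\mathcal D^{-1}]$ with $\mathcal D=(\alpha_0-\alpha_1)^2$. The algebra $A_\alpha$, with its multiplication and the comultiplication $1\mapsto (X-\alpha_0)\otimes 1+1\otimes(X-\alpha_1)$, $X\mapsto X\otimes X-\alpha_0\alpha_1\,1\otimes 1$, defines a $(1+1)$-dimensional TQFT $\mathcal F_\alpha$, which sends a collection $\mathscr C$ of disjoint circles in the annulus $\mathbb A=\{z\in\mathbb R^2: 1\le |z|\le 2\}$ to the tensor product over $R_\alpha$ of one copy of $A_\alpha$ for each circle. Give $\mathcal F_\alpha(\mathscr C)$ the annular grading, in which $R_\alpha$ and the factors of contractible circles have degree $0$, and in which the factor of the $i$-th non-contractible circle, counted from the innermost outwards, has the homogeneous basis $1$, $X-\alpha_0$ if $i$ is odd, and $1$, $X-\alpha_1$ if $i$ is even, in degrees $-1$, $1$. Let $\mathcal G_\alpha(\mathscr C)=\mathcal F_\alpha(\mathscr C)$, and for a cobordism $S\subset\mathbb A\times[0,1]$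 let $\mathcal G_\alpha(S)$ be the part of $\mathcal F_\alpha(S)$ that preserves the annular degree. Let $L\subset \mathbb A\times[0,1]$ be a link with $k$ components and let $D\subset\mathbb A$ be a diagram of $L$. Apply $\mathcal G_\alpha$ to the cube of resolutions of $D$, with $0$- and $1$-smoothings at the vertices and signed saddle cobordisms on the edges, and extend scalars to $R_{\alpha\mathcal D}$. Then the result is a chain complex $CKh^{\mathbb A}_{\alpha\mathcal D}(D)$ (the composite of successive differentials is zero), and its homology $Kh^{\mathbb A}_{\alpha\mathcal D}(L)$, summed over all homological degrees, is a free $R_{\alpha\mathcal D}$-module of rank $2^k$. -/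

import Mathlib

open scoped TensorProduct

noncomputable section

namespace AnnularKhovanov

/-! ### The rings and the Frobenius algebra -/

/-- `R_α = ℤ[α₀, α₁]`. -/
abbrev Rα : Type := MvPolynomial (Fin 2) ℤ

abbrev α₀ : Rα := MvPolynomial.X 0

abbrev α₁ : Rα := MvPolynomial.X 1

/-- `A_α = R_α[X] / ((X - α₀)(X - α₁))`, that is, `X² = -α₀α₁ + (α₀ + α₁) X`.
The element `⟨r, s⟩` is `r + s X`. -/
abbrev Aα : Type := QuadraticAlgebra Rα (-(α₀ * α₁)) (α₀ + α₁)

/-- The class of `X` in `A_α`. -/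
def AX : Aα := ⟨0, 1⟩

theorem AX_relation : (AX - algebraMap Rα Aα α₀) * (AX - algebraMap Rα Aα α₁) = 0 := by
  apply QuadraticAlgebra.ext
  · simp [AX, QuadraticAlgebra.algebraMap_eq]
  · simp [AX, QuadraticAlgebra.algebraMap_eq]
    ring

/-- The coordinates of an element of `A_α` with respect to `{1, X - r}`. -/
def coordsAt (r : Rα) : Aα ≃ₗ[Rα] (Fin 2 → Rα) where
  toFun z := ![z.re + r * z.im, z.im]
  invFun c := ⟨c 0 - r * c 1, c 1⟩
  map_add' x y := by
    funext i
    fin_cases i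
    · change x.re + y.re + r * (x.im + y.im) = x.re + r * x.im + (y.re + r * y.im)
      ring
    · rfl
  map_smul' c x := by
    funext i
    fin_cases i
    · change c * x.re + r * (c * x.im) = c * (x.re + r * x.im)
      ring
    · rfl
  left_inv x := by
    change (⟨x.re + r * x.im - r * x.im, x.im⟩ : Aα) = x
    rw [add_sub_cancel_right]
  right_inv c := by
    funext i
    fin_cases i
    · change c 0 - r * c 1 + r * c 1 = c 0
      ring
    · rfl

/-- The `R_α`-basis `{1, X - r}` of `A_α`. -/
def basisAt (r : Rα) : Module.Basis (Fin 2) Rα Aα := Module.Basis.ofEquivFun (coordsAt r)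

theorem basisAt_zero_index (r : Rα) : basisAt r 0 = 1 := by
  apply (coordsAt r).injective
  rw [basisAt, Module.Basis.coe_ofEquivFun, LinearEquiv.apply_symm_apply]
  funext i
  fin_cases i
  · change (1 : Rα) = 1 + r * 0
    ring
  · rfl

theorem basisAt_one_index (r : Rα) : basisAt r 1 = AX - algebraMap Rα Aα r := by
  apply (coordsAt r).injective
  rw [basisAt, Module.Basis.coe_ofEquivFun, LinearEquiv.apply_symm_apply]
  funext i
  fin_cases i <;> simp [coordsAt, AX, QuadraticAlgebra.algebraMap_eq]

/-- The discriminant `𝒟 = (α₀ - α₁)²`. -/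
abbrev discr : Rα := (α₀ - α₁) ^ 2

/-- `R_{α𝒟} = R_α[𝒟⁻¹]`. -/
abbrev RαD : Type := Localization.Away discr

/-- Let `M` and `N` be free modules with bases `bM` and `bN` of homogeneous elements, of degrees
`degM` and `degN`, the ground ring being in degree `0`. This is the degree-preserving part of the
linear map `f`: its matrix entries between basis elements of equal degree are kept, and the
others are replaced by `0`. -/
def degreePreservingPart {R M N ι κ : Type*} [CommRing R] [AddCommGroup M] [Module R M]
    [AddCommGroup N] [Module R N] [Fintype ι] [DecidableEq ι] [Fintype κ]
    (bM : Module.Basis ι R M) (bN : Module.Basis κ R N) (degM : ι → ℤ) (degN : κ → ℤ)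
    (f : M →ₗ[R] N) : M →ₗ[R] N :=
  Matrix.toLin bM bN
    (Matrix.of fun y x => if degN y = degM x then LinearMap.toMatrix bM bN f y x else 0)

/-- The homology of a module with a differential: cycles modulo boundaries. -/
abbrev Homology {R M : Type*} [CommRing R] [AddCommGroup M] [Module R M] (d : M →ₗ[R] M) : Type _ :=
  ↥(LinearMap.ker d) ⧸ (LinearMap.range d).submoduleOf (LinearMap.ker d)

/-! ### Links in the thickened annulus -/

/-- The annulus `{z : 1 ≤ |z| ≤ 2}`. -/
abbrev Annulus : Type := {z : ℂ // 1 ≤ ‖z‖ ∧ ‖z‖ ≤ 2}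

/-- The thickened annulus `𝔸 × I`. -/
abbrev ThickenedAnnulus : Type := Annulus × unitInterval

/-- `L` is a link with `k` components: the image of an embedding of `k` disjoint circles. -/
def IsLink (k : ℕ) (L : Set ThickenedAnnulus) : Prop :=
  ∃ f : Fin k × Circle → ThickenedAnnulus, Topology.IsEmbedding f ∧ Set.range f = L

/-- Two subsets are ambient isotopic. -/
def AmbientIsotopic {X : Type*} [TopologicalSpace X] (K L : Set X) : Prop :=
  ∃ H : unitInterval → (X ≃ₜ X), Continuous (fun z : unitInterval × X => H z.1 z.2) ∧
    H 0 = Homeomorph.refl X ∧ H 1 '' K = L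

/-! ### Annular link diagrams

A diagram is cut by finitely many rays from the puncture into angular sectors, in such a way that
every sector contains at most one crossing or one extremum of the angular coordinate. The strands
that meet a ray are numbered `0, 1, 2, …` from the puncture outwards. A sector has a *start* ray
and an *end* ray, in counterclockwise order. -/

/-- The part of a link diagram in one sector.
* `id`: radially parallel strands only.
* `birth i`: an arc with both ends, the strands `i` and `i + 1`, on the end ray.
* `death i`: an arc with both ends, the strands `i` and `i + 1`, on the start ray.
* `cross i o`: the strands `i` and `i + 1` cross. If `o = true` then the strand from `i` to `i + 1`
  is the overstrand; otherwise the strand from `i + 1` to `i` is. -/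
inductive Slab : Type
  | id : Slab
  | birth (i : ℕ) : Slab
  | death (i : ℕ) : Slab
  | cross (i : ℕ) (o : Bool) : Slab

namespace Slab

/-- The sector can have `m` strands on its start ray and `n` strands on its end ray. -/
def Fits : Slab → ℕ → ℕ → Prop
  | id, m, n => n = m
  | birth i, m, n => i ≤ m ∧ n = m + 2
  | death i, m, n => i ≤ n ∧ m = n + 2
  | cross i _, m, n => i + 2 ≤ m ∧ n = m

def isCross : Slab → Bool
  | cross _ _ => true
  | _ => false

/-- The position of the event in a sector. -/
def pos : Slab → ℕ
  | id => 0
  | birth i => i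
  | death i => i
  | cross i _ => i

/-- In the link, strand `p` on the start ray is joined to strand `q` on the end ray. -/
def Strand : Slab → ℕ → ℕ → Prop
  | id, p, q => p = q
  | birth i, p, q => q = if p < i then p else p + 2
  | death i, p, q => p = if q < i then q else q + 2
  | cross i _, p, q =>
      (p = i ∧ q = i + 1) ∨ (p = i + 1 ∧ q = i) ∨ (p = q ∧ p ≠ i ∧ p ≠ i + 1)

/-- The strand from `p` to `q` is the overstrand of a crossing. -/
def Over : Slab → ℕ → ℕ → Prop
  | cross i true, p, q => p = i ∧ q = i + 1
  | cross i false, p, q => p = i + 1 ∧ q = i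
  | _, _, _ => False

/-- In the smoothing (the `0`-smoothing if `b = false`, the `1`-smoothing if `b = true`, of the
crossing, if there is one), strand `p` on the start ray is joined to strand `q` on the end ray.
The `0`-smoothing joins the two regions that the overstrand sweeps when it is turned
counterclockwise. If `o = true` these are the regions between the strands `i` and `i + 1` on the
start ray and on the end ray, so that the `0`-smoothing joins `i` to `i` and `i + 1` to `i + 1`. -/
def SmoothThrough : Slab → Bool → ℕ → ℕ → Prop
  | id, _, p, q => p = q
  | birth i, _, p, q => q = if p < i then p else p + 2
  | death i, _, p, q => p = if q < i then q else q + 2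
  | cross i o, b, p, q => p = q ∧ (o ≠ b ∨ (p ≠ i ∧ p ≠ i + 1))

/-- In the smoothing, strands `p` and `q` of the start ray are joined inside the sector. -/
def SmoothCap : Slab → Bool → ℕ → ℕ → Prop
  | death i, _, p, q => p = i ∧ q = i + 1
  | cross i o, b, p, q => o = b ∧ p = i ∧ q = i + 1
  | _, _, _, _ => False

/-- In the smoothing, strands `p` and `q` of the end ray are joined inside the sector. -/
def SmoothCup : Slab → Bool → ℕ → ℕ → Prop
  | birth i, _, p, q => p = i ∧ q = i + 1
  | cross i o, b, p, q => o = b ∧ p = i ∧ q = i + 1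
  | _, _, _, _ => False

end Slab

/-- An annular link diagram with `N + 1` sectors. Sector `j` lies between ray `j` and ray `j + 1`,
where `j + 1` is taken cyclically, and ray `j` meets the diagram in `width j` points. -/
structure Diagram where
  N : ℕ
  width : Fin (N + 1) → ℕ
  slab : Fin (N + 1) → Slab
  fits : ∀ j, (slab j).Fits (width j) (width (j + 1))

namespace Diagram

variable (D : Diagram)

/-- `y` is the point of the thickened annulus with angle `2πt/(N + 1)`, radius `2 - 1/(x + 2)` and
height `h`. -/
def HasCoords (y : ThickenedAnnulus) (t x h : ℝ) : Prop :=
  (y.1 : ℂ) = ((2 - 1 / (x + 2) : ℝ) : ℂ) *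
      Complex.exp (((2 * Real.pi * t / (D.N + 1) : ℝ) : ℂ) * Complex.I) ∧
    (y.2 : ℝ) = h

open scoped Classical in
/-- The link in `𝔸 × I` presented by the diagram: everything is drawn at height `1/2`, except that
the overstrand of a crossing is lifted. -/
def link : Set ThickenedAnnulus :=
  {y | ∃ (j : Fin (D.N + 1)) (s : ℝ), 0 ≤ s ∧ s ≤ 1 ∧
    ((∃ p q : ℕ, p < D.width j ∧ q < D.width (j + 1) ∧ (D.slab j).Strand p q ∧
        D.HasCoords y (j + s) ((1 - s) * p + s * q)
          (1 / 2 + if (D.slab j).Over p q then s * (1 - s) else 0)) ∨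
      (∃ i : ℕ, D.slab j = Slab.birth i ∧
        D.HasCoords y (j + (1 + |2 * s - 1|) / 2) (i + s) (1 / 2)) ∨
      (∃ i : ℕ, D.slab j = Slab.death i ∧
        D.HasCoords y (j + (1 - |2 * s - 1|) / 2) (i + s) (1 / 2)))}

/-- `D` is a diagram of `L`. -/
def IsDiagramOf (L : Set ThickenedAnnulus) : Prop := AmbientIsotopic L D.link

/-! ### The cube of resolutions -/

/-- The crossings, ordered by their angular position. -/
abbrev Crossing : Type := {j : Fin (D.N + 1) // (D.slab j).isCross = true}

/-- The vertices of the cube `{0, 1}ⁿ`. -/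
abbrev Vertex : Type := D.Crossing → Bool

/-- The intersection points of the diagram with the rays: `(j, p)` is strand `p` on ray `j`. -/
abbrev Point : Type := {x : Fin (D.N + 1) × ℕ // x.2 < D.width x.1}

instance : Finite D.Point :=
  Finite.of_injective
    (fun x : D.Point => (⟨x.1.1, ⟨x.1.2, x.2⟩⟩ : Σ j : Fin (D.N + 1), Fin (D.width j))) (by
      rintro ⟨⟨j, p⟩, hp⟩ ⟨⟨j', p'⟩, hp'⟩ h
      simp only [Sigma.mk.injEq] at h
      obtain ⟨rfl, h⟩ := h
      simp only [heq_eq_eq, Fin.mk.injEq] at h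
      subst h
      rfl)

/-- The smoothing prescribed by `u` in sector `j` (irrelevant if there is no crossing there). -/
def bit (u : D.Vertex) (j : Fin (D.N + 1)) : Bool :=
  if h : (D.slab j).isCross = true then u ⟨j, h⟩ else false

/-- Two points are joined by an arc of the smoothing `D_u` inside one sector. -/
def Arc (u : D.Vertex) (x y : D.Point) : Prop :=
  ∃ j : Fin (D.N + 1),
    (x.1.1 = j ∧ y.1.1 = j + 1 ∧ (D.slab j).SmoothThrough (D.bit u j) x.1.2 y.1.2) ∨
    (x.1.1 = j ∧ y.1.1 = j ∧ (D.slab j).SmoothCap (D.bit u j) x.1.2 y.1.2) ∨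
    (x.1.1 = j + 1 ∧ y.1.1 = j + 1 ∧ (D.slab j).SmoothCup (D.bit u j) x.1.2 y.1.2)

/-- The circles of the smoothing `D_u`: the classes of points connected by arcs. Every circle
meets some ray. -/
def Circles (u : D.Vertex) : Type := Quot (D.Arc u)

/-- The circle of `D_u` through a point. -/
def circ (u : D.Vertex) (x : D.Point) : D.Circles u := Quot.mk _ x

instance (u : D.Vertex) : Finite (D.Circles u) := inferInstanceAs (Finite (Quot (D.Arc u)))

instance (u : D.Vertex) : Fintype (D.Circles u) := Fintype.ofFinite _

instance (u : D.Vertex) : DecidableEq (D.Circles u) := Classical.decEq _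

/-- The strands on ray `0` that belong to the circle `c`. -/
def hits (u : D.Vertex) (c : D.Circles u) : Set ℕ :=
  {p | ∃ h : p < D.width 0, D.circ u ⟨(0, p), h⟩ = c}

/-- A circle is essential if it is not contractible in the annulus; for an embedded circle this
means that it crosses a ray from the puncture to the outer boundary an odd number of times. -/
def IsEssential (u : D.Vertex) (c : D.Circles u) : Prop := Odd (D.hits u c).ncard

/-- The number of essential circles that lie closer to the puncture than the essential circle `c`,
that is, those met before `c` on ray `0`. The `i`-th essential circle has depth `i - 1`. -/
def depth (u : D.Vertex) (c : D.Circles u) : ℕ :=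
  {c' | D.IsEssential u c' ∧ sInf (D.hits u c') < sInf (D.hits u c)}.ncard

/-! ### The functors `F_α` and `G_α` on the cube -/

/-- The module `F_α(D_u)`, which is also the module `G_α(D_u)`: one tensor factor `A_α` for every
circle. -/
abbrev State (u : D.Vertex) : Type := ⨂[Rα] (_ : D.Circles u), Aα

/-- The basis of `F_α(D_u)` made from the basis `{1, X}` of every factor. -/
def stdBasis (u : D.Vertex) : Module.Basis (D.Circles u → Fin 2) Rα (D.State u) :=
  Basis.piTensorProduct fun _ => basisAt 0

open scoped Classical in
/-- The homogeneous basis of the factor of the circle `c`: `{1, X}` if `c` is trivial,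
`{1, X - α₀}` if `c` is the `i`-th essential circle with `i` odd, `{1, X - α₁}` if `i` is even. -/
def factorBasis (u : D.Vertex) (c : D.Circles u) : Module.Basis (Fin 2) Rα Aα :=
  if D.IsEssential u c then (if Even (D.depth u c) then basisAt α₀ else basisAt α₁)
  else basisAt 0

/-- The homogeneous basis of `G_α(D_u)`. -/
def homBasis (u : D.Vertex) : Module.Basis (D.Circles u → Fin 2) Rα (D.State u) :=
  Basis.piTensorProduct fun c => D.factorBasis u c

open scoped Classical in
/-- The annular degree of an element of the homogeneous basis. -/
def adeg (u : D.Vertex) (x : D.Circles u → Fin 2) : ℤ :=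
  ∑ c : D.Circles u, if D.IsEssential u c then (if x c = 0 then -1 else 1) else 0

theorem crossing_fits (c : D.Crossing) :
    (D.slab c.1).pos + 1 < D.width c.1 ∧ (D.slab c.1).pos + 1 < D.width (c.1 + 1) := by
  have h := D.fits c.1
  have hc := c.2
  generalize D.slab c.1 = S at h hc ⊢
  cases S with
  | cross i o =>
    simp only [Slab.Fits, Slab.pos] at h ⊢
    omega
  | _ => simp [Slab.isCross] at hc

/-- The strand `i` on the start ray at a crossing of the strands `i` and `i + 1`. -/
def inner (c : D.Crossing) : D.Point :=
  ⟨(c.1, (D.slab c.1).pos), Nat.lt_of_succ_lt (D.crossing_fits c).1⟩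

/-- The strand `i + 1` on the end ray at a crossing of the strands `i` and `i + 1`. In either
smoothing of the crossing, `inner` and `outer` lie on different ones of the two local arcs. -/
def outer (c : D.Crossing) : D.Point :=
  ⟨(c.1 + 1, (D.slab c.1).pos + 1), (D.crossing_fits c).2⟩

/-- The circle of `D_u` through some point of a circle of `D_v`. For a circle away from the
crossing at which the smoothings `D_u` and `D_v` differ, it is the same circle. -/
def transfer (u v : D.Vertex) (e : D.Circles v) : D.Circles u := D.circ u (Quot.out e)

/-- The map `F_α(D_u) → F_α(D_v)` of a saddle at the crossing `c` that merges two circles: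
multiplication of the two factors, and the identity on the other factors. -/
def mergeMap (u v : D.Vertex) (c : D.Crossing) : D.State u →ₗ[Rα] D.State v :=
  (D.stdBasis u).constr Rα fun x =>
    PiTensorProduct.tprod Rα fun e : D.Circles v =>
      if e = D.circ v (D.outer c) then
        basisAt 0 (x (D.circ u (D.inner c))) * basisAt 0 (x (D.circ u (D.outer c)))
      else basisAt 0 (x (D.transfer u v e))

/-- The element of `F_α(D_v)` with `a` and `b` in the factors of the two circles at the crossing
`c`, and with the basis elements given by `x` in the other factors. -/
def splitTensor (u v : D.Vertex) (c : D.Crossing) (x : D.Circles u → Fin 2) (a b : Aα) :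
    D.State v :=
  PiTensorProduct.tprod Rα fun e : D.Circles v =>
    if e = D.circ v (D.inner c) then a
    else if e = D.circ v (D.outer c) then b
    else basisAt 0 (x (D.transfer u v e))

/-- The map `F_α(D_u) → F_α(D_v)` of a saddle at the crossing `c` that splits a circle:
the comultiplication `1 ↦ (X - α₀) ⊗ 1 + 1 ⊗ (X - α₁)`, `X ↦ X ⊗ X - α₀α₁ 1 ⊗ 1` on its factor,
and the identity on the other factors. -/
def splitMap (u v : D.Vertex) (c : D.Crossing) : D.State u →ₗ[Rα] D.State v :=
  (D.stdBasis u).constr Rα fun x =>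
    if x (D.circ u (D.inner c)) = 0 then
      D.splitTensor u v c x (AX - algebraMap Rα Aα α₀) 1 +
        D.splitTensor u v c x 1 (AX - algebraMap Rα Aα α₁)
    else
      D.splitTensor u v c x AX AX - (α₀ * α₁) • D.splitTensor u v c x 1 1

/-- `F_α` of the saddle cobordism from `D_u` to `D_v` at the crossing `c`. -/
def saddleF (u v : D.Vertex) (c : D.Crossing) : D.State u →ₗ[Rα] D.State v :=
  if D.circ u (D.inner c) ≠ D.circ u (D.outer c) then D.mergeMap u v c else D.splitMap u v c

/-- `G_α` of the saddle cobordism: the part of `F_α` that preserves the annular degree. -/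
def saddleG (u v : D.Vertex) (c : D.Crossing) : D.State u →ₗ[Rα] D.State v :=
  degreePreservingPart (D.homBasis u) (D.homBasis v) (D.adeg u) (D.adeg v) (D.saddleF u v c)

/-! ### The chain complex and its homology -/

/-- The start of the edge of the cube in direction `c` that ends at `v`. -/
def source (v : D.Vertex) (c : D.Crossing) : D.Vertex := Function.update v c false

/-- The sign of an edge of the cube. -/
def edgeSign (v : D.Vertex) (c : D.Crossing) : Rα :=
  (-1) ^ (Finset.univ.filter fun c' : D.Crossing => c' < c ∧ v c' = true).card

/-- The total chain module `G_α([[D]])`, the sum over all vertices of the cube. -/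
abbrev Chain : Type := ∀ u : D.Vertex, D.State u

/-- The differential of `G_α([[D]])`: the signed sum of the maps of all edges of the cube. -/
def dα : D.Chain →ₗ[Rα] D.Chain :=
  LinearMap.pi fun v =>
    ∑ c : D.Crossing,
      if v c = true then
        D.edgeSign v c • (D.saddleG (D.source v c) v c ∘ₗ LinearMap.proj (D.source v c))
      else 0

/-- The differential of `CKh^𝔸_{α𝒟}(D) = G_{α𝒟}([[D]])`, by extension of scalars. -/
def dαD : (RαD ⊗[Rα] D.Chain) →ₗ[RαD] (RαD ⊗[Rα] D.Chain) := D.dα.baseChange RαD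

/-- The homology `Kh^𝔸_{α𝒟}`, summed over all homological degrees. -/
abbrev Kh : Type := Homology D.dαD

end Diagram

end AnnularKhovanov

end

open scoped TensorProduct

noncomputable section

namespace AnnularKhovanov

/-! ### Homology of a cube whose vertices carry partially defined generators -/

/-- The generator `p` survives at the vertex `u` of the cube. -/
def CubeCompat {C P : Type*} (base : P → Prop) (ok : P → C → Bool → Prop) (x : (C → Bool) × P) :
    Prop :=
  base x.2 ∧ ∀ c, ok x.2 c (x.1 c)

section Cube

set_option linter.unusedSectionVars false

variable {R M C P : Type*} [CommRing R] [AddCommGroup M] [Module R M] [Fintype C] [DecidableEq C]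
  {base : P → Prop} {ok : P → C → Bool → Prop}

open scoped Classical in
/-- The generator at the vertex `u` labelled `p`, or `0` if there is none. -/
def cubeGen (b : Module.Basis {x : (C → Bool) × P // CubeCompat base ok x} R M)
    (u : C → Bool) (p : P) : M :=
  if h : CubeCompat base ok (u, p) then b ⟨(u, p), h⟩ else 0

variable (b : Module.Basis {x : (C → Bool) × P // CubeCompat base ok x} R M)

theorem cubeGen_of_compat {u : C → Bool} {p : P} (h : CubeCompat base ok (u, p)) :
    cubeGen b u p = b ⟨(u, p), h⟩ := dif_pos h

theorem cubeGen_of_not_compat {u : C → Bool} {p : P} (h : ¬ CubeCompat base ok (u, p)) :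
    cubeGen b u p = 0 := dif_neg h

theorem CubeCompat.update {u : C → Bool} {p : P} (h : CubeCompat base ok (u, p)) {c : C}
    {s : Bool} (hc : ok p c s) : CubeCompat base ok (Function.update u c s, p) := by
  refine ⟨h.1, fun c' => ?_⟩
  by_cases hcc : c' = c
  · subst hcc; simpa using hc
  · simpa [Function.update_of_ne hcc] using h.2 c'

variable (σ : (C → Bool) → C → R) (d : M →ₗ[R] M)

/-- `d` is the signed sum of the edge maps of the cube. -/
def IsCubeDifferential : Prop :=
  ∀ u p, CubeCompat base ok (u, p) → d (cubeGen b u p) =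
    ∑ c, if u c = false then σ u c • cubeGen b (Function.update u c true) p else 0

/-- `σ` is a sign assignment for which every square of the cube anticommutes. -/
structure IsCubeSign {R C : Type*} [CommRing R] [DecidableEq C] (σ : (C → Bool) → C → R) :
    Prop where
  mul_self : ∀ u c, σ u c * σ u c = 1
  square : ∀ u c c', c ≠ c' → u c = false → u c' = false →
    σ u c * σ (Function.update u c true) c' + σ u c' * σ (Function.update u c' true) c = 0

variable {b σ d}

/-- `IsCubeDifferential` speaks of surviving generators only. Here the generator may die when `c` is
switched on, but then it is dead at all later vertices too, because they keep `c` switched on, and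
both sides vanish. -/
theorem IsCubeDifferential.apply_update (hd : IsCubeDifferential b σ d) {u : C → Bool} {p : P}
    (h : CubeCompat base ok (u, p)) (c : C) :
    d (cubeGen b (Function.update u c true) p) =
      ∑ c', if Function.update u c true c' = false then
        σ (Function.update u c true) c' •
          cubeGen b (Function.update (Function.update u c true) c' true) p else 0 := by
  by_cases hc : ok p c true
  · exact hd _ _ (h.update hc)
  · have hn : ∀ w : C → Bool, w c = true → cubeGen b w p = 0 := fun w hw =>
      cubeGen_of_not_compat b fun hh => hc (hw ▸ hh.2 c)
    rw [hn _ (by simp), map_zero]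
    refine (Finset.sum_eq_zero fun c' _ => ?_).symm
    split_ifs with hc'
    · have hne : c ≠ c' := by rintro rfl; simp at hc'
      rw [hn _ (by simp [Function.update_of_ne hne]), smul_zero]
    · rfl

/-- The two orders in which a pair of directions can be switched on cancel. This remains true when
an intermediate generator is dead, by `apply_update`. -/
theorem IsCubeDifferential.comp_self (hd : IsCubeDifferential b σ d) (hσ : IsCubeSign σ) :
    d ∘ₗ d = 0 := by
  refine b.ext fun ⟨⟨u, p⟩, h⟩ => ?_
  rw [LinearMap.comp_apply, ← cubeGen_of_compat b h, hd u p h, map_sum, LinearMap.zero_apply]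
  simp only [apply_ite d, map_smul, map_zero, hd.apply_update h, Finset.smul_sum, smul_ite,
    smul_zero, smul_smul]
  have key : ∀ c c', (if u c = false then (if Function.update u c true c' = false then
        (σ u c * σ (Function.update u c true) c') •
          cubeGen b (Function.update (Function.update u c true) c' true) p else 0) else 0) =
      (if c ≠ c' ∧ u c = false ∧ u c' = false then
        (σ u c * σ (Function.update u c true) c') •
          cubeGen b (Function.update (Function.update u c true) c' true) p else 0) := by
    intro c c'
    by_cases hcc : c = c'
    · subst hcc; simp
    · simp [hcc, Function.update_of_ne (Ne.symm hcc), ite_and]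
  calc _ = ∑ c, ∑ c', (if c ≠ c' ∧ u c = false ∧ u c' = false then
        (σ u c * σ (Function.update u c true) c') •
          cubeGen b (Function.update (Function.update u c true) c' true) p else 0) := by
        refine Finset.sum_congr rfl fun c _ => ?_
        rw [← Finset.sum_congr rfl fun c' _ => key c c']
        split_ifs <;> simp
    _ = ∑ x : C × C, (if x.1 ≠ x.2 ∧ u x.1 = false ∧ u x.2 = false then
        (σ u x.1 * σ (Function.update u x.1 true) x.2) •
          cubeGen b (Function.update (Function.update u x.1 true) x.2 true) p else 0) :=
        (Fintype.sum_prod_type' _).symm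
    _ = 0 := by
        -- Exchanging the two directions has no fixed points among the nonzero terms, and it
        -- reverses the sign.
        refine Finset.sum_involution (fun x _ => x.swap) ?_ ?_ ?_ ?_
        · rintro ⟨c, c'⟩ -
          by_cases hx : c ≠ c' ∧ u c = false ∧ u c' = false
          · rw [if_pos hx, if_pos ⟨hx.1.symm, hx.2.2, hx.2.1⟩]
            simp only [Prod.fst_swap, Prod.snd_swap]
            rw [Function.update_comm hx.1.symm, ← add_smul, hσ.square u c c' hx.1 hx.2.1 hx.2.2,
              zero_smul]
          · rw [if_neg hx, if_neg fun h => hx ⟨h.1.symm, h.2.2, h.2.1⟩, add_zero]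
        · rintro ⟨c, c'⟩ - hne heq
          simp only [Prod.swap_prod_mk, Prod.mk.injEq] at heq
          simp [heq.1] at hne
        · simp
        · simp

variable (b σ) in
open scoped Classical in
/-- The contracting homotopy: it removes the direction `ch p`, if there is one. -/
def cubeHomotopy (ch : P → Option C) : M →ₗ[R] M :=
  b.constr R fun x => match ch x.1.2 with
    | none => 0
    | some c => if x.1.1 c = true then
        σ (Function.update x.1.1 c false) c • cubeGen b (Function.update x.1.1 c false) x.1.2 else 0

/-- The formula also holds for dead generators: as `p` admits both choices at `c`, survival does not
depend on the value of `u` at `c`. -/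
theorem cubeHomotopy_apply {ch : P → Option C} {p : P} {c : C} (hc : ch p = some c)
    (hok : ∀ s, ok p c s) (u : C → Bool) :
    cubeHomotopy b σ ch (cubeGen b u p) = if u c = true then
      σ (Function.update u c false) c • cubeGen b (Function.update u c false) p else 0 := by
  by_cases h : CubeCompat base ok (u, p)
  · rw [cubeGen_of_compat b h, cubeHomotopy, Module.Basis.constr_basis]
    simp only [hc]
  · rw [cubeGen_of_not_compat b h, map_zero, cubeGen_of_not_compat b, smul_zero, ite_self]
    intro h'
    apply h
    have := h'.update (hok (u c))
    simpa using this

theorem cubeHomotopy_apply_of_none {ch : P → Option C} {p : P} (hc : ch p = none)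
    (u : C → Bool) : cubeHomotopy b σ ch (cubeGen b u p) = 0 := by
  by_cases h : CubeCompat base ok (u, p)
  · rw [cubeGen_of_compat b h, cubeHomotopy, Module.Basis.constr_basis]
    simp only [hc]
  · rw [cubeGen_of_not_compat b h, map_zero]

/-- The homotopy kills every generator whose coordinate at `c` is `false`, so of `h d` only the term
that switches `c` on and off again remains. -/
theorem IsCubeDifferential.homotopy_of_false (hd : IsCubeDifferential b σ d) (hσ : IsCubeSign σ)
    {ch : P → Option C} {p : P} {c : C} (hc : ch p = some c) (hok : ∀ s, ok p c s) {u : C → Bool}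
    (h : CubeCompat base ok (u, p)) (hu : u c = false) :
    d (cubeHomotopy b σ ch (cubeGen b u p)) + cubeHomotopy b σ ch (d (cubeGen b u p)) =
      cubeGen b u p := by
  rw [cubeHomotopy_apply hc hok, hd u p h, hu, if_neg (by simp), map_zero, zero_add, map_sum,
    Finset.sum_eq_single c]
  · rw [if_pos hu, map_smul, cubeHomotopy_apply hc hok]
    have : Function.update u c false = u := by rw [← hu]; simp
    simp [this, smul_smul, hσ.mul_self]
  · intro c' _ hne
    split_ifs
    · rw [map_smul, cubeHomotopy_apply hc hok, Function.update_of_ne hne.symm, hu]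
      simp
    · simp
  · simp

/-- The term of `d h` in direction `c` gives the generator back. For every other direction `c'` the
terms of `d h` and `h d` cancel by anticommutativity of the square spanned by `c` and `c'`. -/
theorem IsCubeDifferential.homotopy_of_true (hd : IsCubeDifferential b σ d) (hσ : IsCubeSign σ)
    {ch : P → Option C} {p : P} {c : C} (hc : ch p = some c) (hok : ∀ s, ok p c s) {u : C → Bool}
    (h : CubeCompat base ok (u, p)) (hu : u c = false) :
    d (cubeHomotopy b σ ch (cubeGen b (Function.update u c true) p)) +
      cubeHomotopy b σ ch (d (cubeGen b (Function.update u c true) p)) =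
      cubeGen b (Function.update u c true) p := by
  have hcu : Function.update u c false = u := by rw [← hu]; simp
  rw [cubeHomotopy_apply hc hok, hd.apply_update h c, map_sum]
  simp only [Function.update_self, if_true, Function.update_idem, hcu, map_smul, hd u p h]
  rw [Finset.smul_sum, ← Finset.sum_add_distrib, Finset.sum_eq_single c]
  · simp [hu, smul_smul, hσ.mul_self]
  · intro c' _ hne
    rw [Function.update_of_ne hne]
    by_cases hc' : u c' = false
    · rw [if_pos hc', if_pos hc', map_smul, cubeHomotopy_apply hc hok,
        Function.update_of_ne hne.symm, Function.update_self, if_pos rfl,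
        Function.update_comm hne.symm, Function.update_idem, Function.update_comm hne, hcu,
        smul_smul, smul_smul, ← add_smul]
      have hsq := hσ.square u c c' hne.symm hu hc'
      have h1 := hσ.mul_self u c
      have h2 := hσ.mul_self (Function.update u c' true) c
      have : σ u c * σ u c' + σ (Function.update u c true) c' * σ (Function.update u c' true) c
          = 0 := by
        -- The square relation is multiplied by the two signs of its edges in direction `c` and in
        -- the position needed for cancellation; their squares are `1`.
        linear_combination (σ u c * σ (Function.update u c' true) c) * hsq -
          σ (Function.update u c true) c' * σ (Function.update u c' true) c * h1 -
          σ u c * σ u c' * h2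
      rw [this, zero_smul]
    · simp [hc']
  · simp

theorem IsCubeDifferential.homotopy (hd : IsCubeDifferential b σ d) (hσ : IsCubeSign σ)
    {ch : P → Option C} {p : P} {c : C} (hc : ch p = some c) (hok : ∀ s, ok p c s) {u : C → Bool}
    (h : CubeCompat base ok (u, p)) :
    d (cubeHomotopy b σ ch (cubeGen b u p)) + cubeHomotopy b σ ch (d (cubeGen b u p)) =
      cubeGen b u p := by
  cases hu : u c with
  | false => exact hd.homotopy_of_false hσ hc hok h hu
  | true =>
    have := hd.homotopy_of_true hσ hc hok (h.update (hok false)) (Function.update_self c false u)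
    have hcu : Function.update u c true = u := by rw [← hu]; simp
    simpa [hcu] using this

/-- A label that admits exactly one choice at every direction of the cube. -/
def CubeIsolated (base : P → Prop) (ok : P → C → Bool → Prop) (p : P) : Prop :=
  base p ∧ ∀ c, ∃! s, ok p c s

/-- The generators of isolated labels. -/
def isolatedEquiv (base : P → Prop) (ok : P → C → Bool → Prop) :
    {x : {x : (C → Bool) × P // CubeCompat base ok x} // CubeIsolated base ok x.1.2} ≃
      {p : P // CubeIsolated base ok p} where
  toFun x := ⟨x.1.1.2, x.2⟩
  invFun p := ⟨⟨(fun c => (p.2.2 c).choose, p.1), p.2.1, fun c => (p.2.2 c).choose_spec.1⟩, p.2⟩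
  left_inv x := by
    obtain ⟨⟨⟨u, p⟩, h⟩, hp⟩ := x
    refine Subtype.ext (Subtype.ext (Prod.ext (funext fun c => ?_) rfl))
    exact ((hp.2 c).choose_spec.2 _ (h.2 c)).symm
  right_inv p := rfl

variable (b) in
/-- The coordinates of a chain at the isolated generators. -/
def isolatedCoords :
    M →ₗ[R] ({x : {x : (C → Bool) × P // CubeCompat base ok x} // CubeIsolated base ok x.1.2} →₀ R) :=
  Finsupp.lcomapDomain Subtype.val Subtype.val_injective ∘ₗ b.repr.toLinearMap

theorem isolatedCoords_gen {u : C → Bool} {p : P} (hp : ¬ CubeIsolated base ok p) :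
    isolatedCoords b (cubeGen b u p) = 0 := by
  classical
  by_cases h : CubeCompat base ok (u, p)
  · rw [cubeGen_of_compat b h]
    ext ⟨x, hx⟩
    simp only [isolatedCoords, LinearMap.comp_apply, LinearEquiv.coe_coe, Module.Basis.repr_self,
      Finsupp.lcomapDomain, LinearMap.coe_mk, AddHom.coe_mk, Finsupp.comapDomain_apply,
      Finsupp.zero_apply]
    rw [Finsupp.single_apply, if_neg]
    rintro rfl
    exact hp hx
  · rw [cubeGen_of_not_compat b h, map_zero]

theorem isolatedCoords_basis
    (x : {x : {x : (C → Bool) × P // CubeCompat base ok x} // CubeIsolated base ok x.1.2}) :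
    isolatedCoords b (b x.1) = Finsupp.single x 1 := by
  classical
  ext y
  simp [isolatedCoords, Finsupp.lcomapDomain, Finsupp.single_apply, Subtype.ext_iff]

theorem IsCubeDifferential.apply_isolated (hd : IsCubeDifferential b σ d) {u : C → Bool} {p : P}
    (h : CubeCompat base ok (u, p)) (hp : CubeIsolated base ok p) : d (cubeGen b u p) = 0 := by
  rw [hd u p h]
  refine Finset.sum_eq_zero fun c _ => ?_
  split_ifs with hu
  · rw [cubeGen_of_not_compat, smul_zero]
    intro h'
    have h1 := h.2 c
    have h2 := h'.2 c
    simp only [hu, Function.update_self] at h1 h2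
    exact Bool.false_ne_true ((hp.2 c).unique h1 h2)
  · rfl

theorem IsCubeDifferential.isolatedCoords_comp (hd : IsCubeDifferential b σ d) :
    isolatedCoords b ∘ₗ d = 0 := by
  refine b.ext fun ⟨⟨u, p⟩, h⟩ => ?_
  rw [LinearMap.comp_apply, ← cubeGen_of_compat b h, LinearMap.zero_apply]
  by_cases hp : CubeIsolated base ok p
  · rw [hd.apply_isolated h hp, map_zero]
  · rw [hd u p h, map_sum]
    refine Finset.sum_eq_zero fun c _ => ?_
    split_ifs
    · rw [map_smul, isolatedCoords_gen hp, smul_zero]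
    · exact map_zero _

/-- A surviving label either admits both choices in some direction, and is contracted along it, or
admits exactly one choice in every direction and is isolated. The identity is thus homotopic to the
projection onto the isolated generators. -/
theorem IsCubeDifferential.exists_homotopy (hd : IsCubeDifferential b σ d) (hσ : IsCubeSign σ) :
    ∃ h : M →ₗ[R] M, ∀ m,
      d (h m) + h (d m) + Finsupp.linearCombination R (fun x => b x.1) (isolatedCoords b m) = m := by
  classical
  let ch : P → Option C := fun p => if h : ∃ c, ∀ s, ok p c s then some h.choose else none
  refine ⟨cubeHomotopy b σ ch, fun m => ?_⟩
  suffices H : d ∘ₗ cubeHomotopy b σ ch + cubeHomotopy b σ ch ∘ₗ d +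
      Finsupp.linearCombination R (fun x => b x.1) ∘ₗ isolatedCoords b = LinearMap.id by
    exact LinearMap.congr_fun H m
  refine b.ext fun ⟨⟨u, p⟩, h⟩ => ?_
  simp only [LinearMap.add_apply, LinearMap.comp_apply, LinearMap.id_apply]
  by_cases hp : ∃ c, ∀ s, ok p c s
  · have hni : ¬ CubeIsolated base ok p := fun hi =>
      Bool.false_ne_true ((hi.2 hp.choose).unique (hp.choose_spec _) (hp.choose_spec _))
    rw [← cubeGen_of_compat b h, isolatedCoords_gen hni, map_zero, add_zero]
    exact hd.homotopy hσ (dif_pos hp) hp.choose_spec h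
  · have hi : CubeIsolated base ok p := by
      refine ⟨h.1, fun c => ⟨u c, h.2 c, fun s hs => ?_⟩⟩
      by_contra hne
      refine hp ⟨c, fun s' => ?_⟩
      have : s' = s ∨ s' = u c := by revert hne; cases s <;> cases s' <;> cases u c <;> simp
      rcases this with rfl | rfl
      exacts [hs, h.2 c]
    have h0 := hd.apply_isolated h hi
    rw [isolatedCoords_basis ⟨⟨(u, p), h⟩, hi⟩, ← cubeGen_of_compat b h, h0,
      cubeHomotopy_apply_of_none (dif_neg hp), map_zero, map_zero, Finsupp.linearCombination_single,
      cubeGen_of_compat b h]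
    simp

/-- The homology of a cube is free on the isolated generators. -/
theorem IsCubeDifferential.nonempty_homology_equiv (hd : IsCubeDifferential b σ d)
    (hσ : IsCubeSign σ) :
    Nonempty (Homology d ≃ₗ[R] ({p : P // CubeIsolated base ok p} →₀ R)) := by
  obtain ⟨h, hh⟩ := hd.exists_homotopy hσ
  let ρ := isolatedCoords b ∘ₗ (LinearMap.ker d).subtype
  have hsurj : Function.Surjective ρ := by
    intro y
    have h1 : d ∘ₗ Finsupp.linearCombination R (fun x : {x : {x : (C → Bool) × P //
        CubeCompat base ok x} // CubeIsolated base ok x.1.2} => b x.1) = 0 := by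
      refine Finsupp.lhom_ext' fun x => LinearMap.ext_ring ?_
      simp only [LinearMap.comp_apply, Finsupp.lsingle_apply, Finsupp.linearCombination_single,
        one_smul, LinearMap.zero_apply]
      exact cubeGen_of_compat b x.1.2 ▸ hd.apply_isolated x.1.2 x.2
    have h2 : isolatedCoords b ∘ₗ Finsupp.linearCombination R (fun x : {x : {x : (C → Bool) × P //
        CubeCompat base ok x} // CubeIsolated base ok x.1.2} => b x.1) = LinearMap.id := by
      refine Finsupp.lhom_ext' fun x => LinearMap.ext_ring ?_
      simp [isolatedCoords_basis]
    exact ⟨⟨_, LinearMap.congr_fun h1 y⟩, LinearMap.congr_fun h2 y⟩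
  -- A cycle `z` without isolated coordinates is the boundary of `h z`; conversely no boundary has
  -- isolated coordinates.
  have hker : LinearMap.ker ρ = (LinearMap.range d).submoduleOf (LinearMap.ker d) := by
    ext ⟨z, hz⟩
    rw [LinearMap.mem_ker, Submodule.submoduleOf, Submodule.mem_comap, LinearMap.mem_range]
    constructor
    · intro hz0
      refine ⟨h z, ?_⟩
      have := hh z
      rw [LinearMap.mem_ker.1 hz, map_zero, show isolatedCoords b z = 0 from hz0, map_zero] at this
      simpa using this
    · rintro ⟨y, hy⟩
      change isolatedCoords b z = 0
      rw [← show d y = z from hy]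
      exact LinearMap.congr_fun hd.isolatedCoords_comp y
  exact ⟨(Submodule.quotEquivOfEq _ _ hker.symm) ≪≫ₗ (ρ.quotKerEquivOfSurjective hsurj) ≪≫ₗ
    Finsupp.domLCongr (isolatedEquiv base ok)⟩

end Cube

/-! ### Degree-preserving parts of filtered maps -/

section Graded

set_option linter.unusedSectionVars false

variable {R M N ι κ J : Type*} [CommRing R] [AddCommGroup M] [Module R M]
  [AddCommGroup N] [Module R N] [Fintype ι] [DecidableEq ι] [Fintype κ] [DecidableEq κ]
  (bM : Module.Basis ι R M) (bN : Module.Basis κ R N) (degM : ι → ℤ) (degN : κ → ℤ)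

/-- The component of degree `δ`. -/
def homogeneousPart (δ : ℤ) : M →ₗ[R] M :=
  bM.constr R fun x => if degM x = δ then bM x else 0

theorem repr_homogeneousPart (δ : ℤ) (m : M) (x : ι) :
    bM.repr (homogeneousPart bM degM δ m) x = if degM x = δ then bM.repr m x else 0 := by
  rw [homogeneousPart, Module.Basis.constr_apply_fintype]
  simp only [map_sum, map_smul, Finsupp.coe_finsetSum, Finset.sum_apply, Finsupp.smul_apply,
    Module.Basis.equivFun_apply, apply_ite bM.repr, Module.Basis.repr_self, map_zero]
  rw [Finset.sum_eq_single x]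
  · split_ifs <;> simp
  · intro y _ hy
    split_ifs <;> simp [hy]
  · simp

theorem repr_degreePreservingPart (f : M →ₗ[R] N) (m : M) (y : κ) :
    bN.repr (degreePreservingPart bM bN degM degN f m) y =
      ∑ x, if degN y = degM x then bM.repr m x * bN.repr (f (bM x)) y else 0 := by
  rw [degreePreservingPart, Matrix.toLin_apply]
  simp only [map_sum, map_smul, Module.Basis.repr_self, Finsupp.coe_finsetSum, Finset.sum_apply,
    Finsupp.smul_apply, Finsupp.single_apply, smul_eq_mul, mul_ite, mul_one, mul_zero,
    Finset.sum_ite_eq', Finset.mem_univ, if_true]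
  rw [Matrix.mulVec, dotProduct]
  refine Finset.sum_congr rfl fun x _ => ?_
  rw [Matrix.of_apply, LinearMap.toMatrix_apply]
  split_ifs <;> simp [mul_comm]

/-- `m` has no components of degree less than `δ`. -/
def DegreeGE (δ : ℤ) (m : M) : Prop := ∀ x, bM.repr m x ≠ 0 → δ ≤ degM x

variable {bM bN degM degN}

theorem DegreeGE.zero (δ : ℤ) : DegreeGE bM degM δ (0 : M) := fun x hx => by simp at hx

theorem DegreeGE.smul {δ : ℤ} {m : M} (h : DegreeGE bM degM δ m) (r : R) :
    DegreeGE bM degM δ (r • m) := fun x hx => h x fun h0 => hx (by simp [h0])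

/-- For a map that does not lower degrees, the part of `f m` in the lowest degree `δ` can come only
from the part of `m` in degree `δ`: a basis vector of higher degree has its image above `δ`. This is
the passage to the associated graded map. -/
theorem degreePreservingPart_homogeneousPart {f : M →ₗ[R] N}
    (hf : ∀ x, DegreeGE bN degN (degM x) (f (bM x))) {δ : ℤ} {m : M}
    (hm : DegreeGE bM degM δ m) :
    degreePreservingPart bM bN degM degN f (homogeneousPart bM degM δ m) =
      homogeneousPart bN degN δ (f m) := by
  refine bN.ext_elem fun y => ?_
  rw [repr_degreePreservingPart, repr_homogeneousPart]
  have hfm : bN.repr (f m) y = ∑ x, bM.repr m x * bN.repr (f (bM x)) y := by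
    conv_lhs => rw [← bM.sum_repr m]
    simp only [map_sum, map_smul, Finsupp.coe_finsetSum, Finset.sum_apply, Finsupp.smul_apply,
      smul_eq_mul]
  split_ifs with hy
  · rw [hfm]
    refine Finset.sum_congr rfl fun x _ => ?_
    rw [repr_homogeneousPart]
    by_cases h1 : bM.repr m x = 0
    · simp [h1]
    by_cases h2 : bN.repr (f (bM x)) y = 0
    · simp [h2]
    have := hm x h1
    have := hf x y h2
    rw [if_pos (by omega), if_pos (by omega)]
  · refine Finset.sum_eq_zero fun x _ => ?_
    rw [repr_homogeneousPart]
    split_ifs with h1 h2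
    · exact absurd (h1.trans h2) hy
    · simp
    · rfl

/-- A map is filtered if it is so on a family that spans after inverting `s`. -/
theorem degreeGE_of_family [IsDomain R] [Fintype J] {f : M →ₗ[R] N} {e : J → M} {δ : J → ℤ}
    {s : R} (hs : s ≠ 0) {Q : J → ι → R} (hQ : ∀ x, s • bM x = ∑ j, Q j x • e j)
    (hδ : ∀ j x, Q j x ≠ 0 → degM x ≤ δ j) (hf : ∀ j, DegreeGE bN degN (δ j) (f (e j))) (x : ι) :
    DegreeGE bN degN (degM x) (f (bM x)) := by
  intro y hy
  have h1 : s * bN.repr (f (bM x)) y = ∑ j, Q j x * bN.repr (f (e j)) y := by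
    have := congrArg (fun m => bN.repr (f m) y) (hQ x)
    simpa using this
  obtain ⟨j, -, hj⟩ := Finset.exists_ne_zero_of_sum_ne_zero (h1 ▸ mul_ne_zero hs hy)
  exact (hδ j x (left_ne_zero_of_mul hj)).trans (hf j y (right_ne_zero_of_mul hj))

/-- Triangularity: in the expansion of `s • bM x` only `e j` with `degM x ≤ δ j` occur, and those
with strict inequality have no component in degree `degM x`. Taking that component leaves lowest
components alone. -/
theorem smul_basis_eq_sum_homogeneousPart [Fintype J] {e : J → M} {δ : J → ℤ}
    {s : R} {Q : J → ι → R} (hQ : ∀ x, s • bM x = ∑ j, Q j x • e j)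
    (hδ : ∀ j x, Q j x ≠ 0 → degM x ≤ δ j) (he : ∀ j, DegreeGE bM degM (δ j) (e j)) (x : ι) :
    s • bM x = ∑ j, (if δ j = degM x then Q j x else 0) • homogeneousPart bM degM (δ j) (e j) := by
  have h : s • bM x = homogeneousPart bM degM (degM x) (s • bM x) := by
    rw [map_smul, homogeneousPart, Module.Basis.constr_basis, if_pos rfl]
  rw [h, hQ, map_sum]
  refine Finset.sum_congr rfl fun j _ => ?_
  rw [map_smul]
  by_cases h1 : Q j x = 0
  · simp [h1]
  split_ifs with h2
  · rw [h2]
  · have := hδ j x h1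
    rw [zero_smul]
    convert smul_zero _
    refine bM.ext_elem fun y => ?_
    rw [repr_homogeneousPart]
    split_ifs with h3
    · by_contra h4
      have := he j y (by simpa using h4)
      omega
    · simp

end Graded

/-- A spanning family indexed like a basis is a basis. -/
theorem exists_basis_of_span {R M ι : Type*} [CommRing R] [AddCommGroup M] [Module R M]
    [Finite ι] (b : Module.Basis ι R M) (v : ι → M) (hv : ⊤ ≤ Submodule.span R (Set.range v)) :
    ∃ b' : Module.Basis ι R M, ⇑b' = v := by
  have : Module.Finite R M := Module.Finite.of_basis b
  have hsurj : Function.Surjective (b.constr R v) := by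
    rw [← LinearMap.range_eq_top, Module.Basis.constr_range]
    exact top_le_iff.1 hv
  have hbij : Function.Bijective (b.constr R v) :=
    ⟨OrzechProperty.injective_of_surjective_endomorphism _ hsurj, hsurj⟩
  refine ⟨b.map (LinearEquiv.ofBijective _ hbij), ?_⟩
  ext i
  rw [Module.Basis.map_apply, LinearEquiv.ofBijective_apply, Module.Basis.constr_basis]

/-! ### Alternating sums along a ray -/

/-- The alternating sum of the first `q` values of `f`. -/
def altSum (f : ℕ → ℤ) (q : ℕ) : ℤ := ∑ p ∈ Finset.range q, (-1) ^ p * f p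

theorem altSum_zero (f : ℕ → ℤ) : altSum f 0 = 0 := rfl

theorem altSum_succ (f : ℕ → ℤ) (q : ℕ) : altSum f (q + 1) = altSum f q + (-1) ^ q * f q :=
  Finset.sum_range_succ _ _

theorem altSum_congr {f g : ℕ → ℤ} {q : ℕ} (h : ∀ p < q, f p = g p) : altSum f q = altSum g q :=
  Finset.sum_congr rfl fun p hp => by rw [h p (Finset.mem_range.1 hp)]

theorem altSum_add_two {f : ℕ → ℤ} {q : ℕ} (h : f q = f (q + 1)) :
    altSum f (q + 2) = altSum f q := by
  rw [altSum_succ, altSum_succ, h]; ring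

/-- Inserting two neighbouring strands with equal labels changes no alternating sum beyond them: the
two new terms cancel, and the later strands move by two and keep their signs. -/
theorem altSum_shift {f g : ℕ → ℤ} {i q : ℕ} (hi : g i = g (i + 1)) (h1 : ∀ p < i, f p = g p)
    (hq : i ≤ q) (h2 : ∀ p, i ≤ p → p < q → f p = g (p + 2)) :
    altSum f q = altSum g (q + 2) := by
  induction q, hq using Nat.le_induction with
  | base => rw [altSum_add_two hi, altSum_congr h1]
  | succ q hq ih =>
    rw [altSum_succ, ih fun p hp hpq => h2 p hp (by omega), h2 q hq (by omega),
      show q + 1 + 2 = q + 2 + 1 by ring, altSum_succ g (q + 2)]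
    ring

theorem altSum_cross {f g : ℕ → ℤ} {i q : ℕ} (hq : i + 2 ≤ q)
    (h : ∀ p < q, p ≠ i → p ≠ i + 1 → f p = g p) :
    altSum g q - altSum f q = (-1) ^ i * ((g i - g (i + 1)) - (f i - f (i + 1))) := by
  induction q, hq using Nat.le_induction with
  | base =>
    rw [altSum_succ, altSum_succ, altSum_succ, altSum_succ,
      altSum_congr fun p hp => h p (by omega) (by omega) (by omega)]
    ring
  | succ q hq ih =>
    rw [altSum_succ, altSum_succ, h q (by omega) (by omega) (by omega), ← ih fun p hp => h p (by omega)]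
    ring

/-- The gap on the left of strand `p`, if the strands are directed alternately, strand `0`
counterclockwise. -/
def leftGap (p : ℕ) : ℕ := if Even p then p else p + 1

theorem altSum_leftGap_add_one {f : ℕ → ℤ} {q : ℕ} (h : f q = f (q + 1)) :
    altSum f (leftGap (q + 1)) = altSum f (leftGap q) := by
  by_cases hq : Even q
  · rw [leftGap, if_neg (by simpa [Nat.even_add_one] using hq), leftGap, if_pos hq,
      altSum_add_two h]
  · rw [leftGap, if_pos (by simpa [Nat.even_add_one] using hq), leftGap, if_neg hq]

theorem altSum_leftGap_congr {f g : ℕ → ℤ} {p q : ℕ} (hpq : Even p ↔ Even q) (h : f p = g q)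
    (hs : altSum f p = altSum g q) : altSum f (leftGap p) = altSum g (leftGap q) := by
  by_cases hp : Even p
  · rw [leftGap, if_pos hp, leftGap, if_pos (hpq.1 hp), hs]
  · have hq := fun hq => hp (hpq.2 hq)
    rw [leftGap, if_neg hp, leftGap, if_neg hq, altSum_succ, altSum_succ, hs, h,
      (Nat.not_even_iff_odd.1 hp).neg_one_pow, (Nat.not_even_iff_odd.1 hq).neg_one_pow]

/-! ### Labellings of the strands of a sector -/

namespace Slab

/-- The labels `f` on the start ray and `g` on the end ray agree along the arcs of a smoothing. -/
structure Respects {β : Type*} (S : Slab) (b : Bool) (m n : ℕ) (f g : ℕ → β) : Prop where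
  through : ∀ p q, p < m → q < n → S.SmoothThrough b p q → f p = g q
  cap : ∀ p q, p < m → q < m → S.SmoothCap b p q → f p = f q
  cup : ∀ p q, p < n → q < n → S.SmoothCup b p q → g p = g q

variable {S : Slab} {b : Bool} {m n : ℕ} {f g : ℕ → ℤ}

/-- Inside a sector, strands between a radial strand and the puncture appear, disappear or turn back
in neighbouring pairs with equal labels. Such pairs do not contribute to the alternating sum and
preserve the parity of strand numbers. -/
theorem Respects.altSum_through (hS : S.Fits m n) (h : S.Respects b m n f g) {p q : ℕ}
    (hp : p < m) (hq : q < n) (hpq : S.SmoothThrough b p q) :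
    (Even p ↔ Even q) ∧ altSum f p = altSum g q := by
  cases S with
  | id =>
    obtain rfl : n = m := hS
    obtain rfl : p = q := hpq
    exact ⟨Iff.rfl, altSum_congr fun r hr => h.through r r (by omega) (by omega) rfl⟩
  | birth i =>
    obtain ⟨hi, rfl⟩ : i ≤ m ∧ n = m + 2 := hS
    have hpq : q = if p < i then p else p + 2 := hpq
    have h1 : ∀ r < i, f r = g r := fun r hr =>
      h.through r r (by omega) (by omega) (show r = if r < i then r else r + 2 by simp [hr])
    have h2 : ∀ r, i ≤ r → r < m → f r = g (r + 2) := fun r hr hrm =>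
      h.through r (r + 2) hrm (by omega) (show _ = if r < i then r else r + 2 by simp [hr])
    have h3 : g i = g (i + 1) := h.cup i (i + 1) (by omega) (by omega) ⟨rfl, rfl⟩
    split_ifs at hpq with hpi
    · subst hpq
      exact ⟨Iff.rfl, altSum_congr fun r hr => h1 r (by omega)⟩
    · subst hpq
      exact ⟨by simp [Nat.even_add], altSum_shift h3 h1 (by omega) fun r hr hrp => h2 r hr (by omega)⟩
  | death i =>
    obtain ⟨hi, rfl⟩ : i ≤ n ∧ m = n + 2 := hS
    have hpq : p = if q < i then q else q + 2 := hpq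
    have h1 : ∀ r < i, g r = f r := fun r hr =>
      (h.through r r (by omega) (by omega) (show r = if r < i then r else r + 2 by simp [hr])).symm
    have h2 : ∀ r, i ≤ r → r < n → g r = f (r + 2) := fun r hr hrm =>
      (h.through (r + 2) r (by omega) hrm
        (show _ = if r < i then r else r + 2 by simp [hr])).symm
    have h3 : f i = f (i + 1) := h.cap i (i + 1) (by omega) (by omega) ⟨rfl, rfl⟩
    split_ifs at hpq with hpi
    · subst hpq
      exact ⟨Iff.rfl, altSum_congr fun r hr => (h1 r (by omega)).symm⟩
    · subst hpq
      exact ⟨by simp [Nat.even_add],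
        (altSum_shift h3 h1 (by omega) fun r hr hrp => h2 r hr (by omega)).symm⟩
  | cross i o =>
    obtain ⟨hi, rfl⟩ : i + 2 ≤ m ∧ n = m := hS
    obtain ⟨rfl, hpq⟩ : p = q ∧ (o ≠ b ∨ (p ≠ i ∧ p ≠ i + 1)) := hpq
    refine ⟨Iff.rfl, ?_⟩
    have h1 : ∀ r < n, r ≠ i → r ≠ i + 1 → f r = g r := fun r hr h1 h2 =>
      h.through r r hr hr ⟨rfl, Or.inr ⟨h1, h2⟩⟩
    by_cases hob : o = b
    · rcases hpq with h' | hpq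
      · exact absurd hob h'
      have h3 : f i = f (i + 1) := h.cap i (i + 1) (by omega) (by omega) ⟨hob, rfl, rfl⟩
      have h4 : g i = g (i + 1) := h.cup i (i + 1) (by omega) (by omega) ⟨hob, rfl, rfl⟩
      rcases lt_or_ge p i with hp' | hp'
      · exact altSum_congr fun r hr => h1 r (by omega) (by omega) (by omega)
      -- For a strand beyond the turned-back pair, both bracketed differences in `altSum_cross` are
      -- zero.
      · have := altSum_cross (f := f) (g := g) (i := i) (q := p) (by omega)
          fun r hr => h1 r (by omega)
        rw [h3, h4] at this
        simp at this
        linarith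
    · exact altSum_congr fun r hr => h.through r r (by omega) (by omega) ⟨rfl, Or.inl hob⟩

theorem Respects.altSum_total (hS : S.Fits m n) (h : S.Respects b m n f g) :
    altSum f m = altSum g n := by
  cases S with
  | id =>
    obtain rfl : n = m := hS
    exact altSum_congr fun r hr => h.through r r (by omega) (by omega) rfl
  | birth i =>
    obtain ⟨hi, rfl⟩ : i ≤ m ∧ n = m + 2 := hS
    refine altSum_shift (h.cup i (i + 1) (by omega) (by omega) ⟨rfl, rfl⟩) (fun r hr => ?_) hi
      fun r hr hrp => ?_
    · exact h.through r r (by omega) (by omega) (show r = if r < i then r else r + 2 by simp [hr])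
    · exact h.through r (r + 2) (by omega) (by omega)
        (show _ = if r < i then r else r + 2 by simp [hr])
  | death i =>
    obtain ⟨hi, rfl⟩ : i ≤ n ∧ m = n + 2 := hS
    refine (altSum_shift (h.cap i (i + 1) (by omega) (by omega) ⟨rfl, rfl⟩) (fun r hr => ?_) hi
      fun r hr hrp => ?_).symm
    · exact (h.through r r (by omega) (by omega)
        (show r = if r < i then r else r + 2 by simp [hr])).symm
    · exact (h.through (r + 2) r (by omega) (by omega)
        (show _ = if r < i then r else r + 2 by simp [hr])).symm
  | cross i o =>
    obtain ⟨hi, rfl⟩ : i + 2 ≤ m ∧ n = m := hS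
    by_cases hob : o = b
    · have h3 : f i = f (i + 1) := h.cap i (i + 1) (by omega) (by omega) ⟨hob, rfl, rfl⟩
      have h4 : g i = g (i + 1) := h.cup i (i + 1) (by omega) (by omega) ⟨hob, rfl, rfl⟩
      have := altSum_cross (f := f) (g := g) hi
          fun r hr h1 h2 => h.through r r hr hr ⟨rfl, Or.inr ⟨h1, h2⟩⟩
      rw [h3, h4] at this
      simp at this
      linarith
    · exact altSum_congr fun r hr => h.through r r hr hr ⟨rfl, Or.inl hob⟩

theorem smoothCap_succ {p q : ℕ} (h : S.SmoothCap b p q) : q = p + 1 := by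
  cases S with
  | death i => obtain ⟨rfl, rfl⟩ : p = i ∧ q = i + 1 := h; rfl
  | cross i o => obtain ⟨-, rfl, rfl⟩ : o = b ∧ p = i ∧ q = i + 1 := h; rfl
  | _ => exact h.elim

theorem smoothCup_succ {p q : ℕ} (h : S.SmoothCup b p q) : q = p + 1 := by
  cases S with
  | birth i => obtain ⟨rfl, rfl⟩ : p = i ∧ q = i + 1 := h; rfl
  | cross i o => obtain ⟨-, rfl, rfl⟩ : o = b ∧ p = i ∧ q = i + 1 := h; rfl
  | _ => exact h.elim

/-- The alternating sums at the left gaps are constant along arcs. -/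
theorem Respects.altSum_leftGap (hS : S.Fits m n) (h : S.Respects b m n f g) :
    S.Respects b m n (fun p => altSum f (leftGap p)) (fun q => altSum g (leftGap q)) where
  through p q hp hq hpq :=
    have h1 := h.altSum_through hS hp hq hpq
    altSum_leftGap_congr h1.1 (h.through p q hp hq hpq) h1.2
  cap p q hp hq hpq := by
    have h1 := h.cap p q hp hq hpq
    obtain rfl := smoothCap_succ hpq
    exact (altSum_leftGap_add_one h1).symm
  cup p q hp hq hpq := by
    have h1 := h.cup p q hp hq hpq
    obtain rfl := smoothCup_succ hpq
    exact (altSum_leftGap_add_one h1).symm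

end Slab

/-! ### Disjoint closed curves meeting a ray -/

open scoped Classical in
/-- The indicator function of a set of strands. -/
def hitInd (H : Set ℕ) (p : ℕ) : ℤ := if p ∈ H then 1 else 0

/-- The ray meets the pairwise disjoint curves `c : C` in the sets `H c` of strands, of which there
are `m` altogether; the curves, directed alternately along the ray, have no curve both on their
left and on their right. -/
structure RaySeparated {C : Type*} (m : ℕ) (H : C → Set ℕ) : Prop where
  lt : ∀ c, ∀ p ∈ H c, p < m
  cover : ∀ p < m, ∃! c, p ∈ H c
  left : ∀ c c' p p', p ∈ H c → p' ∈ H c →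
    altSum (hitInd (H c')) (leftGap p) = altSum (hitInd (H c')) (leftGap p')

theorem odd_altSum_hitInd (H : Set ℕ) (q : ℕ) :
    Odd (altSum (hitInd H) q) ↔ Odd {p | p < q ∧ p ∈ H}.ncard := by
  induction q with
  | zero => simp [altSum_zero]
  | succ q ih =>
    have hfin : {p | p < q ∧ p ∈ H}.Finite := (Set.finite_lt_nat q).subset fun p hp => hp.1
    rw [altSum_succ]
    by_cases hq : q ∈ H
    · have : {p | p < q + 1 ∧ p ∈ H} = insert q {p | p < q ∧ p ∈ H} := by
        ext p
        simp only [Set.mem_ofPred_eq, Set.mem_insert_iff]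
        constructor
        · rintro ⟨h1, h2⟩
          by_cases h : p = q
          · exact Or.inl h
          · exact Or.inr ⟨by omega, h2⟩
        · rintro (rfl | ⟨h1, h2⟩)
          exacts [⟨by omega, hq⟩, ⟨by omega, h2⟩]
      rw [this, Set.ncard_insert_of_notMem (by simp) hfin, Nat.odd_add_one, ← ih]
      have h1 : Odd ((-1 : ℤ) ^ q * hitInd H q) := by
        simp only [hitInd, hq, if_true, mul_one]
        exact Odd.pow (by decide)
      simp only [Int.odd_add, ← Int.not_odd_iff_even, h1, not_true, iff_false]
    · have : {p | p < q + 1 ∧ p ∈ H} = {p | p < q ∧ p ∈ H} := by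
        ext p
        simp only [Set.mem_ofPred_eq]
        constructor
        · rintro ⟨h1, h2⟩
          have : p ≠ q := by rintro rfl; exact hq h2
          exact ⟨by omega, h2⟩
        · rintro ⟨h1, h2⟩
          exact ⟨by omega, h2⟩
      rw [this, ← ih]
      simp [hitInd, hq]

theorem altSum_hitInd_of_forall_notMem {H : Set ℕ} {q q' : ℕ} (hqq : q ≤ q')
    (h : ∀ p, q ≤ p → p < q' → p ∉ H) : altSum (hitInd H) q' = altSum (hitInd H) q := by
  induction q', hqq using Nat.le_induction with
  | base => rfl
  | succ q' hqq ih =>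
    rw [altSum_succ, ih fun p h1 h2 => h p h1 (by omega), hitInd, if_neg (h q' hqq (by omega))]
    ring

namespace RaySeparated

set_option linter.unusedSectionVars false

variable {C : Type*} {m : ℕ} {H : C → Set ℕ} (hH : RaySeparated m H)
include hH

theorem altSum_first {c : C} : altSum (hitInd (H c)) (sInf (H c)) = 0 := by
  rw [altSum_hitInd_of_forall_notMem (Nat.zero_le _), altSum_zero]
  exact fun p _ hp => Nat.notMem_of_lt_sInf hp

/-- Along the ray, the alternating sum is the index of the gap with respect to `c`. By `left`, every
strand of `c` has the same index `l` on its left, hence `l + 1` on its right, so only these two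
values occur. The index of the innermost gap is `0`, and the parity of the first strand decides
whether this is `l` or `l + 1`. -/
theorem exists_side {c : C} (hc : (H c).Nonempty) (q : ℕ) :
    altSum (hitInd (H c)) q = 0 ∨ altSum (hitInd (H c)) q = (-1) ^ sInf (H c) := by
  set l := altSum (hitInd (H c)) (leftGap (sInf (H c))) with hl
  have h0 := hH.altSum_first (c := c)
  have hmem := Nat.sInf_mem hc
  have hl' : l = 0 ∧ (-1 : ℤ) ^ sInf (H c) = 1 ∨ l = -1 ∧ (-1 : ℤ) ^ sInf (H c) = -1 := by
    by_cases he : Even (sInf (H c))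
    · left
      rw [hl, leftGap, if_pos he, h0]
      exact ⟨rfl, he.neg_one_pow⟩
    · right
      have ho := (Nat.not_even_iff_odd.1 he).neg_one_pow (α := ℤ)
      rw [hl, leftGap, if_neg he, altSum_succ, h0, ho, hitInd, if_pos hmem]
      simp
  suffices h : altSum (hitInd (H c)) q = l ∨ altSum (hitInd (H c)) q = l + 1 by omega
  induction q with
  | zero => rw [altSum_zero]; omega
  | succ q ih =>
    by_cases hq : q ∈ H c
    · have h1 := hH.left c c _ _ hq hmem
      rw [← hl] at h1
      have h2 := altSum_succ (hitInd (H c)) q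
      rw [show hitInd (H c) q = 1 from if_pos hq] at h2
      by_cases he : Even q
      · rw [leftGap, if_pos he] at h1
        rw [he.neg_one_pow] at h2
        omega
      · rw [leftGap, if_neg he] at h1
        exact Or.inl h1
    · rw [altSum_hitInd_of_forall_notMem (Nat.le_succ q) fun p h1 h2 => by
        obtain rfl : p = q := by omega
        exact hq]
      exact ih

theorem odd_altSum_total (c : C) : Odd (altSum (hitInd (H c)) m) ↔ Odd (H c).ncard := by
  rw [odd_altSum_hitInd]
  have : {p | p < m ∧ p ∈ H c} = H c := by
    ext p
    exact ⟨fun h => h.2, fun h => ⟨hH.lt c p h, h⟩⟩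
  rw [this]

theorem altSum_of_not_odd {c : C} (hc : ¬ Odd (H c).ncard) : altSum (hitInd (H c)) m = 0 := by
  rw [← hH.odd_altSum_total] at hc
  rcases (H c).eq_empty_or_nonempty with h | h
  · rw [altSum_hitInd_of_forall_notMem (Nat.zero_le m), altSum_zero]
    simp [h]
  · rcases hH.exists_side h m with h1 | h1
    · exact h1
    · exact absurd (h1 ▸ Odd.pow (by decide)) hc

theorem nonempty_of_odd {c : C} (hc : Odd (H c).ncard) : (H c).Nonempty := by
  by_contra h
  rw [Set.not_nonempty_iff_eq_empty] at h
  simp [h] at hc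

theorem altSum_of_odd {c : C} (hc : Odd (H c).ncard) :
    altSum (hitInd (H c)) m = (-1) ^ sInf (H c) := by
  refine (hH.exists_side (hH.nonempty_of_odd hc) m).resolve_left fun h => ?_
  rw [← hH.odd_altSum_total, h] at hc
  simp at hc

/-- A curve disjoint from `c'` stays in a single region of its complement. At a strand of `c` the
gaps on both sides have the same index with respect to `c'`, so the left gap may be replaced by the
inner one. -/
theorem altSum_eq_of_mem_of_ne {c c' : C} (hcc : c ≠ c') {p p' : ℕ} (hp : p ∈ H c)
    (hp' : p' ∈ H c) : altSum (hitInd (H c')) p = altSum (hitInd (H c')) p' := by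
  have key : ∀ r ∈ H c, altSum (hitInd (H c')) (leftGap r) = altSum (hitInd (H c')) r := by
    intro r hr
    rw [leftGap]
    split_ifs
    · rfl
    · exact altSum_hitInd_of_forall_notMem (Nat.le_succ r) fun s h1 h2 => by
        obtain rfl : s = r := by omega
        exact fun h => hcc ((hH.cover s (hH.lt c s hr)).unique hr h)
  rw [← key p hp, ← key p' hp']
  exact hH.left c c' p p' hp hp'

/-- The index of an essential curve with respect to `c'` is odd exactly if `c'` is an essential
curve closer to the puncture. This makes the depth computable from indices. -/
theorem odd_altSum_at_first {c : C} (hc : Odd (H c).ncard) (c' : C) :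
    Odd (altSum (hitInd (H c')) (sInf (H c))) ↔
      Odd (H c').ncard ∧ sInf (H c') < sInf (H c) := by
  have hne := hH.nonempty_of_odd hc
  have hmem := Nat.sInf_mem hne
  by_cases hcc : c = c'
  · subst hcc
    simp [hH.altSum_first]
  by_cases hlt : ∃ p ∈ H c', p < sInf (H c)
  · obtain ⟨p, hp, hpc⟩ := hlt
    have hlt : sInf (H c') < sInf (H c) := (Nat.sInf_le hp).trans_lt hpc
    have h0 : ∀ r ∈ H c', altSum (hitInd (H c)) r = 0 := fun r hr => by
      rw [hH.altSum_eq_of_mem_of_ne (Ne.symm hcc) hr hp,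
        altSum_hitInd_of_forall_notMem (Nat.zero_le _), altSum_zero]
      exact fun s _ hs => Nat.notMem_of_lt_sInf (by omega)
    have hfin : (H c).Finite := (Set.finite_lt_nat m).subset (hH.lt c)
    obtain ⟨t, ht, htmax⟩ := hfin.exists_maximal hne
    have hmax : ∀ s ∈ H c, s ≤ t := fun s hs => by
      rcases le_total s t with h | h
      exacts [h, htmax hs h]
    -- At every strand of `c'` the index with respect to `c` is `0`, as it is at a strand before `c`
    -- begins. Beyond the last strand `t` of `c` that index is `±1`, so `c'` has no strand there.
    have h1 : altSum (hitInd (H c')) m = altSum (hitInd (H c')) t := by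
      refine altSum_hitInd_of_forall_notMem (hH.lt c t ht).le fun r hr1 hr2 hr => ?_
      have hrt : r ≠ t := by
        rintro rfl
        exact hcc ((hH.cover r hr2).unique ht hr)
      have h2 := h0 r hr
      rw [← altSum_hitInd_of_forall_notMem hr2.le fun s hs1 _ hs => by
        have := hmax s hs; omega, hH.altSum_of_odd hc] at h2
      exact absurd h2 (by simp)
    rw [hH.altSum_eq_of_mem_of_ne hcc hmem ht, ← h1, hH.odd_altSum_total]
    simp [hlt]
  · push Not at hlt
    rw [altSum_hitInd_of_forall_notMem (Nat.zero_le _) fun s _ hs hsc =>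
      absurd (hlt s hsc) (by omega), altSum_zero]
    simp only [Int.not_odd_zero, false_iff, not_and]
    intro ho
    exact not_lt.2 (hlt _ (Nat.sInf_mem (hH.nonempty_of_odd ho)))

/-- Signs do not matter modulo `2`, and every strand belongs to exactly one curve, so the sum counts
the first `q` strands. -/
theorem sum_altSum_mod_two [Fintype C] {q : ℕ} (hq : q ≤ m) :
    ((∑ c, altSum (hitInd (H c)) q : ℤ) : ZMod 2) = q := by
  induction q with
  | zero => simp [altSum_zero]
  | succ q ih =>
    simp only [altSum_succ, Finset.sum_add_distrib]
    obtain ⟨c, hc, hu⟩ := hH.cover q (by omega)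
    rw [Int.cast_add, ih (by omega), Finset.sum_eq_single c]
    · rw [hitInd, if_pos hc]
      rcases Nat.even_or_odd q with h | h
      · simp [h.neg_one_pow]
      · simp [h.neg_one_pow]
    · intro c' _ hne
      rw [hitInd, if_neg fun h => hne (hu c' h), mul_zero]
    · simp

/-- An essential curve meets the ray first in a strand whose number has the parity of its depth. -/
theorem even_depth_iff [Finite C] {c : C} (hc : Odd (H c).ncard) :
    Even ({c' | Odd (H c').ncard ∧ sInf (H c') < sInf (H c)}.ncard) ↔ Even (sInf (H c)) := by
  classical
  have := Fintype.ofFinite C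
  have hle := (hH.lt c _ (Nat.sInf_mem (hH.nonempty_of_odd hc))).le
  have h := hH.sum_altSum_mod_two hle
  rw [Int.cast_sum] at h
  have h1 : ∀ c', ((altSum (hitInd (H c')) (sInf (H c)) : ℤ) : ZMod 2) =
      if Odd (H c').ncard ∧ sInf (H c') < sInf (H c) then 1 else 0 := by
    intro c'
    have hiff := hH.odd_altSum_at_first hc c'
    split_ifs with ho
    · exact ZMod.intCast_eq_one_iff_odd.2 (hiff.2 ho)
    · exact (ZMod.intCast_eq_zero_iff_even).2 (Int.not_odd_iff_even.1 fun h => ho (hiff.1 h))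
  simp only [h1, Finset.sum_boole] at h
  rw [← ZMod.natCast_eq_zero_iff_even, ← ZMod.natCast_eq_zero_iff_even, ← h, Set.ncard_eq_toFinset_card']
  simp

open scoped Classical in
/-- The winding number of a curve around the puncture. -/
theorem altSum_total [Finite C] (c : C) : altSum (hitInd (H c)) m =
    if Odd (H c).ncard then
      (if Even ({c' | Odd (H c').ncard ∧ sInf (H c') < sInf (H c)}.ncard) then 1 else -1)
    else 0 := by
  split_ifs with h1 h2
  · rw [hH.altSum_of_odd h1, ((hH.even_depth_iff h1).1 h2).neg_one_pow]
  · rw [hH.altSum_of_odd h1,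
      (Nat.not_even_iff_odd.1 fun h => h2 ((hH.even_depth_iff h1).2 h)).neg_one_pow]
  · exact hH.altSum_of_not_odd h1

end RaySeparated

theorem Slab.Respects.congr {β : Type*} {S : Slab} {b : Bool} {m n : ℕ} {f g f' g' : ℕ → β}
    (h : S.Respects b m n f g) (hf : ∀ p < m, f' p = f p) (hg : ∀ q < n, g' q = g q) :
    S.Respects b m n f' g' where
  through p q hp hq hpq := by rw [hf p hp, hg q hq, h.through p q hp hq hpq]
  cap p q hp hq hpq := by rw [hf p hp, hf q hq, h.cap p q hp hq hpq]
  cup p q hp hq hpq := by rw [hg p hp, hg q hq, h.cup p q hp hq hpq]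

namespace Diagram

variable (D : Diagram) {β γ : Type*} [Zero β] [Zero γ]

/-! ### Labellings of the points of a diagram -/

/-- The label of strand `p` on ray `j`. -/
def strand (Φ : D.Point → β) (j : Fin (D.N + 1)) (p : ℕ) : β :=
  if h : p < D.width j then Φ ⟨(j, p), h⟩ else 0

theorem strand_of_lt (Φ : D.Point → β) {j : Fin (D.N + 1)} {p : ℕ} (h : p < D.width j) :
    D.strand Φ j p = Φ ⟨(j, p), h⟩ := dif_pos h

/-- A labelling of the points is constant on the arcs of a smoothing of sector `j`. -/
def SectorCompat (Φ : D.Point → β) (j : Fin (D.N + 1)) (b : Bool) : Prop :=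
  (D.slab j).Respects b (D.width j) (D.width (j + 1)) (D.strand Φ j) (D.strand Φ (j + 1))

/-- A labelling of the points is constant on the circles of a smoothing. -/
def Compat (u : D.Vertex) (Φ : D.Point → β) : Prop := ∀ j, D.SectorCompat Φ j (D.bit u j)

variable {D}

theorem SectorCompat.comp₂ {δ : Type*} [Zero δ] {Φ : D.Point → β} {Ψ : D.Point → γ}
    {j : Fin (D.N + 1)} {b : Bool}
    (h : D.SectorCompat Φ j b) (h' : D.SectorCompat Ψ j b) (s : β → γ → δ) :
    D.SectorCompat (fun x => s (Φ x) (Ψ x)) j b where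
  through p q hp hq hpq := by
    have h1 := h.through p q hp hq hpq
    have h2 := h'.through p q hp hq hpq
    rw [strand_of_lt _ _ hp, strand_of_lt _ _ hq] at *
    rw [h1, h2]
  cap p q hp hq hpq := by
    have h1 := h.cap p q hp hq hpq
    have h2 := h'.cap p q hp hq hpq
    rw [strand_of_lt _ _ hp, strand_of_lt _ _ hq] at *
    rw [h1, h2]
  cup p q hp hq hpq := by
    have h1 := h.cup p q hp hq hpq
    have h2 := h'.cup p q hp hq hpq
    rw [strand_of_lt _ _ hp, strand_of_lt _ _ hq] at *
    rw [h1, h2]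

theorem compat_iff_arc {u : D.Vertex} {Φ : D.Point → β} :
    D.Compat u Φ ↔ ∀ x y, D.Arc u x y → Φ x = Φ y := by
  constructor
  · rintro h ⟨⟨j1, p⟩, hp⟩ ⟨⟨j2, q⟩, hq⟩ ⟨j, ⟨h1, h2, h3⟩ | ⟨h1, h2, h3⟩ | ⟨h1, h2, h3⟩⟩
    · dsimp only at h1 h2 hp hq
      subst h1 h2
      simpa [strand_of_lt _ _ hp, strand_of_lt _ _ hq] using (h j1).through p q hp hq h3
    · dsimp only at h1 h2 hp hq
      subst h1 h2
      simpa [strand_of_lt _ _ hp, strand_of_lt _ _ hq] using (h j2).cap p q hp hq h3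
    · dsimp only at h1 h2 hp hq
      subst h1 h2
      simpa [strand_of_lt _ _ hp, strand_of_lt _ _ hq] using (h j).cup p q hp hq h3
  · intro h j
    refine ⟨fun p q hp hq hpq => ?_, fun p q hp hq hpq => ?_, fun p q hp hq hpq => ?_⟩
    · rw [strand_of_lt _ _ hp, strand_of_lt _ _ hq]
      exact h _ _ ⟨j, Or.inl ⟨rfl, rfl, hpq⟩⟩
    · rw [strand_of_lt _ _ hp, strand_of_lt _ _ hq]
      exact h _ _ ⟨j, Or.inr (Or.inl ⟨rfl, rfl, hpq⟩)⟩
    · rw [strand_of_lt _ _ hp, strand_of_lt _ _ hq]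
      exact h _ _ ⟨j, Or.inr (Or.inr ⟨rfl, rfl, hpq⟩)⟩

theorem Compat.eq_of_circ_eq {u : D.Vertex} {Φ : D.Point → β} (h : D.Compat u Φ) {x y : D.Point}
    (hxy : D.circ u x = D.circ u y) : Φ x = Φ y :=
  congrArg (Quot.lift Φ (compat_iff_arc.1 h)) hxy

theorem compat_comp_circ {u : D.Vertex} (φ : D.Circles u → β) :
    D.Compat u fun x => φ (D.circ u x) :=
  compat_iff_arc.2 fun _ _ h => congrArg φ (Quot.sound h)

theorem circ_out {u : D.Vertex} (e : D.Circles u) : D.circ u (Quot.out e) = e := Quot.out_eq e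

theorem Compat.apply_out {u : D.Vertex} {Φ : D.Point → β} (h : D.Compat u Φ) (x : D.Point) :
    Φ (Quot.out (D.circ u x)) = Φ x := h.eq_of_circ_eq (circ_out _)

/-! ### Conservation of alternating sums -/

theorem SectorCompat.altSum_eq {Φ : D.Point → ℤ} {j : Fin (D.N + 1)} {b : Bool}
    (h : D.SectorCompat Φ j b) :
    altSum (D.strand Φ (j + 1)) (D.width (j + 1)) = altSum (D.strand Φ j) (D.width j) :=
  (h.altSum_total (D.fits j)).symm

/-- The rays are arranged cyclically, so the changes of the alternating sum over all sectors add up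
to `0`. If all sectors but one conserve it, so does the last. -/
theorem altSum_eq_of_compl {Φ : D.Point → ℤ} {k : Fin (D.N + 1)}
    (h : ∀ j, j ≠ k → ∃ b, D.SectorCompat Φ j b) :
    altSum (D.strand Φ (k + 1)) (D.width (k + 1)) = altSum (D.strand Φ k) (D.width k) := by
  let w : Fin (D.N + 1) → ℤ := fun j => altSum (D.strand Φ j) (D.width j)
  have h1 : ∑ j, (w (j + 1) - w j) = 0 := by
    rw [Finset.sum_sub_distrib, sub_eq_zero]
    exact Equiv.sum_comp (Equiv.addRight (1 : Fin (D.N + 1))) w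
  rw [Finset.sum_eq_single k (fun j _ hj => by
    obtain ⟨b, hb⟩ := h j hj
    rw [sub_eq_zero]
    exact hb.altSum_eq) (by simp)] at h1
  exact sub_eq_zero.1 h1

theorem Compat.leftGap {u : D.Vertex} {Φ : D.Point → ℤ} (h : D.Compat u Φ) :
    D.Compat u fun x => altSum (D.strand Φ x.1.1) (leftGap x.1.2) := fun j =>
  ((h j).altSum_leftGap (D.fits j)).congr (fun _ hp => strand_of_lt _ _ hp)
    fun _ hq => strand_of_lt _ _ hq

/-! ### The winding numbers of the circles of a smoothing -/

/-- The indicator function of a circle. -/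
def circInd {u : D.Vertex} (c : D.Circles u) (x : D.Point) : ℤ := if D.circ u x = c then 1 else 0

theorem strand_circInd {u : D.Vertex} (c : D.Circles u) :
    D.strand (circInd c) 0 = hitInd (D.hits u c) := by
  funext p
  rw [strand, hitInd]
  by_cases h : p < D.width 0
  · rw [dif_pos h]
    simp [circInd, hits, h]
  · rw [dif_neg h, if_neg]
    rintro ⟨h', -⟩
    exact h h'

/-- The field `left` holds because the index of the left gap with respect to `c'` is itself a
labelling that is constant along arcs (`Compat.leftGap`), hence constant on every circle. -/
theorem raySeparated (u : D.Vertex) : RaySeparated (D.width 0) (D.hits u) where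
  lt := by
    rintro c p ⟨h, -⟩
    exact h
  cover p hp := by
    refine ⟨D.circ u ⟨(0, p), hp⟩, ⟨hp, rfl⟩, ?_⟩
    rintro c ⟨h, rfl⟩
    rfl
  left c c' p p' hp hp' := by
    obtain ⟨hp1, hp2⟩ := hp
    obtain ⟨hp1', hp2'⟩ := hp'
    have h : D.Compat u (circInd c') := compat_comp_circ fun e => if e = c' then (1 : ℤ) else 0
    have := h.leftGap.eq_of_circ_eq (hp2.trans hp2'.symm)
    simpa only [strand_circInd] using this

open scoped Classical in
/-- The winding number of a circle around the puncture, when the circle is directed so that the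
strands with even number run counterclockwise. -/
def winding (u : D.Vertex) (c : D.Circles u) : ℤ :=
  if D.IsEssential u c then (if Even (D.depth u c) then 1 else -1) else 0

/-- Essentiality and depth enter the grading only through this number. As an alternating sum over
ray `0` it can be added over all circles without reference to the smoothing. -/
theorem winding_eq_altSum (u : D.Vertex) (c : D.Circles u) :
    winding u c = altSum (D.strand (circInd c) 0) (D.width 0) := by
  rw [strand_circInd, (raySeparated u).altSum_total]
  unfold winding IsEssential depth IsEssential
  split_ifs <;> rfl

theorem sum_winding_mul {u : D.Vertex} (s : D.Circles u → ℤ) :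
    ∑ c, winding u c * s c =
      altSum (D.strand (fun x => s (D.circ u x)) 0) (D.width 0) := by
  simp only [winding_eq_altSum, altSum, Finset.sum_mul]
  rw [Finset.sum_comm]
  refine Finset.sum_congr rfl fun p hp => ?_
  have hp := Finset.mem_range.1 hp
  simp only [strand_of_lt _ _ hp, mul_assoc, ← Finset.mul_sum, circInd]
  simp

/-! ### The four points at a crossing -/

/-- The strand `i + 1` on the start ray at a crossing of the strands `i` and `i + 1`. -/
def innerAbove (c : D.Crossing) : D.Point :=
  ⟨(c.1, (D.slab c.1).pos + 1), (D.crossing_fits c).1⟩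

/-- The strand `i` on the end ray at a crossing of the strands `i` and `i + 1`. -/
def outerBelow (c : D.Crossing) : D.Point :=
  ⟨(c.1 + 1, (D.slab c.1).pos), Nat.lt_of_succ_lt (D.crossing_fits c).2⟩

/-- The smoothing of a crossing that is not radial. -/
def turnBit (c : D.Crossing) : Bool :=
  match D.slab c.1 with
  | Slab.cross _ o => o
  | _ => false

theorem slab_crossing (c : D.Crossing) :
    D.slab c.1 = Slab.cross (D.slab c.1).pos (turnBit c) := by
  have := c.2
  unfold turnBit
  revert this
  generalize D.slab c.1 = S
  cases S <;> simp [Slab.isCross, Slab.pos]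

theorem width_crossing (c : D.Crossing) : D.width (c.1 + 1) = D.width c.1 := by
  have h := D.fits c.1
  rw [slab_crossing c] at h
  exact h.2

/-- A labelling is constant on the radial strands away from a crossing in the same sector. -/
def AwayCompat (Φ : D.Point → β) (c : D.Crossing) : Prop :=
  ∀ p, p < D.width c.1 → p ≠ (D.slab c.1).pos → p ≠ (D.slab c.1).pos + 1 →
    D.strand Φ c.1 p = D.strand Φ (c.1 + 1) p

theorem sectorCompat_crossing_iff {Φ : D.Point → β} {c : D.Crossing} {b : Bool} :
    D.SectorCompat Φ c.1 b ↔ AwayCompat Φ c ∧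
      if b = turnBit c then
        Φ (D.inner c) = Φ (innerAbove c) ∧ Φ (outerBelow c) = Φ (D.outer c)
      else Φ (D.inner c) = Φ (outerBelow c) ∧ Φ (innerAbove c) = Φ (D.outer c) := by
  have hw := width_crossing c
  have hlt := D.crossing_fits c
  have e1 : D.strand Φ c.1 (D.slab c.1).pos = Φ (D.inner c) := strand_of_lt _ _ _
  have e2 : D.strand Φ c.1 ((D.slab c.1).pos + 1) = Φ (innerAbove c) := strand_of_lt _ _ _
  have e3 : D.strand Φ (c.1 + 1) (D.slab c.1).pos = Φ (outerBelow c) := strand_of_lt _ _ _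
  have e4 : D.strand Φ (c.1 + 1) ((D.slab c.1).pos + 1) = Φ (D.outer c) := strand_of_lt _ _ _
  rw [← e1, ← e2, ← e3, ← e4]
  unfold SectorCompat AwayCompat
  have hS := slab_crossing c
  generalize turnBit c = o at *
  generalize (D.slab c.1).pos = i at *
  rw [hS, hw]
  rw [hw] at hlt
  generalize D.strand Φ c.1 = f
  generalize D.strand Φ (c.1 + 1) = g
  generalize D.width c.1 = m at *
  constructor
  · intro h
    refine ⟨fun p hp h1 h2 => h.through p p hp hp ⟨rfl, Or.inr ⟨h1, h2⟩⟩, ?_⟩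
    split_ifs with hb
    · exact ⟨h.cap i (i + 1) (by omega) (by omega) ⟨hb.symm, rfl, rfl⟩,
        h.cup i (i + 1) (by omega) (by omega) ⟨hb.symm, rfl, rfl⟩⟩
    · exact ⟨h.through i i (by omega) (by omega) ⟨rfl, Or.inl (Ne.symm hb)⟩,
        h.through (i + 1) (i + 1) (by omega) (by omega) ⟨rfl, Or.inl (Ne.symm hb)⟩⟩
  · rintro ⟨h1, h2⟩
    refine ⟨fun p q hp hq hpq => ?_, fun p q hp hq hpq => ?_, fun p q hp hq hpq => ?_⟩
    · obtain ⟨rfl, h3⟩ : p = q ∧ (o ≠ b ∨ (p ≠ i ∧ p ≠ i + 1)) := hpq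
      by_cases hpi : p = i
      · subst hpi
        rw [if_neg (by rintro rfl; simp at h3)] at h2
        exact h2.1
      by_cases hpi' : p = i + 1
      · subst hpi'
        rw [if_neg (by rintro rfl; simp at h3)] at h2
        exact h2.2
      exact h1 p hp hpi hpi'
    · obtain ⟨rfl, rfl, rfl⟩ : o = b ∧ p = i ∧ q = i + 1 := hpq
      rw [if_pos rfl] at h2
      exact h2.1
    · obtain ⟨rfl, rfl, rfl⟩ : o = b ∧ p = i ∧ q = i + 1 := hpq
      rw [if_pos rfl] at h2
      exact h2.2

/-- No condition is imposed on the four points at `c`. The other sectors conserve the alternating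
sum, so the sector of `c` must do so as well, and there only these four points can change it. -/
theorem AwayCompat.add_eq_add {Φ : D.Point → ℤ} {c : D.Crossing} (h : AwayCompat Φ c)
    (h' : ∀ j, j ≠ c.1 → ∃ b, D.SectorCompat Φ j b) :
    Φ (D.inner c) + Φ (D.outer c) = Φ (innerAbove c) + Φ (outerBelow c) := by
  have hw := width_crossing c
  have hlt := D.crossing_fits c
  have e1 : D.strand Φ c.1 (D.slab c.1).pos = Φ (D.inner c) := strand_of_lt _ _ _
  have e2 : D.strand Φ c.1 ((D.slab c.1).pos + 1) = Φ (innerAbove c) := strand_of_lt _ _ _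
  have e3 : D.strand Φ (c.1 + 1) (D.slab c.1).pos = Φ (outerBelow c) := strand_of_lt _ _ _
  have e4 : D.strand Φ (c.1 + 1) ((D.slab c.1).pos + 1) = Φ (D.outer c) := strand_of_lt _ _ _
  have h1 := altSum_eq_of_compl h'
  rw [hw] at h1
  have h2 := altSum_cross (f := D.strand Φ c.1) (g := D.strand Φ (c.1 + 1))
    (i := (D.slab c.1).pos) (q := D.width c.1) hlt.1 h
  rw [h1, sub_self, e1, e2, e3, e4] at h2
  rcases mul_eq_zero.1 h2.symm with h3 | h3
  · exact absurd h3 (pow_ne_zero _ (by norm_num))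
  · linarith

end Diagram

/-! ### Orientations of one-dimensional manifolds -/

/-- Two fixed-point-free involutions are reversed by a common two-colouring. -/
theorem exists_alternating_coloring {H : Type*} {r θ : H → H} (hr : Function.Involutive r)
    (hθ : Function.Involutive θ) (hr' : ∀ x, r x ≠ x) (hθ' : ∀ x, θ x ≠ x) :
    ∃ o : H → Fin 2, ∀ x, o (r x) = o x + 1 ∧ o (θ x) = o x + 1 := by
  classical
  let R : Equiv.Perm H := hr.toPerm
  let T : Equiv.Perm H := hθ.toPerm
  let τ : Equiv.Perm H := R * T
  have hRR : R * R = 1 := by ext x; exact hr x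
  have hTT : T * T = 1 := by ext x; exact hθ x
  have hconj : R * τ * R⁻¹ = τ⁻¹ := by
    have h1 : R⁻¹ = R := inv_eq_of_mul_eq_one_left hRR
    have h2 : τ⁻¹ = T * R := by
      rw [mul_inv_rev, h1, inv_eq_of_mul_eq_one_left hTT]
    rw [h2, h1, ← mul_assoc, hRR, one_mul]
  have hpow : ∀ (n : ℤ) (x : H), R ((τ ^ n) x) = (τ ^ (-n)) (R x) := by
    intro n x
    have h : (R * τ * R⁻¹) ^ n = R * τ ^ n * R⁻¹ := conj_zpow
    rw [hconj, inv_zpow'] at h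
    rw [h]
    simp
  -- If `r x = τⁿ x`, the point halfway between is fixed by `r` when `n` is even and by `θ` when `n`
  -- is odd.
  have hno : ∀ x, ¬ τ.SameCycle x (R x) := by
    rintro x ⟨n, hn⟩
    rcases Int.even_or_odd' n with ⟨k, rfl | rfl⟩
    · refine hr' ((τ ^ k) x) ?_
      change R ((τ ^ k) x) = _
      rw [hpow, ← hn, ← Equiv.Perm.mul_apply, ← zpow_add]
      congr 2; ring
    · refine hθ' ((τ ^ k) x) (R.injective ?_)
      change τ ((τ ^ k) x) = _
      rw [hpow, ← hn, ← Equiv.Perm.mul_apply, ← Equiv.Perm.mul_apply, ← zpow_add, ← zpow_one_add]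
      congr 2; ring
  let q : H → Quotient (Equiv.Perm.SameCycle.setoid τ) := fun x => Quotient.mk _ x
  have hq : ∀ x y, q x = q y ↔ τ.SameCycle x y := fun x y => Quotient.eq
  have hqR : ∀ x y, q x = q y → q (R x) = q (R y) := by
    intro x y h
    obtain ⟨n, rfl⟩ := (hq x y).1 h
    rw [hq, hpow]
    exact ⟨-n, rfl⟩
  -- Each orbit of the group generated by `r` and `θ` is a pair of distinct `τ`-cycles exchanged by
  -- `r`; a well-ordering selects the one coloured `0`.
  let o : H → Fin 2 := fun x => if WellOrderingRel (q x) (q (R x)) then 0 else 1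
  have ho : ∀ x, o (R x) = o x + 1 := by
    intro x
    have h1 : R (R x) = x := hr x
    have hne : q x ≠ q (R x) := fun h => hno x ((hq _ _).1 h)
    simp only [o, h1]
    by_cases h : WellOrderingRel (q x) (q (R x))
    · rw [if_pos h, if_neg (asymm h)]; rfl
    · rw [if_neg h, if_pos]
      · rfl
      · exact ((trichotomous_of WellOrderingRel (q x) (q (R x))).resolve_left h).resolve_left hne
  have hoc : ∀ x y, q x = q y → o x = o y := fun x y h => by
    simp only [o, h, hqR x y h]
  refine ⟨o, fun x => ⟨ho x, ?_⟩⟩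
  rw [← ho x]
  refine hoc _ _ ?_
  have h1 : θ x = R (τ x) := (hr (θ x)).symm
  rw [h1]
  refine hqR _ _ ((hq _ _).2 ?_)
  exact ⟨-1, by simp⟩

/-! ### Resolved sectors -/

namespace Slab

/-- The radial strands of a sector, the crossing being kept (`none`) or smoothed (`some b`). -/
def ResThrough (S : Slab) : Option Bool → ℕ → ℕ → Prop
  | none => S.Strand
  | some b => S.SmoothThrough b

/-- The arcs with both ends on the start ray. -/
def ResCap (S : Slab) : Option Bool → ℕ → ℕ → Prop
  | none => fun p q => S = death p ∧ q = p + 1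
  | some b => S.SmoothCap b

/-- The arcs with both ends on the end ray. -/
def ResCup (S : Slab) : Option Bool → ℕ → ℕ → Prop
  | none => fun p q => S = birth p ∧ q = p + 1
  | some b => S.SmoothCup b

/-- The other end of an arc in a sector; `true` stands for the start ray. -/
def go : Slab → Option Bool → Bool × ℕ → Bool × ℕ
  | id, _, x => (!x.1, x.2)
  | birth i, _, x =>
    if x.1 then (false, if x.2 < i then x.2 else x.2 + 2)
    else if x.2 < i then (true, x.2) else if x.2 = i then (false, i + 1)
    else if x.2 = i + 1 then (false, i) else (true, x.2 - 2)
  | death i, _, x =>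
    if x.1 then if x.2 < i then (false, x.2) else if x.2 = i then (true, i + 1)
      else if x.2 = i + 1 then (true, i) else (false, x.2 - 2)
    else (true, if x.2 < i then x.2 else x.2 + 2)
  | cross i _, none, x => (!x.1, if x.2 = i then i + 1 else if x.2 = i + 1 then i else x.2)
  | cross i o, some b, x =>
    if o = b then if x.2 = i then (x.1, i + 1) else if x.2 = i + 1 then (x.1, i) else (!x.1, x.2)
    else (!x.1, x.2)

variable {S : Slab} {m n : ℕ}

theorem go_lt (hS : S.Fits m n) (r : Option Bool) {x : Bool × ℕ}
    (hx : x.2 < if x.1 then m else n) : (S.go r x).2 < if (S.go r x).1 then m else n := by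
  obtain ⟨s, p⟩ := x
  cases S <;> cases r <;> cases s <;> simp only [Fits, go] at * <;> split_ifs at * <;>
    simp_all <;> omega

theorem go_go (hS : S.Fits m n) (r : Option Bool) {x : Bool × ℕ}
    (hx : x.2 < if x.1 then m else n) : S.go r (S.go r x) = x := by
  obtain ⟨s, p⟩ := x
  cases S <;> cases r <;> cases s <;> simp only [Fits, go] at * <;> grind

theorem go_ne (r : Option Bool) (x : Bool × ℕ) : S.go r x ≠ x := by
  obtain ⟨s, p⟩ := x
  cases S <;> cases r <;> cases s <;> simp only [go] at * <;> grind

theorem ResThrough.go_eq {r : Option Bool} {p q : ℕ} (h : S.ResThrough r p q) :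
    S.go r (true, p) = (false, q) := by
  cases S <;> cases r <;> simp only [go, ResThrough, Strand, SmoothThrough] at * <;> grind

theorem ResCap.go_eq {r : Option Bool} {p q : ℕ} (h : S.ResCap r p q) :
    S.go r (true, p) = (true, q) := by
  cases S <;> cases r <;> simp only [go, ResCap, SmoothCap] at * <;> grind

theorem ResCup.go_eq {r : Option Bool} {p q : ℕ} (h : S.ResCup r p q) :
    S.go r (false, p) = (false, q) := by
  cases S <;> cases r <;> simp only [go, ResCup, SmoothCup] at * <;> grind

/-- The labels orient the arcs of a sector: `0` is counterclockwise, `1` is clockwise. -/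
structure Orients (S : Slab) (r : Option Bool) (m n : ℕ) (f g : ℕ → Fin 2) : Prop where
  through : ∀ p q, p < m → q < n → S.ResThrough r p q → f p = g q
  cap : ∀ p q, p < m → q < m → S.ResCap r p q → f q = f p + 1
  cup : ∀ p q, p < n → q < n → S.ResCup r p q → g q = g p + 1

end Slab

namespace Diagram

variable {D : Diagram}

/-- An orientation of the curves obtained by smoothing some of the crossings. -/
def IsOrientation (r : Fin (D.N + 1) → Option Bool) (o : D.Point → Fin 2) : Prop :=
  ∀ j, (D.slab j).Orients (r j) (D.width j) (D.width (j + 1)) (D.strand o j) (D.strand o (j + 1))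

/-- The set `H` consists of the ends of arcs: a sector, one of its two rays (`true` for the start
ray) and a strand. The involution `θ` goes to the other end of the arc and `ρ` to the other side of
the ray. An alternating colouring of the ends says which of them are incoming and which are
outgoing. -/
theorem exists_isOrientation (r : Fin (D.N + 1) → Option Bool) :
    ∃ o : D.Point → Fin 2, IsOrientation r o := by
  let H := {x : Fin (D.N + 1) × Bool × ℕ //
    x.2.2 < if x.2.1 then D.width x.1 else D.width (x.1 + 1)}
  let θ : H → H := fun x =>
    ⟨(x.1.1, (D.slab x.1.1).go (r x.1.1) x.1.2), Slab.go_lt (D.fits x.1.1) _ x.2⟩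
  let ρ : H → H := fun x => ⟨(if x.1.2.1 then x.1.1 - 1 else x.1.1 + 1, !x.1.2.1, x.1.2.2), by
    obtain ⟨⟨j, s, p⟩, hx⟩ := x
    cases s <;> simpa using hx⟩
  obtain ⟨o, ho⟩ := exists_alternating_coloring (r := ρ) (θ := θ) (fun x => by
      obtain ⟨⟨j, s, p⟩, hx⟩ := x
      cases s <;> simp [ρ]) (fun x => Subtype.ext (Prod.ext rfl (Slab.go_go (D.fits x.1.1) _ x.2)))
      (fun x h => by
        have := congrArg (fun x => x.1.2.1) h
        simp [ρ] at this)
      (fun x h => Slab.go_ne _ _ (congrArg (fun x => x.1.2) h))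
  let f : D.Point → Fin 2 := fun x => o ⟨(x.1.1, true, x.1.2), by simpa using x.2⟩
  have hf : ∀ {j p} (h : p < D.width j), D.strand f j p = o ⟨(j, true, p), by simpa using h⟩ :=
    fun h => strand_of_lt _ _ h
  have hf' : ∀ {j p} (h : p < D.width (j + 1)),
      D.strand f (j + 1) p = o ⟨(j, false, p), by simpa using h⟩ + 1 := by
    intro j p h
    rw [hf h, ← (ho _).1]
    rfl
  have hflip : ∀ a : Fin 2, a + 1 + 1 = a := by decide
  refine ⟨f, fun j => ⟨fun p q hp hq h => ?_, fun p q hp hq h => ?_, fun p q hp hq h => ?_⟩⟩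
  · rw [hf hp, hf' hq]
    have h1 := (ho ⟨(j, true, p), by simpa using hp⟩).2
    have h2 : θ ⟨(j, true, p), by simpa using hp⟩ = ⟨(j, false, q), by simpa using hq⟩ :=
      Subtype.ext (Prod.ext rfl h.go_eq)
    rw [← h2, h1, hflip]
  · rw [hf hp, hf hq]
    have h1 := (ho ⟨(j, true, p), by simpa using hp⟩).2
    have h2 : θ ⟨(j, true, p), by simpa using hp⟩ = ⟨(j, true, q), by simpa using hq⟩ :=
      Subtype.ext (Prod.ext rfl h.go_eq)
    rw [← h2, h1]
  · rw [hf' hp, hf' hq]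
    have h1 := (ho ⟨(j, false, p), by simpa using hp⟩).2
    have h2 : θ ⟨(j, false, p), by simpa using hp⟩ = ⟨(j, false, q), by simpa using hq⟩ :=
      Subtype.ext (Prod.ext rfl h.go_eq)
    rw [← h2, h1]

end Diagram

/-! ### Orientations and colourings -/

/-- The parity of a natural number. -/
def parity (p : ℕ) : Fin 2 := if Even p then 0 else 1

theorem parity_succ (p : ℕ) : parity (p + 1) = parity p + 1 := by
  by_cases h : Even p <;> simp [parity, Nat.even_add_one, h]

theorem parity_add_two (p : ℕ) : parity (p + 2) = parity p := by
  simp [parity, Nat.even_add]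

theorem fin_two_add_add_self (a b : Fin 2) : a + b + b = a := by revert a b; decide

namespace Slab

variable {S : Slab} {m n : ℕ} {f g : ℕ → Fin 2}

theorem parity_eq_of_smoothThrough {b : Bool} {p q : ℕ} (h : S.SmoothThrough b p q) :
    parity p = parity q := by
  cases S <;> simp only [SmoothThrough] at h
  · rw [h]
  · rw [h]; split_ifs <;> simp [parity_add_two]
  · rw [h]; split_ifs <;> simp [parity_add_two]
  · rw [h.1]

/-- Comparing directions with the alternating ones turns orientations into labels constant along
arcs: in a smoothed sector radial arcs preserve the parity of the strand number, while caps and cups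
join neighbours of opposite parity. -/
theorem orients_some_iff {b : Bool} :
    S.Orients (some b) m n f g ↔
      S.Respects b m n (fun p => f p + parity p) fun q => g q + parity q := by
  have h2 : ∀ a b c : Fin 2, a + c = b + (c + 1) ↔ b = a + 1 := by decide
  constructor
  · intro h
    refine ⟨fun p q hp hq hpq => ?_, fun p q hp hq hpq => ?_, fun p q hp hq hpq => ?_⟩
    · rw [h.through p q hp hq hpq, parity_eq_of_smoothThrough hpq]
    · have := h.cap p q hp hq hpq
      obtain rfl := smoothCap_succ hpq
      rwa [parity_succ, h2]
    · have := h.cup p q hp hq hpq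
      obtain rfl := smoothCup_succ hpq
      rwa [parity_succ, h2]
  · intro h
    refine ⟨fun p q hp hq hpq => ?_, fun p q hp hq hpq => ?_, fun p q hp hq hpq => ?_⟩
    · have := h.through p q hp hq hpq
      rw [parity_eq_of_smoothThrough hpq] at this
      exact add_right_cancel this
    · have := h.cap p q hp hq hpq
      obtain rfl := smoothCap_succ hpq
      rwa [parity_succ, h2] at this
    · have := h.cup p q hp hq hpq
      obtain rfl := smoothCup_succ hpq
      rwa [parity_succ, h2] at this

theorem orients_none_iff_of_isCross_eq_false (hS : S.isCross = false) (b : Bool) :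
    S.Orients none m n f g ↔ S.Orients (some b) m n f g := by
  have e1 : S.ResThrough none = S.ResThrough (some b) := by
    cases S <;> first | rfl | simp [isCross] at hS
  have e2 : S.ResCap none = S.ResCap (some b) := by
    funext p q
    cases S <;> simp_all [ResCap, SmoothCap, isCross]; grind
  have e3 : S.ResCup none = S.ResCup (some b) := by
    funext p q
    cases S <;> simp_all [ResCup, SmoothCup, isCross]; grind
  constructor
  · rintro ⟨h1, h2, h3⟩
    exact ⟨e1 ▸ h1, e2 ▸ h2, e3 ▸ h3⟩
  · rintro ⟨h1, h2, h3⟩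
    exact ⟨e1 ▸ h1, e2 ▸ h2, e3 ▸ h3⟩

theorem orients_cross_iff {i : ℕ} {o : Bool} (hi : i + 2 ≤ m) :
    (cross i o).Orients none m m f g ↔
      (∀ p, p < m → p ≠ i → p ≠ i + 1 → f p = g p) ∧ f i = g (i + 1) ∧ f (i + 1) = g i := by
  constructor
  · intro h
    exact ⟨fun p hp h1 h2 => h.through p p hp hp (Or.inr (Or.inr ⟨rfl, h1, h2⟩)),
      h.through i (i + 1) (by omega) (by omega) (Or.inl ⟨rfl, rfl⟩),
      h.through (i + 1) i (by omega) (by omega) (Or.inr (Or.inl ⟨rfl, rfl⟩))⟩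
  · rintro ⟨h1, h2, h3⟩
    refine ⟨fun p q hp hq hpq => ?_, fun p q hp hq hpq => ?_, fun p q hp hq hpq => ?_⟩
    · rcases hpq with ⟨rfl, rfl⟩ | ⟨rfl, rfl⟩ | ⟨rfl, h4, h5⟩
      exacts [h2, h3, h1 p hp h4 h5]
    · exact Slab.noConfusion hpq.1
    · exact Slab.noConfusion hpq.1

end Slab

namespace Diagram

variable {D : Diagram}

/-- The correspondence between orientations of curves and colourings of the regions' boundaries:
directions are compared with the alternating ones. -/
def addParity (Φ : D.Point → Fin 2) (x : D.Point) : Fin 2 := Φ x + parity x.1.2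

theorem addParity_addParity (Φ : D.Point → Fin 2) : addParity (addParity Φ) = Φ :=
  funext fun _ => fin_two_add_add_self _ _

theorem strand_addParity (Φ : D.Point → Fin 2) {j : Fin (D.N + 1)} {p : ℕ}
    (hp : p < D.width j) : D.strand (addParity Φ) j p = D.strand Φ j p + parity p := by
  rw [strand_of_lt _ _ hp, strand_of_lt _ _ hp]
  rfl

theorem orients_some_iff_sectorCompat {o : D.Point → Fin 2} {j : Fin (D.N + 1)} {b : Bool} :
    (D.slab j).Orients (some b) (D.width j) (D.width (j + 1)) (D.strand o j) (D.strand o (j + 1)) ↔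
      D.SectorCompat (addParity o) j b := by
  rw [Slab.orients_some_iff]
  exact ⟨fun h => h.congr (fun p hp => strand_addParity o hp) fun q hq => strand_addParity o hq,
    fun h => h.congr (fun p hp => (strand_addParity o hp).symm)
      fun q hq => (strand_addParity o hq).symm⟩

/-- Each of the two crossing strands changes its number by one, so an orientation that is continuous
along it corresponds to colours that differ at its ends. -/
theorem orients_none_crossing_iff {o : D.Point → Fin 2} {c : D.Crossing} :
    (D.slab c.1).Orients none (D.width c.1) (D.width (c.1 + 1)) (D.strand o c.1)
      (D.strand o (c.1 + 1)) ↔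
      AwayCompat (addParity o) c ∧ addParity o (D.inner c) ≠ addParity o (D.outer c) ∧
        addParity o (innerAbove c) ≠ addParity o (outerBelow c) := by
  have hw := width_crossing c
  have hlt := D.crossing_fits c
  have e1 : D.strand o c.1 (D.slab c.1).pos = o (D.inner c) := strand_of_lt _ _ _
  have e2 : D.strand o c.1 ((D.slab c.1).pos + 1) = o (innerAbove c) := strand_of_lt _ _ _
  have e3 : D.strand o (c.1 + 1) (D.slab c.1).pos = o (outerBelow c) := strand_of_lt _ _ _
  have e4 : D.strand o (c.1 + 1) ((D.slab c.1).pos + 1) = o (D.outer c) := strand_of_lt _ _ _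
  have h1 : (D.slab c.1).Orients none (D.width c.1) (D.width (c.1 + 1)) (D.strand o c.1)
      (D.strand o (c.1 + 1)) ↔ (Slab.cross (D.slab c.1).pos (turnBit c)).Orients none
      (D.width c.1) (D.width c.1) (D.strand o c.1) (D.strand o (c.1 + 1)) := by
    rw [← slab_crossing c, hw]
  rw [h1, Slab.orients_cross_iff (by omega), e1, e2, e3, e4]
  have h2 : ∀ a b p : Fin 2, a = b ↔ a + p ≠ b + (p + 1) := by decide
  have h3 : ∀ a b p : Fin 2, a = b ↔ a + (p + 1) ≠ b + p := by decide
  refine and_congr ?_ (and_congr ?_ ?_)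
  · refine forall_congr' fun p => forall_congr' fun hp => ?_
    rw [strand_addParity o hp, strand_addParity o (hw ▸ hp), add_left_inj]
  · simp only [addParity, inner, outer, parity_succ]
    exact h2 _ _ _
  · simp only [addParity, innerAbove, outerBelow, parity_succ]
    exact h3 _ _ _

/-- The condition on a colouring away from the crossings. -/
def BaseCompat (Φ : D.Point → Fin 2) : Prop :=
  ∀ j, (D.slab j).isCross = false → D.SectorCompat Φ j false

theorem sectorCompat_congr_of_isCross_eq_false {β : Type*} [Zero β] {Φ : D.Point → β}
    {j : Fin (D.N + 1)} (hj : (D.slab j).isCross = false) (b b' : Bool) :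
    D.SectorCompat Φ j b ↔ D.SectorCompat Φ j b' := by
  have key : ∀ (S : Slab), S.isCross = false → ∀ (m n : ℕ) (f g : ℕ → β),
      S.Respects b m n f g → S.Respects b' m n f g := by
    intro S hS m n f g h
    cases S with
    | cross => simp [Slab.isCross] at hS
    | _ => exact ⟨h.through, h.cap, h.cup⟩
  have key' : ∀ (S : Slab), S.isCross = false → ∀ (m n : ℕ) (f g : ℕ → β),
      S.Respects b' m n f g → S.Respects b m n f g := by
    intro S hS m n f g h
    cases S with
    | cross => simp [Slab.isCross] at hS
    | _ => exact ⟨h.through, h.cap, h.cup⟩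
  exact ⟨key _ hj _ _ _ _, key' _ hj _ _ _ _⟩

theorem bit_crossing (u : D.Vertex) (c : D.Crossing) : D.bit u c.1 = u c := dif_pos c.2

theorem cubeCompat_iff {u : D.Vertex} {Φ : D.Point → Fin 2} :
    CubeCompat BaseCompat (fun Φ (c : D.Crossing) s => D.SectorCompat Φ c.1 s) (u, Φ) ↔
      D.Compat u Φ := by
  constructor
  · rintro ⟨h1, h2⟩ j
    by_cases hj : (D.slab j).isCross = true
    · have h3 : D.SectorCompat Φ j (u ⟨j, hj⟩) := h2 ⟨j, hj⟩
      rwa [← bit_crossing u ⟨j, hj⟩] at h3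
    · exact (sectorCompat_congr_of_isCross_eq_false (by simpa using hj) _ _).1
        (h1 j (by simpa using hj))
  · intro h
    exact ⟨fun j hj => (sectorCompat_congr_of_isCross_eq_false hj _ _).1 (h j),
      fun c => (congrArg (D.SectorCompat Φ c.1) (bit_crossing u c)).mp (h c.1)⟩

/-- With only two colours, unequal colours at the ends of both crossing strands leave two patterns
at the four points, one for each smoothing. Both smoothings are compatible only if all four colours
agree. -/
theorem existsUnique_sectorCompat_iff {Φ : D.Point → Fin 2} {c : D.Crossing} :
    (∃! s, D.SectorCompat Φ c.1 s) ↔ AwayCompat Φ c ∧ Φ (D.inner c) ≠ Φ (D.outer c) ∧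
      Φ (innerAbove c) ≠ Φ (outerBelow c) := by
  simp only [sectorCompat_crossing_iff, ExistsUnique, Bool.exists_bool, Bool.forall_bool]
  generalize turnBit c = t
  generalize Φ (D.inner c) = x
  generalize Φ (D.outer c) = y
  generalize Φ (innerAbove c) = z
  generalize Φ (outerBelow c) = w
  by_cases h : AwayCompat Φ c
  · simp only [h, true_and]
    revert t x y z w
    decide
  · simp [h]

/-- The isolated colourings are the analogue of Lee's canonical generators: the unique compatible
smoothing at each crossing is the oriented one. -/
theorem cubeIsolated_iff {Φ : D.Point → Fin 2} :
    CubeIsolated BaseCompat (fun Φ (c : D.Crossing) s => D.SectorCompat Φ c.1 s) Φ ↔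
      IsOrientation (fun _ => none) (addParity Φ) := by
  have hcr : ∀ c : D.Crossing, (∃! s, D.SectorCompat Φ c.1 s) ↔
      (D.slab c.1).Orients none (D.width c.1) (D.width (c.1 + 1)) (D.strand (addParity Φ) c.1)
        (D.strand (addParity Φ) (c.1 + 1)) := fun c => by
    rw [orients_none_crossing_iff, existsUnique_sectorCompat_iff, addParity_addParity]
  have hnc : ∀ j, (D.slab j).isCross = false → (D.SectorCompat Φ j false ↔
      (D.slab j).Orients none (D.width j) (D.width (j + 1)) (D.strand (addParity Φ) j)
        (D.strand (addParity Φ) (j + 1))) := fun j hj => by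
    rw [Slab.orients_none_iff_of_isCross_eq_false hj false, orients_some_iff_sectorCompat,
      addParity_addParity]
  constructor
  · rintro ⟨h1, h2⟩ j
    by_cases hj : (D.slab j).isCross = true
    · exact (hcr ⟨j, hj⟩).1 (h2 ⟨j, hj⟩)
    · exact (hnc j (by simpa using hj)).1 (h1 j (by simpa using hj))
  · intro h
    exact ⟨fun j hj => (hnc j hj).2 (h j), fun c => (hcr c).2 (h c.1)⟩

/-! ### Components of the link -/

/-- Two points are joined by an arc of the link inside one sector. -/
def LinkArc (x y : D.Point) : Prop :=
  ∃ j : Fin (D.N + 1),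
    (x.1.1 = j ∧ y.1.1 = j + 1 ∧ (D.slab j).Strand x.1.2 y.1.2) ∨
    (x.1.1 = j ∧ y.1.1 = j ∧ D.slab j = Slab.death x.1.2 ∧ y.1.2 = x.1.2 + 1) ∨
    (x.1.1 = j + 1 ∧ y.1.1 = j + 1 ∧ D.slab j = Slab.birth x.1.2 ∧ y.1.2 = x.1.2 + 1)

variable (D) in
/-- The components of the link presented by a diagram. -/
def LinkComponents : Type := Quot (LinkArc (D := D))

instance : Finite (LinkComponents D) := inferInstanceAs (Finite (Quot _))

/-- Orientations form a torsor: relative to a fixed one, an orientation is a free choice of one bit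
on each component. -/
theorem isOrientation_none_iff {o : D.Point → Fin 2} {o₀ : D.Point → Fin 2}
    (h₀ : IsOrientation (fun _ => none) o₀) :
    IsOrientation (fun _ => none) o ↔ ∀ x y, LinkArc x y → o x - o₀ x = o y - o₀ y := by
  have e1 : ∀ a b a' b' : Fin 2, b = b' → (a = a' ↔ a - b = a' - b') := by decide
  have e2 : ∀ a b a' b' : Fin 2, b' = b + 1 → (a' = a + 1 ↔ a - b = a' - b') := by decide
  constructor
  · rintro h ⟨⟨j1, p⟩, hp⟩ ⟨⟨j2, q⟩, hq⟩ ⟨j, ⟨h1, h2, h3⟩ | ⟨h1, h2, h3⟩ | ⟨h1, h2, h3⟩⟩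
    · dsimp only at h1 h2 hp hq
      subst h1 h2
      have := (e1 _ _ _ _ ((h₀ j1).through p q hp hq h3)).1 ((h j1).through p q hp hq h3)
      simpa [strand_of_lt _ _ hp, strand_of_lt _ _ hq] using this
    · dsimp only at h1 h2 hp hq
      subst h1 h2
      have := (e2 _ _ _ _ ((h₀ j2).cap p q hp hq h3)).1 ((h j2).cap p q hp hq h3)
      simpa [strand_of_lt _ _ hp, strand_of_lt _ _ hq] using this
    · dsimp only at h1 h2 hp hq
      subst h1 h2
      have := (e2 _ _ _ _ ((h₀ j).cup p q hp hq h3)).1 ((h j).cup p q hp hq h3)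
      simpa [strand_of_lt _ _ hp, strand_of_lt _ _ hq] using this
  · intro h j
    refine ⟨fun p q hp hq hpq => ?_, fun p q hp hq hpq => ?_, fun p q hp hq hpq => ?_⟩
    · rw [e1 _ _ _ _ ((h₀ j).through p q hp hq hpq)]
      simp only [strand_of_lt _ _ hp, strand_of_lt _ _ hq]
      exact h _ _ ⟨j, Or.inl ⟨rfl, rfl, hpq⟩⟩
    · rw [e2 _ _ _ _ ((h₀ j).cap p q hp hq hpq)]
      simp only [strand_of_lt _ _ hp, strand_of_lt _ _ hq]
      exact h _ _ ⟨j, Or.inr (Or.inl ⟨rfl, rfl, hpq⟩)⟩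
    · rw [e2 _ _ _ _ ((h₀ j).cup p q hp hq hpq)]
      simp only [strand_of_lt _ _ hp, strand_of_lt _ _ hq]
      exact h _ _ ⟨j, Or.inr (Or.inr ⟨rfl, rfl, hpq⟩)⟩

variable (D) in
/-- The isolated colourings correspond to the orientations of the link. -/
theorem card_cubeIsolated :
    Nat.card {Φ : D.Point → Fin 2 // CubeIsolated BaseCompat
      (fun Φ (c : D.Crossing) s => D.SectorCompat Φ c.1 s) Φ} =
      2 ^ Nat.card (LinkComponents D) := by
  obtain ⟨o₀, h₀⟩ := exists_isOrientation (D := D) fun _ => none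
  have hsub : ∀ a b : Fin 2, a - b + b = a := by decide
  let e : {Φ : D.Point → Fin 2 // CubeIsolated BaseCompat
      (fun Φ (c : D.Crossing) s => D.SectorCompat Φ c.1 s) Φ} ≃ (LinkComponents D → Fin 2) :=
    { toFun := fun Φ => Quot.lift (fun x => addParity Φ.1 x - o₀ x)
        ((isOrientation_none_iff h₀).1 (cubeIsolated_iff.1 Φ.2))
      invFun := fun φ => ⟨addParity fun x => φ (Quot.mk _ x) + o₀ x, by
        rw [cubeIsolated_iff, addParity_addParity, isOrientation_none_iff h₀]
        intro x y hxy
        simp only [add_sub_cancel_right]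
        exact congrArg φ (Quot.sound hxy)⟩
      left_inv := fun Φ => by
        refine Subtype.ext ?_
        simp only [sub_add_cancel]
        exact addParity_addParity Φ.1
      right_inv := fun φ => by
        funext x
        induction x using Quot.ind with | mk x => ?_
        simp only [addParity_addParity, add_sub_cancel_right] }
  rw [Nat.card_congr e, Nat.card_fun]
  simp

end Diagram

namespace Diagram

variable {D : Diagram}

/-! ### The circles of two adjacent smoothings -/

/-- The smoothings differ exactly at the crossing `c`. -/
structure Adjacent (u v : D.Vertex) (c : D.Crossing) : Prop where
  eq : ∀ c', c' ≠ c → u c' = v c'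
  ne : u c ≠ v c

theorem Adjacent.symm {u v : D.Vertex} {c : D.Crossing} (h : Adjacent u v c) : Adjacent v u c :=
  ⟨fun c' hc' => (h.eq c' hc').symm, h.ne.symm⟩

theorem adjacent_update {u : D.Vertex} {c : D.Crossing} (hu : u c = false) :
    Adjacent u (Function.update u c true) c :=
  ⟨fun c' hc' => by rw [Function.update_of_ne hc'], by simp [hu]⟩

theorem Adjacent.bit_eq {u v : D.Vertex} {c : D.Crossing} (h : Adjacent u v c)
    {j : Fin (D.N + 1)} (hj : j ≠ c.1) : D.bit u j = D.bit v j := by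
  unfold bit
  split_ifs with hc
  · exact h.eq _ fun h' => hj (congrArg Subtype.val h')
  · rfl

theorem Compat.crossing {β : Type*} [Zero β] {u : D.Vertex} {Φ : D.Point → β}
    (h : D.Compat u Φ) (c : D.Crossing) :
    AwayCompat Φ c ∧ if u c = turnBit c then
        Φ (D.inner c) = Φ (innerAbove c) ∧ Φ (outerBelow c) = Φ (D.outer c)
      else Φ (D.inner c) = Φ (outerBelow c) ∧ Φ (innerAbove c) = Φ (D.outer c) := by
  have := h c.1
  rwa [bit_crossing, sectorCompat_crossing_iff] at this

/-- In `D_u` the points `inner` and `outer` lie on the two different local arcs at `c`, so a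
labelling constant on these arcs takes a single value at the crossing once these two labels agree.
The other smoothing pairs `inner` and `outer` with the remaining points the other way round, which
forces this. -/
theorem Adjacent.compat_iff {β : Type*} [Zero β] {u v : D.Vertex} {c : D.Crossing}
    (h : Adjacent u v c) {Φ : D.Point → β} (hu : D.Compat u Φ) :
    D.Compat v Φ ↔ Φ (D.inner c) = Φ (D.outer c) := by
  have h1 := hu.crossing c
  have hne := h.ne
  constructor
  · intro hv
    have h2 := hv.crossing c
    by_cases h3 : u c = turnBit c
    · rw [if_pos h3] at h1
      rw [if_neg fun h4 => hne (h3.trans h4.symm)] at h2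
      exact h2.2.1.trans h1.2.2
    · have h4 : v c = turnBit c := by
        revert hne h3; cases u c <;> cases v c <;> cases turnBit c <;> simp
      rw [if_neg h3] at h1
      rw [if_pos h4] at h2
      exact h1.2.1.trans h2.2.2
  · intro hio j
    by_cases hj : j = c.1
    · subst hj
      rw [bit_crossing, sectorCompat_crossing_iff]
      refine ⟨h1.1, ?_⟩
      have h2 := h1.2
      split_ifs at h2 ⊢
      · exact ⟨h2.1, h2.2⟩
      · exact ⟨hio.trans h2.2.symm, h2.1.symm.trans hio⟩
      · exact ⟨hio.trans h2.2.symm, h2.1.symm.trans hio⟩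
      · exact ⟨h2.1, h2.2⟩
    · rw [← h.bit_eq hj]
      exact hu j

/-- Suppose two circles meet at `c` in both smoothings. The product of the indicators of the circle
of `D_u` and the circle of `D_v` through `inner` is compatible outside the sector of `c`. It is `1`
at `inner` and `0` at the other three points, which contradicts `AwayCompat.add_eq_add`. -/
theorem Adjacent.not_ne_and_ne {u v : D.Vertex} {c : D.Crossing} (h : Adjacent u v c)
    (ht : u c = turnBit c) (hu : D.circ u (D.inner c) ≠ D.circ u (D.outer c)) :
    D.circ v (D.inner c) = D.circ v (D.outer c) := by
  by_contra hv
  have hf : D.Compat u (circInd (D.circ u (D.inner c))) :=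
    compat_comp_circ fun e => if e = D.circ u (D.inner c) then (1 : ℤ) else 0
  have hg : D.Compat v (circInd (D.circ v (D.inner c))) :=
    compat_comp_circ fun e => if e = D.circ v (D.inner c) then (1 : ℤ) else 0
  have hf' := hf.crossing c
  have hg' := hg.crossing c
  rw [if_pos ht] at hf'
  rw [if_neg fun h4 => h.ne (ht.trans h4.symm)] at hg'
  have hmul : AwayCompat (fun x => circInd (D.circ u (D.inner c)) x *
      circInd (D.circ v (D.inner c)) x) c := by
    intro p hp h1 h2
    have h3 := hf'.1 p hp h1 h2
    have h4 := hg'.1 p hp h1 h2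
    have hp' : p < D.width (c.1 + 1) := by rwa [width_crossing]
    rw [strand_of_lt _ _ hp, strand_of_lt _ _ hp'] at *
    rw [h3, h4]
  have key := hmul.add_eq_add fun j hj => ⟨D.bit u j, (hf j).comp₂ (by
    have := hg j
    rwa [← h.bit_eq hj] at this) fun x y => x * y⟩
  have e1 : circInd (D.circ u (D.inner c)) (D.outer c) = 0 := if_neg hu.symm
  have e2 : circInd (D.circ v (D.inner c)) (D.outer c) = 0 := if_neg (Ne.symm hv)
  have e3 : circInd (D.circ u (D.inner c)) (D.inner c) = 1 := if_pos rfl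
  have e4 : circInd (D.circ v (D.inner c)) (D.inner c) = 1 := if_pos rfl
  rw [hf'.2.2, hg'.2.2, e1, e2, e3, e4] at key
  simp at key

/-- This is where orientability excludes saddles from one circle to one circle. Orient the curves
with the crossing `c` kept and all others smoothed as in `D_u`. The associated colouring separates
`inner` from `outer`, yet it is compatible with one of the two smoothings, in which these points
therefore lie on different circles. -/
theorem Adjacent.not_eq_and_eq {u v : D.Vertex} {c : D.Crossing} (h : Adjacent u v c)
    (ht : u c = turnBit c) (hu : D.circ u (D.inner c) = D.circ u (D.outer c)) :
    D.circ v (D.inner c) ≠ D.circ v (D.outer c) := by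
  intro hv
  obtain ⟨o, ho⟩ := exists_isOrientation (D := D)
    fun j => if j = c.1 then none else some (D.bit u j)
  have hj : ∀ j, j ≠ c.1 → D.SectorCompat (addParity o) j (D.bit u j) := fun j hj => by
    rw [← orients_some_iff_sectorCompat]
    have := ho j
    simp only [if_neg hj] at this
    exact this
  have hc := ho c.1
  simp only [if_true] at hc
  rw [ orients_none_crossing_iff] at hc
  obtain ⟨h1, h2, h3⟩ := hc
  by_cases h4 : addParity o (D.inner c) = addParity o (innerAbove c)
  · have : D.Compat u (addParity o) := fun j => by
      by_cases hjc : j = c.1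
      · subst hjc
        rw [bit_crossing, sectorCompat_crossing_iff, if_pos ht]
        refine ⟨h1, h4, ?_⟩
        generalize addParity o (D.inner c) = x at *
        generalize addParity o (D.outer c) = y at *
        generalize addParity o (innerAbove c) = z at *
        generalize addParity o (outerBelow c) = w at *
        revert x y z w; decide
      · exact hj j hjc
    exact h2 (this.eq_of_circ_eq hu)
  · have : D.Compat v (addParity o) := fun j => by
      by_cases hjc : j = c.1
      · subst hjc
        rw [bit_crossing, sectorCompat_crossing_iff, if_neg fun h' => h.ne (ht.trans h'.symm)]
        refine ⟨h1, ?_⟩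
        generalize addParity o (D.inner c) = x at *
        generalize addParity o (D.outer c) = y at *
        generalize addParity o (innerAbove c) = z at *
        generalize addParity o (outerBelow c) = w at *
        revert x y z w; decide
      · rw [← h.bit_eq hjc]
        exact hj j hjc
    exact h2 (this.eq_of_circ_eq hv)

/-- A saddle merges two circles or splits one. -/
theorem Adjacent.circ_ne_iff {u v : D.Vertex} {c : D.Crossing} (h : Adjacent u v c) :
    D.circ u (D.inner c) ≠ D.circ u (D.outer c) ↔ D.circ v (D.inner c) = D.circ v (D.outer c) := by
  by_cases ht : u c = turnBit c
  · exact ⟨h.not_ne_and_ne ht, fun h1 h2 => h.not_eq_and_eq ht h2 h1⟩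
  · have ht' : v c = turnBit c := by
      have hne := h.ne
      revert hne ht; cases u c <;> cases v c <;> cases turnBit c <;> simp
    constructor
    · intro h1
      by_contra h2
      exact h1 (h.symm.not_ne_and_ne ht' h2)
    · exact fun h1 => h.symm.not_eq_and_eq ht' h1

/-- The circles that do not pass through a crossing. -/
def farCircles (u : D.Vertex) (c : D.Crossing) : Finset (D.Circles u) :=
  Finset.univ.filter fun e => e ≠ D.circ u (D.inner c) ∧ e ≠ D.circ u (D.outer c)

theorem mem_farCircles {u : D.Vertex} {c : D.Crossing} {e : D.Circles u} :
    e ∈ farCircles u c ↔ e ≠ D.circ u (D.inner c) ∧ e ≠ D.circ u (D.outer c) := by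
  simp [farCircles]

/-- The indicator of a circle that avoids the crossing vanishes at `inner` and `outer`, so it is
also constant on the circles of the other smoothing. This makes `transfer` a bijection between the
far circles. -/
theorem Adjacent.circInd_compat {u v : D.Vertex} {c : D.Crossing} (h : Adjacent u v c)
    {e : D.Circles v} (he : e ∈ farCircles v c) : D.Compat u (circInd e) := by
  rw [mem_farCircles] at he
  have hv : D.Compat v (circInd e) := compat_comp_circ fun e' => if e' = e then (1 : ℤ) else 0
  rw [h.symm.compat_iff hv]
  simp [circInd, he.1.symm, he.2.symm]

theorem circInd_out {u : D.Vertex} (e : D.Circles u) : circInd e (Quot.out e) = 1 :=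
  if_pos (circ_out e)

theorem eq_of_circInd_eq_one {u : D.Vertex} {e : D.Circles u} {x : D.Point}
    (h : circInd e x = 1) : D.circ u x = e := by
  by_contra h'
  simp [circInd, h'] at h

theorem Adjacent.transfer_mem {u v : D.Vertex} {c : D.Crossing} (h : Adjacent u v c)
    {e : D.Circles v} (he : e ∈ farCircles v c) : D.transfer u v e ∈ farCircles u c := by
  have hc := h.circInd_compat he
  rw [mem_farCircles] at he ⊢
  constructor
  · intro h'
    have := hc.eq_of_circ_eq h'
    rw [circInd_out] at this
    exact he.1 (eq_of_circInd_eq_one this.symm).symm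
  · intro h'
    have := hc.eq_of_circ_eq h'
    rw [circInd_out] at this
    exact he.2 (eq_of_circInd_eq_one this.symm).symm

theorem Adjacent.transfer_transfer {u v : D.Vertex} {c : D.Crossing} (h : Adjacent u v c)
    {e : D.Circles v} (he : e ∈ farCircles v c) : D.transfer v u (D.transfer u v e) = e := by
  refine eq_of_circInd_eq_one ?_
  rw [(h.circInd_compat he).eq_of_circ_eq (circ_out (D.transfer u v e)), circInd_out]

theorem Adjacent.sum_farCircles {M : Type*} [AddCommMonoid M] {u v : D.Vertex} {c : D.Crossing}
    (h : Adjacent u v c) (f : D.Circles u → M) :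
    ∑ e ∈ farCircles v c, f (D.transfer u v e) = ∑ e ∈ farCircles u c, f e :=
  Finset.sum_bij' (fun e _ => D.transfer u v e) (fun e _ => D.transfer v u e)
    (fun _ he => h.transfer_mem he) (fun _ he => h.symm.transfer_mem he)
    (fun _ he => h.transfer_transfer he) (fun _ he => h.symm.transfer_transfer he)
    (fun _ _ => rfl)

/-- The number of circles of a given colour. -/
def colorCount (u : D.Vertex) (Φ : D.Point → Fin 2) (a : Fin 2) : ℕ :=
  ∑ e : D.Circles u, if Φ (Quot.out e) = a then 1 else 0

theorem colorCount_eq {u : D.Vertex} {Φ : D.Point → Fin 2} (hu : D.Compat u Φ) {c : D.Crossing}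
    (hc : Φ (D.inner c) = Φ (D.outer c)) (a : Fin 2) :
    colorCount u Φ a = (∑ e ∈ farCircles u c, if Φ (Quot.out e) = a then 1 else 0) +
      if Φ (D.inner c) = a then
        (if D.circ u (D.inner c) = D.circ u (D.outer c) then 1 else 2) else 0 := by
  have h1 : (Finset.univ : Finset (D.Circles u)) \ farCircles u c =
      {D.circ u (D.inner c), D.circ u (D.outer c)} := by
    ext e
    simp only [Finset.mem_sdiff, Finset.mem_univ, mem_farCircles, true_and, Finset.mem_insert,
      Finset.mem_singleton]
    tauto
  rw [colorCount, ← Finset.sum_sdiff (Finset.subset_univ (farCircles u c)), h1, add_comm]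
  congr 1
  by_cases h2 : D.circ u (D.inner c) = D.circ u (D.outer c)
  · rw [if_pos h2, h2, Finset.pair_eq_singleton, Finset.sum_singleton, hu.apply_out, hc]
  · rw [Finset.sum_pair h2, hu.apply_out, hu.apply_out, hc, if_neg h2]
    split_ifs <;> rfl

theorem Adjacent.colorCount_of_merge {u v : D.Vertex} {c : D.Crossing} (h : Adjacent u v c)
    {Φ : D.Point → Fin 2} (hu : D.Compat u Φ) (hv : D.Compat v Φ)
    (hm : D.circ u (D.inner c) ≠ D.circ u (D.outer c)) (a : Fin 2) :
    colorCount u Φ a = colorCount v Φ a + if Φ (D.inner c) = a then 1 else 0 := by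
  have hc := (h.compat_iff hu).1 hv
  rw [colorCount_eq hu hc, colorCount_eq hv hc, if_neg hm, if_pos (h.circ_ne_iff.1 hm),
    ← h.sum_farCircles]
  have : ∀ e : D.Circles v, Φ (Quot.out (D.transfer u v e)) = Φ (Quot.out e) := fun e =>
    hu.apply_out _
  simp only [this]
  split_ifs <;> rfl

theorem Adjacent.colorCount_of_split {u v : D.Vertex} {c : D.Crossing} (h : Adjacent u v c)
    {Φ : D.Point → Fin 2} (hu : D.Compat u Φ) (hv : D.Compat v Φ)
    (hm : D.circ u (D.inner c) = D.circ u (D.outer c)) (a : Fin 2) :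
    colorCount v Φ a = colorCount u Φ a + if Φ (D.inner c) = a then 1 else 0 :=
  h.symm.colorCount_of_merge hv hu (fun h' => (h.circ_ne_iff.2 h') hm) a

theorem colorCount_le (u : D.Vertex) (Φ : D.Point → Fin 2) (a : Fin 2) :
    colorCount u Φ a ≤ Nat.card D.Point := by
  calc colorCount u Φ a ≤ ∑ e : D.Circles u, 1 := Finset.sum_le_sum fun e _ => by
        split_ifs <;> simp
    _ = Nat.card (D.Circles u) := by simp
    _ ≤ Nat.card D.Point := Nat.card_le_card_of_surjective (D.circ u) Quot.mk_surjective

end Diagram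

/-! ### The idempotents of the Frobenius algebra -/

/-- The value of `X` on a colour. -/
def root (a : Fin 2) : Rα := if a = 0 then α₀ else α₁

/-- The value of `X` on the other colour. -/
def coroot (a : Fin 2) : Rα := if a = 0 then α₁ else α₀

/-- The element `X - α₁` or `X - α₀`, a multiple of an idempotent after inverting `𝒟`. -/
def colorElt (a : Fin 2) : Aα := AX - algebraMap Rα Aα (coroot a)

/-- The factor by which `colorElt a` fails to be idempotent. -/
def colorScale (a : Fin 2) : Rα := root a - coroot a

theorem colorElt_eq (a : Fin 2) : colorElt a = ⟨-coroot a, 1⟩ := by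
  refine QuadraticAlgebra.ext ?_ ?_ <;> simp [colorElt, AX, QuadraticAlgebra.algebraMap_eq]

theorem colorElt_mul_self (a : Fin 2) : colorElt a * colorElt a = colorScale a • colorElt a := by
  fin_cases a <;> refine QuadraticAlgebra.ext ?_ ?_ <;>
    simp [colorElt_eq, colorScale, root, coroot] <;> ring

theorem colorElt_mul_of_ne {a b : Fin 2} (h : a ≠ b) : colorElt a * colorElt b = 0 := by
  fin_cases a <;> fin_cases b <;> first | exact absurd rfl h | skip
  all_goals refine QuadraticAlgebra.ext ?_ ?_ <;> simp [colorElt_eq, coroot]; ring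

/-- A function that is linear in every variable separately is multilinear. -/
theorem exists_multilinearMap {R ι A M : Type*} [CommRing R] [AddCommGroup A] [Module R A]
    [AddCommGroup M] [Module R M] [instD : DecidableEq ι] (F : (ι → A) → M)
    (h : ∀ z i, ∃ L : A →ₗ[R] M, ∀ a, F (Function.update z i a) = L a) :
    ∃ G : MultilinearMap R (fun _ : ι => A) M, ∀ z, G z = F z := by
  refine ⟨⟨F, ?_, ?_⟩, fun _ => rfl⟩
  · intro inst z i x y
    obtain rfl : inst = instD := Subsingleton.elim _ _
    obtain ⟨L, hL⟩ := h z i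
    rw [hL, hL, hL, map_add]
  · intro inst z i r x
    obtain rfl : inst = instD := Subsingleton.elim _ _
    obtain ⟨L, hL⟩ := h z i
    rw [hL, hL, map_smul]

namespace Diagram

variable {D : Diagram}

/-- The element of `F_α(D_u)` given by a colouring of the circles. -/
def coloredState (u : D.Vertex) (Φ : D.Point → Fin 2) : D.State u :=
  PiTensorProduct.tprod Rα fun e => colorElt (Φ (Quot.out e))

/-- A linear map given on the standard basis by a multilinear formula. -/
theorem constr_stdBasis_tprod {u : D.Vertex} {M : Type*} [AddCommGroup M] [Module Rα M]
    {g : (D.Circles u → Fin 2) → M} {F : (D.Circles u → Aα) → M}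
    (h : ∀ z i, ∃ L : Aα →ₗ[Rα] M, ∀ a, F (Function.update z i a) = L a)
    (hg : ∀ x, g x = F fun c => basisAt 0 (x c)) (z : D.Circles u → Aα) :
    (D.stdBasis u).constr Rα g (PiTensorProduct.tprod Rα z) = F z := by
  obtain ⟨G, hG⟩ := exists_multilinearMap F h
  have : (D.stdBasis u).constr Rα g = PiTensorProduct.lift G := by
    refine (D.stdBasis u).ext fun x => ?_
    rw [Module.Basis.constr_basis, stdBasis, Basis.piTensorProduct_apply,
      PiTensorProduct.lift.tprod, hG, hg]
  rw [this, PiTensorProduct.lift.tprod, hG]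

theorem Adjacent.exists_transfer_eq {u v : D.Vertex} {c : D.Crossing} (h : Adjacent u v c)
    {e : D.Circles u} (he : e ∈ farCircles u c) :
    ∃ e₀ ∈ farCircles v c, ∀ e' ∈ farCircles v c, D.transfer u v e' = e ↔ e' = e₀ := by
  refine ⟨D.transfer v u e, h.symm.transfer_mem he, fun e' he' => ⟨?_, ?_⟩⟩
  · rintro rfl
    exact (h.transfer_transfer he').symm
  · rintro rfl
    exact h.symm.transfer_transfer he

/-- The map is defined on the standard basis, whereas coloured states are other pure tensors, so the
formula has to be shown multilinear. Changing one of the two merging factors affects only the slot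
of the merged circle; changing any other factor affects only the slot of the corresponding far
circle. -/
theorem mergeMap_tprod {u v : D.Vertex} {c : D.Crossing} (h : Adjacent u v c)
    (hm : D.circ u (D.inner c) ≠ D.circ u (D.outer c)) (z : D.Circles u → Aα) :
    D.mergeMap u v c (PiTensorProduct.tprod Rα z) =
      PiTensorProduct.tprod Rα fun e : D.Circles v =>
        if e = D.circ v (D.outer c) then z (D.circ u (D.inner c)) * z (D.circ u (D.outer c))
        else z (D.transfer u v e) := by
  have hv := h.circ_ne_iff.1 hm
  have hfar : ∀ e : D.Circles v, e ≠ D.circ v (D.outer c) → e ∈ farCircles v c := fun e he =>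
    mem_farCircles.2 ⟨hv ▸ he, he⟩
  refine constr_stdBasis_tprod (F := fun z => PiTensorProduct.tprod Rα fun e : D.Circles v =>
        if e = D.circ v (D.outer c) then z (D.circ u (D.inner c)) * z (D.circ u (D.outer c))
        else z (D.transfer u v e)) ?_ (fun x => rfl) z
  intro z k
  set w : D.Circles v → Aα := fun e =>
    if e = D.circ v (D.outer c) then z (D.circ u (D.inner c)) * z (D.circ u (D.outer c))
        else z (D.transfer u v e) with hw
  by_cases hi : k = D.circ u (D.inner c)
  · refine ⟨(PiTensorProduct.tprod Rα).toLinearMap w (D.circ v (D.outer c)) ∘ₗ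
      LinearMap.mulRight Rα (z (D.circ u (D.outer c))), fun a => ?_⟩
    rw [LinearMap.comp_apply, LinearMap.mulRight_apply, MultilinearMap.toLinearMap_apply]
    congr 1
    funext e
    by_cases he : e = D.circ v (D.outer c)
    · subst he
      rw [if_pos rfl, Function.update_self, hi, Function.update_self, Function.update_of_ne hm.symm]
    · rw [if_neg he, Function.update_of_ne he, Function.update_of_ne, hw]
      · simp [he]
      · rw [hi]
        exact (mem_farCircles.1 (h.transfer_mem (hfar e he))).1
  by_cases ho : k = D.circ u (D.outer c)
  · refine ⟨(PiTensorProduct.tprod Rα).toLinearMap w (D.circ v (D.outer c)) ∘ₗ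
      LinearMap.mulLeft Rα (z (D.circ u (D.inner c))), fun a => ?_⟩
    rw [LinearMap.comp_apply, LinearMap.mulLeft_apply, MultilinearMap.toLinearMap_apply]
    congr 1
    funext e
    by_cases he : e = D.circ v (D.outer c)
    · subst he
      rw [if_pos rfl, Function.update_self, ho, Function.update_self, Function.update_of_ne hm]
    · rw [if_neg he, Function.update_of_ne he, Function.update_of_ne, hw]
      · simp [he]
      · rw [ho]
        exact (mem_farCircles.1 (h.transfer_mem (hfar e he))).2
  obtain ⟨e₀, he₀, hu⟩ := h.exists_transfer_eq (mem_farCircles.2 ⟨hi, ho⟩)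
  refine ⟨(PiTensorProduct.tprod Rα).toLinearMap w e₀, fun a => ?_⟩
  rw [MultilinearMap.toLinearMap_apply]
  congr 1
  funext e
  by_cases he : e = D.circ v (D.outer c)
  · rw [if_pos he, Function.update_of_ne (Ne.symm hi), Function.update_of_ne (Ne.symm ho),
      Function.update_of_ne, hw]
    · simp [he]
    · rw [he]
      exact (mem_farCircles.1 he₀).2.symm
  · rw [if_neg he]
    by_cases hee : e = e₀
    · rw [(hu e (hfar e he)).2 hee, hee, Function.update_self, Function.update_self]
    · rw [Function.update_of_ne hee, Function.update_of_ne fun h' => hee ((hu e (hfar e he)).1 h'),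
        hw]
      simp [he]

/-- The tensor with the factors `z` away from a crossing and `a`, `b` at the crossing. -/
def splitState (u v : D.Vertex) (c : D.Crossing) (z : D.Circles u → Aα) (a b : Aα) : D.State v :=
  PiTensorProduct.tprod Rα fun e : D.Circles v =>
    if e = D.circ v (D.inner c) then a else if e = D.circ v (D.outer c) then b
    else z (D.transfer u v e)

theorem exists_splitState_bilinear {u v : D.Vertex} {c : D.Crossing}
    (hv : D.circ v (D.inner c) ≠ D.circ v (D.outer c)) (z : D.Circles u → Aα) :
    ∃ B : Aα →ₗ[Rα] Aα →ₗ[Rα] D.State v, ∀ a b, splitState u v c z a b = B a b := by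
  let w : D.Circles v → Aα := fun e => z (D.transfer u v e)
  have key : ∀ a b, splitState u v c z a b = PiTensorProduct.tprod Rα
      (Function.update (Function.update w (D.circ v (D.inner c)) a) (D.circ v (D.outer c)) b) := by
    intro a b
    unfold splitState
    congr 1
    funext e
    by_cases h1 : e = D.circ v (D.inner c)
    · rw [if_pos h1, Function.update_of_ne (h1 ▸ hv), h1, Function.update_self]
    · rw [if_neg h1]
      by_cases h2 : e = D.circ v (D.outer c)
      · rw [if_pos h2, h2, Function.update_self]
      · rw [if_neg h2, Function.update_of_ne h2, Function.update_of_ne h1]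
  refine ⟨LinearMap.mk₂ Rα (splitState u v c z) ?_ ?_ ?_ ?_, fun a b => rfl⟩
  · intro a a' b
    rw [key, key, key, Function.update_comm hv, MultilinearMap.map_update_add,
      Function.update_comm hv, Function.update_comm hv]
  · intro r a b
    rw [key, key, Function.update_comm hv, MultilinearMap.map_update_smul,
      Function.update_comm hv]
  · intro a b b'
    rw [key, key, key, MultilinearMap.map_update_add]
  · intro r a b
    rw [key, key, MultilinearMap.map_update_smul]

theorem splitState_update_of_split {u v : D.Vertex} {c : D.Crossing} (h : Adjacent u v c)
    (z : D.Circles u → Aα) (a b x : Aα) :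
    splitState u v c (Function.update z (D.circ u (D.inner c)) x) a b = splitState u v c z a b := by
  unfold splitState
  congr 1
  funext e
  split_ifs with h1 h2
  · rfl
  · rfl
  · rw [Function.update_of_ne]
    exact (mem_farCircles.1 (h.transfer_mem (mem_farCircles.2 ⟨h1, h2⟩))).1

theorem exists_splitState_linear {u v : D.Vertex} {c : D.Crossing} (h : Adjacent u v c)
    (z : D.Circles u → Aα) {k : D.Circles u} (hk : k ∈ farCircles u c) (a b : Aα) :
    ∃ L : Aα →ₗ[Rα] D.State v, ∀ x, splitState u v c (Function.update z k x) a b = L x := by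
  obtain ⟨e₀, he₀, hu⟩ := h.exists_transfer_eq hk
  refine ⟨(PiTensorProduct.tprod Rα).toLinearMap (fun e : D.Circles v =>
    if e = D.circ v (D.inner c) then a else if e = D.circ v (D.outer c) then b
    else z (D.transfer u v e)) e₀, fun x => ?_⟩
  rw [MultilinearMap.toLinearMap_apply, splitState]
  congr 1
  funext e
  have he₀' := mem_farCircles.1 he₀
  by_cases h1 : e = D.circ v (D.inner c)
  · rw [if_pos h1, Function.update_of_ne (h1 ▸ he₀'.1.symm), if_pos h1]
  by_cases h2 : e = D.circ v (D.outer c)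
  · rw [if_neg h1, if_pos h2, Function.update_of_ne (h2 ▸ he₀'.2.symm), if_neg h1, if_pos h2]
  rw [if_neg h1, if_neg h2]
  have he := mem_farCircles.2 ⟨h1, h2⟩
  by_cases hee : e = e₀
  · rw [(hu e he).2 hee, hee, Function.update_self, Function.update_self]
  · rw [Function.update_of_ne hee, Function.update_of_ne fun h' => hee ((hu e he).1 h'),
      if_neg h1, if_neg h2]

theorem splitMap_tprod {u v : D.Vertex} {c : D.Crossing} (h : Adjacent u v c)
    (hm : D.circ u (D.inner c) = D.circ u (D.outer c)) (z : D.Circles u → Aα) :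
    D.splitMap u v c (PiTensorProduct.tprod Rα z) =
      (z (D.circ u (D.inner c))).re • (splitState u v c z (AX - algebraMap Rα Aα α₀) 1 +
        splitState u v c z 1 (AX - algebraMap Rα Aα α₁)) +
      (z (D.circ u (D.inner c))).im •
        (splitState u v c z AX AX - (α₀ * α₁) • splitState u v c z 1 1) := by
  refine constr_stdBasis_tprod (F := fun z =>
      (z (D.circ u (D.inner c))).re • (splitState u v c z (AX - algebraMap Rα Aα α₀) 1 +
        splitState u v c z 1 (AX - algebraMap Rα Aα α₁)) +
      (z (D.circ u (D.inner c))).im •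
        (splitState u v c z AX AX - (α₀ * α₁) • splitState u v c z 1 1)) ?_ (fun x => ?_) z
  · intro z k
    by_cases hk : k = D.circ u (D.inner c)
    · subst hk
      simp only [splitState_update_of_split h, Function.update_self]
      generalize splitState u v c z (AX - algebraMap Rα Aα α₀) 1 +
        splitState u v c z 1 (AX - algebraMap Rα Aα α₁) = s
      generalize splitState u v c z AX AX - (α₀ * α₁) • splitState u v c z 1 1 = t
      refine ⟨{ toFun := fun a => a.re • s + a.im • t, map_add' := ?_, map_smul' := ?_ },
        fun a => rfl⟩
      · intro a b
        rw [QuadraticAlgebra.re_add, QuadraticAlgebra.im_add]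
        module
      · intro r a
        rw [QuadraticAlgebra.re_smul, QuadraticAlgebra.im_smul, RingHom.id_apply]
        module
    · have hk' : k ∈ farCircles u c := mem_farCircles.2 ⟨hk, hm ▸ hk⟩
      obtain ⟨L₁, h₁⟩ := exists_splitState_linear h z hk' (AX - algebraMap Rα Aα α₀) 1
      obtain ⟨L₂, h₂⟩ := exists_splitState_linear h z hk' 1 (AX - algebraMap Rα Aα α₁)
      obtain ⟨L₃, h₃⟩ := exists_splitState_linear h z hk' AX AX
      obtain ⟨L₄, h₄⟩ := exists_splitState_linear h z hk' 1 1
      simp only [h₁, h₂, h₃, h₄, Function.update_of_ne (Ne.symm hk)]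
      exact ⟨(z (D.circ u (D.inner c))).re • (L₁ + L₂) +
        (z (D.circ u (D.inner c))).im • (L₃ - (α₀ * α₁) • L₄), fun a => rfl⟩
  · have h2 : x (D.circ u (D.inner c)) = 0 ∨ x (D.circ u (D.inner c)) = 1 := by
      generalize x (D.circ u (D.inner c)) = y
      revert y; decide
    have e0 : basisAt 0 0 = (⟨1, 0⟩ : Aα) := basisAt_zero_index 0
    have e1 : basisAt 0 1 = (⟨0, 1⟩ : Aα) := by
      rw [basisAt_one_index, map_zero, sub_zero]; rfl
    rcases h2 with h2 | h2
    · simp only [h2, if_true, e0, one_smul, zero_smul, add_zero]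
      rfl
    · simp only [h2, one_ne_zero, if_false, e1, one_smul, zero_smul, zero_add]
      rfl

/-- With `p`, `q`, `r`, `s` standing for `X ⊗ X`, `X ⊗ 1`, `1 ⊗ X`, `1 ⊗ 1` and `x = α₀`, `y = α₁`,
this says that the comultiplication sends `X - α₁` to its tensor square. The next identity is the
same for `X - α₀`. -/
theorem split_identity_left {R M : Type*} [CommRing R] [AddCommGroup M] [Module R M] (x y : R)
    (p q r s : M) : -y • (q - x • s + (r - y • s)) + (1 : R) • (p - (x * y) • s) =
      p - y • r - y • (q - y • s) := by module

theorem split_identity_right {R M : Type*} [CommRing R] [AddCommGroup M] [Module R M] (x y : R)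
    (p q r s : M) : -x • (q - x • s + (r - y • s)) + (1 : R) • (p - (x * y) • s) =
      p - x • r - x • (q - x • s) := by module

/-- The effect of a saddle on the coloured states. -/
theorem saddleF_coloredState {u v : D.Vertex} {c : D.Crossing} (h : Adjacent u v c)
    {Φ : D.Point → Fin 2} (hu : D.Compat u Φ) (hv : D.Compat v Φ) :
    D.saddleF u v c (coloredState u Φ) =
      (if D.circ u (D.inner c) = D.circ u (D.outer c) then (1 : Rα)
        else colorScale (Φ (D.inner c))) • coloredState v Φ := by
  have hc := (h.compat_iff hu).1 hv
  have htr : ∀ e : D.Circles v, Φ (Quot.out (D.transfer u v e)) = Φ (Quot.out e) := fun e =>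
    hu.apply_out _
  unfold saddleF coloredState
  by_cases hm : D.circ u (D.inner c) = D.circ u (D.outer c)
  · have hvne : D.circ v (D.inner c) ≠ D.circ v (D.outer c) := fun h' =>
      h.circ_ne_iff.2 h' hm
    rw [if_neg (not_not.2 hm), if_pos hm, one_smul, splitMap_tprod h hm]
    have hz : PiTensorProduct.tprod Rα (fun e : D.Circles v => colorElt (Φ (Quot.out e))) =
        splitState u v c (fun e => colorElt (Φ (Quot.out e))) (colorElt (Φ (D.inner c)))
          (colorElt (Φ (D.inner c))) := by
      unfold splitState
      congr 1
      funext e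
      split_ifs with h1 h2
      · rw [h1, hv.apply_out]
      · rw [h2, hv.apply_out, hc]
      · exact congrArg colorElt (htr e).symm
    obtain ⟨B, hB⟩ := exists_splitState_bilinear (u := u) (v := v) hvne
      (fun e => colorElt (Φ (Quot.out e)))
    rw [hz]
    simp only [hB, hu.apply_out]
    have hre : (colorElt (Φ (D.inner c))).re = -coroot (Φ (D.inner c)) := by rw [colorElt_eq]
    have him : (colorElt (Φ (D.inner c))).im = 1 := by rw [colorElt_eq]
    rw [hre, him]
    have h2 : Φ (D.inner c) = 0 ∨ Φ (D.inner c) = 1 := by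
      generalize Φ (D.inner c) = y
      revert y; decide
    simp only [colorElt, Algebra.algebraMap_eq_smul_one, map_sub, map_smul, LinearMap.sub_apply,
      LinearMap.smul_apply]
    generalize B AX AX = p
    generalize B AX 1 = q
    generalize B 1 AX = r
    generalize B 1 1 = s
    rcases h2 with h2 | h2 <;> rw [h2] <;> simp only [coroot, if_true, one_ne_zero, if_false]
    · exact split_identity_left α₀ α₁ p q r s
    · exact split_identity_right α₀ α₁ p q r s
  · have hw : (fun e : D.Circles v => if e = D.circ v (D.outer c) then
          colorElt (Φ (Quot.out (D.circ u (D.inner c)))) *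
            colorElt (Φ (Quot.out (D.circ u (D.outer c))))
        else colorElt (Φ (Quot.out (D.transfer u v e)))) =
        Function.update (fun e : D.Circles v => colorElt (Φ (Quot.out e))) (D.circ v (D.outer c))
          (colorScale (Φ (D.inner c)) • colorElt (Φ (D.inner c))) := by
      funext e
      by_cases he : e = D.circ v (D.outer c)
      · rw [if_pos he, he, Function.update_self, hu.apply_out, hu.apply_out, ← hc,
          colorElt_mul_self]
      · rw [if_neg he, Function.update_of_ne he]
        exact congrArg colorElt (htr e)
    rw [if_pos hm, if_neg hm, mergeMap_tprod h hm, hw, MultilinearMap.map_update_smul]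
    congr 2
    refine Function.update_eq_self_iff.2 ?_
    exact congrArg colorElt (hc.trans (hv.apply_out (D.outer c)).symm)

/-- Compatibility is lost only by merging circles of different colours, and the product of the two
orthogonal colour elements is `0`. -/
theorem saddleF_coloredState_of_not_compat {u v : D.Vertex} {c : D.Crossing} (h : Adjacent u v c)
    {Φ : D.Point → Fin 2} (hu : D.Compat u Φ) (hv : ¬ D.Compat v Φ) :
    D.saddleF u v c (coloredState u Φ) = 0 := by
  have hc := fun h' => hv ((h.compat_iff hu).2 h')
  have hm : D.circ u (D.inner c) ≠ D.circ u (D.outer c) := fun h' => hc (hu.eq_of_circ_eq h')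
  unfold saddleF coloredState
  rw [if_pos hm, mergeMap_tprod h hm]
  refine MultilinearMap.map_coord_zero _ (D.circ v (D.outer c)) ?_
  rw [if_pos rfl, hu.apply_out, hu.apply_out, colorElt_mul_of_ne hc]

end Diagram

/-! ### Annular degrees of coloured states -/

/-- The sign of a colour. -/
def colorSign (a : Fin 2) : ℤ := if a = 0 then -1 else 1

theorem basisAt_repr (r : Rα) (z : Aα) (i : Fin 2) :
    (basisAt r).repr z i = if i = 0 then z.re + r * z.im else z.im := by
  fin_cases i <;> rfl

theorem basisAt_apply (r : Rα) (i : Fin 2) :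
    basisAt r i = if i = 0 then (⟨1, 0⟩ : Aα) else ⟨-r, 1⟩ := by
  fin_cases i
  · exact basisAt_zero_index r
  · refine (basisAt_one_index r).trans (QuadraticAlgebra.ext ?_ ?_) <;>
      simp [AX, QuadraticAlgebra.algebraMap_eq]

/-- The coefficients of a multiple of an element of `A_α` with respect to the coloured elements. -/
def colorCoeff (z : Aα) (a : Fin 2) : Rα :=
  if a = 0 then z.re + α₀ * z.im else -(z.re + α₁ * z.im)

theorem smul_eq_sum_colorCoeff (z : Aα) :
    (α₀ - α₁) • z = ∑ a, colorCoeff z a • colorElt a := by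
  rw [Fin.sum_univ_two]
  refine QuadraticAlgebra.ext ?_ ?_ <;> simp [colorCoeff, colorElt_eq, coroot] <;> ring

theorem eq_zero_or_eq_one (a : Fin 2) : a = 0 ∨ a = 1 := by revert a; decide

namespace Diagram

variable {D : Diagram}

open scoped Classical in
/-- The contribution of a circle to the annular degree. -/
def circleDegree (u : D.Vertex) (c : D.Circles u) (i : Fin 2) : ℤ :=
  if D.IsEssential u c then (if i = 0 then -1 else 1) else 0

/-- On an essential circle one of `X - α₀`, `X - α₁` is the basis vector of degree `1`; the other
differs from it by a scalar and has lowest degree `-1`. Which is which alternates with the depth,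
and so does the winding number. -/
theorem le_circleDegree_of_repr_ne_zero {u : D.Vertex} {c : D.Circles u} {a i : Fin 2}
    (h : (D.factorBasis u c).repr (colorElt a) i ≠ 0) :
    winding u c * colorSign a ≤ circleDegree u c i := by
  unfold factorBasis at h
  unfold winding circleDegree colorSign
  by_cases h1 : D.IsEssential u c
  · simp only [if_pos h1] at h ⊢
    by_cases h2 : Even (D.depth u c)
    · simp only [if_pos h2] at h ⊢
      rw [basisAt_repr, colorElt_eq] at h
      rcases eq_zero_or_eq_one a with rfl | rfl <;> rcases eq_zero_or_eq_one i with rfl | rfl <;>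
        simp [coroot] at h ⊢
    · simp only [if_neg h2] at h ⊢
      rw [basisAt_repr, colorElt_eq] at h
      rcases eq_zero_or_eq_one a with rfl | rfl <;> rcases eq_zero_or_eq_one i with rfl | rfl <;>
        simp [coroot] at h ⊢
  · simp [if_neg h1]

/-- The converse triangularity: the basis vector of degree `1` is a colour element itself, so its
expansion does not involve the colour of lowest degree `-1`. -/
theorem circleDegree_le_of_colorCoeff_ne_zero {u : D.Vertex} {c : D.Circles u} {a i : Fin 2}
    (h : colorCoeff (D.factorBasis u c i) a ≠ 0) :
    circleDegree u c i ≤ winding u c * colorSign a := by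
  unfold factorBasis at h
  unfold winding circleDegree colorSign
  by_cases h1 : D.IsEssential u c
  · simp only [if_pos h1] at h ⊢
    by_cases h2 : Even (D.depth u c)
    · simp only [if_pos h2] at h ⊢
      rw [basisAt_apply, colorCoeff] at h
      rcases eq_zero_or_eq_one a with rfl | rfl <;> rcases eq_zero_or_eq_one i with rfl | rfl <;>
        simp at h ⊢
    · simp only [if_neg h2] at h ⊢
      rw [basisAt_apply, colorCoeff] at h
      rcases eq_zero_or_eq_one a with rfl | rfl <;> rcases eq_zero_or_eq_one i with rfl | rfl <;>
        simp at h ⊢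
  · simp [if_neg h1]

theorem adeg_eq (u : D.Vertex) (x : D.Circles u → Fin 2) :
    D.adeg u x = ∑ c, circleDegree u c (x c) := rfl

/-- The annular degree of a coloured state; it does not depend on the smoothing. -/
def colorDegree (Φ : D.Point → Fin 2) : ℤ :=
  altSum (D.strand (fun x => colorSign (Φ x)) 0) (D.width 0)

/-- The right side depends on the smoothing in form only, since the left side is computed from the
labels on ray `0`. Saddles respect the filtration by annular degree for this reason. -/
theorem Compat.colorDegree_eq {u : D.Vertex} {Φ : D.Point → Fin 2} (hu : D.Compat u Φ) :
    colorDegree Φ = ∑ c : D.Circles u, winding u c * colorSign (Φ (Quot.out c)) := by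
  rw [sum_winding_mul fun c : D.Circles u => colorSign (Φ (Quot.out c))]
  have : (fun x => colorSign (Φ (Quot.out (D.circ u x)))) = fun x => colorSign (Φ x) :=
    funext fun x => congrArg colorSign (hu.apply_out x)
  rw [this]
  rfl

theorem Compat.degreeGE_coloredState {u : D.Vertex} {Φ : D.Point → Fin 2} (hu : D.Compat u Φ) :
    DegreeGE (D.homBasis u) (D.adeg u) (colorDegree Φ) (coloredState u Φ) := by
  intro x hx
  rw [homBasis, coloredState, Basis.piTensorProduct_repr_tprod_apply] at hx
  rw [hu.colorDegree_eq, adeg_eq]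
  exact Finset.sum_le_sum fun c _ =>
    le_circleDegree_of_repr_ne_zero fun h => hx (Finset.prod_eq_zero (Finset.mem_univ c) h)

/-- The colouring of the points given by a colouring of the circles. -/
def pointColoring (u : D.Vertex) (φ : D.Circles u → Fin 2) (x : D.Point) : Fin 2 :=
  φ (D.circ u x)

theorem compat_pointColoring (u : D.Vertex) (φ : D.Circles u → Fin 2) :
    D.Compat u (pointColoring u φ) := compat_comp_circ φ

/-- The coefficients of the homogeneous basis with respect to the coloured states. -/
def stateCoeff (u : D.Vertex) (φ x : D.Circles u → Fin 2) : Rα :=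
  ∏ c, colorCoeff (D.factorBasis u c (x c)) (φ c)

theorem smul_homBasis_eq (u : D.Vertex) (x : D.Circles u → Fin 2) :
    (α₀ - α₁) ^ Fintype.card (D.Circles u) • D.homBasis u x =
      ∑ φ, stateCoeff u φ x • coloredState u (pointColoring u φ) := by
  have h1 : ∀ φ, coloredState u (pointColoring u φ) =
      PiTensorProduct.tprod Rα fun c => colorElt (φ c) := fun φ => by
    unfold coloredState
    congr 1
    funext c
    exact congrArg (fun c => colorElt (φ c)) (circ_out c)
  have h2 : (α₀ - α₁) ^ Fintype.card (D.Circles u) • D.homBasis u x =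
      PiTensorProduct.tprod Rα fun c => (α₀ - α₁) • D.factorBasis u c (x c) := by
    rw [MultilinearMap.map_smul_univ, homBasis, Basis.piTensorProduct_apply, Finset.prod_const,
      Finset.card_univ]
  rw [h2]
  simp only [smul_eq_sum_colorCoeff, h1]
  rw [MultilinearMap.map_sum]
  refine Finset.sum_congr rfl fun φ _ => ?_
  rw [MultilinearMap.map_smul_univ]
  rfl

theorem adeg_le_of_stateCoeff_ne_zero {u : D.Vertex} {φ x : D.Circles u → Fin 2}
    (h : stateCoeff u φ x ≠ 0) : D.adeg u x ≤ colorDegree (pointColoring u φ) := by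
  rw [(compat_pointColoring u φ).colorDegree_eq, adeg_eq]
  refine Finset.sum_le_sum fun c _ => ?_
  have h1 : pointColoring u φ (Quot.out c) = φ c := congrArg φ (circ_out c)
  rw [h1]
  exact circleDegree_le_of_colorCoeff_ne_zero fun h' => h (Finset.prod_eq_zero (Finset.mem_univ c) h')

theorem alpha_sub_ne_zero : α₀ - α₁ ≠ 0 := by
  rw [sub_ne_zero]
  intro h
  have := MvPolynomial.X_injective h
  exact absurd this (by decide)

/-- On coloured states the claim is clear, since `Φ` and its degree are kept or the image is `0`. It
passes to the homogeneous basis because a power of `α₀ - α₁` times a basis vector is a combination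
of coloured states of at least its degree. -/
theorem Adjacent.degreeGE_saddleF {u v : D.Vertex} {c : D.Crossing} (h : Adjacent u v c)
    (x : D.Circles u → Fin 2) :
    DegreeGE (D.homBasis v) (D.adeg v) (D.adeg u x) (D.saddleF u v c (D.homBasis u x)) := by
  refine degreeGE_of_family (J := D.Circles u → Fin 2) (pow_ne_zero _ alpha_sub_ne_zero)
    (smul_homBasis_eq u) (fun φ x => adeg_le_of_stateCoeff_ne_zero) (fun φ => ?_) x
  have hu := compat_pointColoring u φ
  by_cases hv : D.Compat v (pointColoring u φ)
  · rw [saddleF_coloredState h hu hv]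
    exact hv.degreeGE_coloredState.smul _
  · rw [saddleF_coloredState_of_not_compat h hu hv]
    exact DegreeGE.zero _

/-- The homogeneous component of lowest degree of a coloured state. -/
def leadingState (u : D.Vertex) (Φ : D.Point → Fin 2) : D.State u :=
  homogeneousPart (D.homBasis u) (D.adeg u) (colorDegree Φ) (coloredState u Φ)

theorem saddleG_leadingState {u v : D.Vertex} {c : D.Crossing} (h : Adjacent u v c)
    {Φ : D.Point → Fin 2} (hu : D.Compat u Φ) (hv : D.Compat v Φ) :
    D.saddleG u v c (leadingState u Φ) =
      (if D.circ u (D.inner c) = D.circ u (D.outer c) then (1 : Rα)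
        else colorScale (Φ (D.inner c))) • leadingState v Φ := by
  rw [saddleG, leadingState, degreePreservingPart_homogeneousPart h.degreeGE_saddleF
    hu.degreeGE_coloredState, saddleF_coloredState h hu hv, map_smul]
  rfl

theorem saddleG_leadingState_of_not_compat {u v : D.Vertex} {c : D.Crossing} (h : Adjacent u v c)
    {Φ : D.Point → Fin 2} (hu : D.Compat u Φ) (hv : ¬ D.Compat v Φ) :
    D.saddleG u v c (leadingState u Φ) = 0 := by
  rw [saddleG, leadingState, degreePreservingPart_homogeneousPart h.degreeGE_saddleF
    hu.degreeGE_coloredState, saddleF_coloredState_of_not_compat h hu hv, map_zero]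

theorem smul_homBasis_mem_span (u : D.Vertex) (x : D.Circles u → Fin 2) :
    (α₀ - α₁) ^ Fintype.card (D.Circles u) • D.homBasis u x ∈
      Submodule.span Rα (Set.range fun φ => leadingState u (pointColoring u φ)) := by
  rw [smul_basis_eq_sum_homogeneousPart (smul_homBasis_eq u)
    (fun φ x => adeg_le_of_stateCoeff_ne_zero)
    (fun φ => (compat_pointColoring u φ).degreeGE_coloredState) x]
  exact Submodule.sum_mem _ fun φ _ => Submodule.smul_mem _ _ (Submodule.subset_span ⟨φ, rfl⟩)

end Diagram

namespace Diagram

variable {D : Diagram}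

/-! ### Signs of the edges of the cube -/

theorem edgeSign_mul_self (u : D.Vertex) (c : D.Crossing) :
    D.edgeSign u c * D.edgeSign u c = 1 := by
  rw [edgeSign, ← mul_pow]; simp

theorem edgeSign_update_of_not_lt (u : D.Vertex) {c c' : D.Crossing} (h : ¬ c' < c) :
    D.edgeSign (Function.update u c' true) c = D.edgeSign u c := by
  unfold edgeSign
  congr 2
  refine Finset.filter_congr fun e _ => and_congr_right fun he => ?_
  have : e ≠ c' := by rintro rfl; exact h he
  rw [Function.update_of_ne this]

theorem edgeSign_update_of_lt (u : D.Vertex) {c c' : D.Crossing} (h : c' < c)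
    (hu : u c' = false) : D.edgeSign (Function.update u c' true) c = -D.edgeSign u c := by
  unfold edgeSign
  have : (Finset.univ.filter fun e : D.Crossing => e < c ∧ Function.update u c' true e = true) =
      insert c' (Finset.univ.filter fun e : D.Crossing => e < c ∧ u e = true) := by
    ext e
    simp only [Finset.mem_filter, Finset.mem_univ, true_and, Finset.mem_insert]
    by_cases he : e = c'
    · subst he; simp [h]
    · simp [he]
  rw [this, Finset.card_insert_of_notMem (by simp [hu]), pow_succ]
  ring

theorem edgeSign_square (u : D.Vertex) {c c' : D.Crossing} (hc : c ≠ c') (h : u c = false)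
    (h' : u c' = false) :
    D.edgeSign u c * D.edgeSign (Function.update u c true) c' +
      D.edgeSign u c' * D.edgeSign (Function.update u c' true) c = 0 := by
  rcases lt_or_gt_of_ne hc with hlt | hlt
  · rw [edgeSign_update_of_lt u hlt h, edgeSign_update_of_not_lt u hlt.not_gt]
    ring
  · rw [edgeSign_update_of_lt u hlt h', edgeSign_update_of_not_lt u hlt.not_gt]
    ring

variable (D) in
theorem isCubeSign_edgeSign :
    IsCubeSign fun (u : D.Vertex) (c : D.Crossing) => algebraMap Rα RαD (D.edgeSign u c) where
  mul_self u c := by rw [← map_mul, edgeSign_mul_self, map_one]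
  square u c c' hc h h' := by
    rw [← map_mul, ← map_mul, ← map_add, edgeSign_square u hc h h', map_zero]

/-! ### The differential on coloured states -/

theorem dα_single (u : D.Vertex) (m : D.State u) :
    D.dα (Pi.single u m) = ∑ c, if u c = false then
      D.edgeSign u c • (Pi.single (Function.update u c true)
        (D.saddleG u (Function.update u c true) c m) : D.Chain) else 0 := by
  funext v
  rw [dα, LinearMap.pi_apply, LinearMap.sum_apply, Finset.sum_apply]
  refine Finset.sum_congr rfl fun c _ => ?_
  have hcast : ∀ w, w = v → (Pi.single w (D.saddleG u w c m) : D.Chain) v = D.saddleG u v c m := by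
    rintro _ rfl
    exact Pi.single_eq_same _ _
  by_cases hv : v c = true
  · rw [if_pos hv, LinearMap.smul_apply, LinearMap.comp_apply, LinearMap.proj_apply]
    by_cases hs : D.source v c = u
    · subst hs
      have h1 : D.source v c c = false := by simp [source]
      have h2 : Function.update (D.source v c) c true = v := by
        rw [source, Function.update_idem]
        exact Function.update_eq_self_iff.2 hv.symm
      have h3 : D.edgeSign v c = D.edgeSign (D.source v c) c := by
        rw [← edgeSign_update_of_not_lt (D.source v c) (lt_irrefl c), h2]
      rw [if_pos h1, Pi.single_eq_same, Pi.smul_apply, hcast _ h2, h3]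
    · rw [Pi.single_eq_of_ne hs, map_zero, smul_zero]
      split_ifs with hu
      · rw [Pi.smul_apply, Pi.single_eq_of_ne, smul_zero]
        rintro rfl
        apply hs
        rw [source, Function.update_idem]
        exact Function.update_eq_self_iff.2 hu.symm
      · rfl
  · rw [if_neg hv, LinearMap.zero_apply]
    split_ifs with hu
    · rw [Pi.smul_apply, Pi.single_eq_of_ne, smul_zero]
      rintro rfl
      simp at hv
    · rfl

theorem dα_single_leadingState {u : D.Vertex} {Φ : D.Point → Fin 2} (hu : D.Compat u Φ) :
    D.dα (Pi.single u (leadingState u Φ)) = ∑ c, if u c = false then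
      D.edgeSign u c • (open scoped Classical in if D.Compat (Function.update u c true) Φ then
        (if D.circ u (D.inner c) = D.circ u (D.outer c) then (1 : Rα)
          else colorScale (Φ (D.inner c))) •
            (Pi.single (Function.update u c true)
              (leadingState (Function.update u c true) Φ) : D.Chain) else 0) else 0 := by
  rw [dα_single]
  refine Finset.sum_congr rfl fun c _ => ?_
  by_cases hc : u c = false
  · rw [if_pos hc, if_pos hc]
    split_ifs with hv hs
    · rw [saddleG_leadingState (adjacent_update hc) hu hv, if_pos hs, one_smul, one_smul]
    · rw [saddleG_leadingState (adjacent_update hc) hu hv, if_neg hs]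
      congr 1
      exact Pi.single_smul _ _ _
    · rw [saddleG_leadingState_of_not_compat (adjacent_update hc) hu hv, Pi.single_zero]
  · rw [if_neg hc, if_neg hc]

/-! ### Rescaling -/

/-- The exponent of the rescaling factor of a coloured state. -/
def scaleExp (u : D.Vertex) (Φ : D.Point → Fin 2) (a : Fin 2) : ℕ :=
  ((Finset.univ.filter fun c : D.Crossing => u c = true ∧ Φ (D.inner c) = a).card +
    Nat.card D.Point - colorCount u Φ a) / 2

/-- The rescaling factor of a coloured state. -/
def stateScale (u : D.Vertex) (Φ : D.Point → Fin 2) : Rα := ∏ a, colorScale a ^ scaleExp u Φ a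

/-- For the colour at `c`, the number of `1`-smoothings of that colour grows by one, while the
number of circles of that colour drops by one in a merge and grows by one in a split. The numerator
thus changes by `2` or `0`, and rounding in the halving is harmless. The summand `Nat.card D.Point`
bounds the number of circles, so the subtraction is never truncated. -/
theorem scaleExp_update {u : D.Vertex} {Φ : D.Point → Fin 2} {c : D.Crossing} (hc : u c = false)
    (hu : D.Compat u Φ) (hv : D.Compat (Function.update u c true) Φ) (a : Fin 2) :
    scaleExp (Function.update u c true) Φ a = scaleExp u Φ a +
      if D.circ u (D.inner c) = D.circ u (D.outer c) then 0
      else if Φ (D.inner c) = a then 1 else 0 := by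
  have hones : (Finset.univ.filter fun c' : D.Crossing =>
      Function.update u c true c' = true ∧ Φ (D.inner c') = a).card =
      (Finset.univ.filter fun c' : D.Crossing => u c' = true ∧ Φ (D.inner c') = a).card +
        if Φ (D.inner c) = a then 1 else 0 := by
    split_ifs with ha
    · rw [← Finset.card_insert_of_notMem (a := c) (by simp [hc])]
      congr 1
      ext e
      by_cases he : e = c
      · subst he; simp [ha]
      · simp [he]
    · rw [add_zero]
      congr 1
      ext e
      by_cases he : e = c
      · subst he; simp [ha]
      · simp [Function.update_of_ne he]
  have h1 := colorCount_le u Φ a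
  have h2 := colorCount_le (Function.update u c true) Φ a
  unfold scaleExp
  rw [hones]
  by_cases hm : D.circ u (D.inner c) = D.circ u (D.outer c)
  · have h3 := (adjacent_update hc).colorCount_of_split hu hv hm a
    rw [if_pos hm]
    omega
  · have h3 := (adjacent_update hc).colorCount_of_merge hu hv hm a
    rw [if_neg hm]
    split_ifs at * <;> omega

theorem stateScale_update {u : D.Vertex} {Φ : D.Point → Fin 2} {c : D.Crossing} (hc : u c = false)
    (hu : D.Compat u Φ) (hv : D.Compat (Function.update u c true) Φ) :
    stateScale (Function.update u c true) Φ = stateScale u Φ *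
      if D.circ u (D.inner c) = D.circ u (D.outer c) then 1 else colorScale (Φ (D.inner c)) := by
  unfold stateScale
  simp only [scaleExp_update hc hu hv, pow_add, Finset.prod_mul_distrib]
  congr 1
  split_ifs with hm
  · simp
  · simp

theorem isUnit_colorScale (a : Fin 2) : IsUnit (algebraMap Rα RαD (colorScale a)) := by
  have h : IsUnit (algebraMap Rα RαD discr) := IsLocalization.Away.algebraMap_isUnit discr
  have h1 : discr = colorScale a * colorScale a := by
    rcases eq_zero_or_eq_one a with rfl | rfl <;> simp only [colorScale, root, coroot, if_true,
      one_ne_zero, if_false] <;> ring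
  have h2 := congrArg (algebraMap Rα RαD) h1
  rw [h2, map_mul] at h
  exact isUnit_of_mul_isUnit_left h

theorem isUnit_stateScale (u : D.Vertex) (Φ : D.Point → Fin 2) :
    IsUnit (algebraMap Rα RαD (stateScale u Φ)) := by
  rw [stateScale, Fin.prod_univ_two, map_mul, map_pow, map_pow]
  exact ((isUnit_colorScale 0).pow _).mul ((isUnit_colorScale 1).pow _)

/-- The rescaled coloured states. -/
def chainGen (u : D.Vertex) (Φ : D.Point → Fin 2) : RαD ⊗[Rα] D.Chain :=
  algebraMap Rα RαD (stateScale u Φ) ⊗ₜ (Pi.single u (leadingState u Φ) : D.Chain)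

/-- The factor `colorScale` that a merge produces is exactly the quotient of the scales of its two
ends, so only edge signs remain. -/
theorem dαD_chainGen {u : D.Vertex} {Φ : D.Point → Fin 2} (hu : D.Compat u Φ) :
    D.dαD (chainGen u Φ) = ∑ c, if u c = false then
      algebraMap Rα RαD (D.edgeSign u c) •
        (open scoped Classical in if D.Compat (Function.update u c true) Φ then
          chainGen (Function.update u c true) Φ else 0) else 0 := by
  rw [chainGen, dαD, LinearMap.baseChange_tmul, dα_single_leadingState hu, TensorProduct.tmul_sum]
  refine Finset.sum_congr rfl fun c _ => ?_
  by_cases hc : u c = false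
  · rw [if_pos hc, if_pos hc, TensorProduct.tmul_smul, algebraMap_smul]
    congr 1
    by_cases hv : D.Compat (Function.update u c true) Φ
    · rw [if_pos hv, if_pos hv, chainGen, stateScale_update hc hu hv, map_mul,
        TensorProduct.tmul_smul, TensorProduct.smul_tmul', Algebra.smul_def]
      congr 1
      exact mul_comm _ _
    · rw [if_neg hv, if_neg hv, TensorProduct.tmul_zero]
  · rw [if_neg hc, if_neg hc, TensorProduct.tmul_zero]

variable (D) in
/-- The vertices with a colouring of the circles. -/
def colorEquiv : (Σ u : D.Vertex, (D.Circles u → Fin 2)) ≃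
    {x : (D.Crossing → Bool) × (D.Point → Fin 2) //
      CubeCompat BaseCompat (fun Φ (c : D.Crossing) s => D.SectorCompat Φ c.1 s) x} where
  toFun x := ⟨(x.1, pointColoring x.1 x.2), cubeCompat_iff.2 (compat_pointColoring x.1 x.2)⟩
  invFun x := ⟨x.1.1, fun c => x.1.2 (Quot.out c)⟩
  left_inv := by
    rintro ⟨u, φ⟩
    have : (fun c : D.Circles u => pointColoring u φ (Quot.out c)) = φ :=
      funext fun c => congrArg φ (circ_out c)
    exact congrArg (Sigma.mk u) this
  right_inv := by
    rintro ⟨⟨u, Φ⟩, h⟩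
    have hu := cubeCompat_iff.1 h
    refine Subtype.ext (Prod.ext rfl (funext fun x => ?_))
    exact hu.apply_out x

variable (D) in
theorem top_le_span_chainGen : ⊤ ≤ Submodule.span RαD
    (Set.range fun x : Σ u : D.Vertex, (D.Circles u → Fin 2) =>
      chainGen x.1 (pointColoring x.1 x.2)) := by
  set S := Submodule.span RαD (Set.range fun x : Σ u : D.Vertex, (D.Circles u → Fin 2) =>
      chainGen x.1 (pointColoring x.1 x.2)) with hS
  let b := (Pi.basis fun u => D.homBasis u).baseChange RαD
  rw [← b.span_eq, Submodule.span_le]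
  rintro _ ⟨⟨u, x⟩, rfl⟩
  rw [Module.Basis.baseChange_apply, Pi.basis_apply]
  let ι : D.State u →ₗ[Rα] RαD ⊗[Rα] D.Chain :=
    TensorProduct.mk Rα RαD D.Chain 1 ∘ₗ LinearMap.single Rα _ u
  have h1 : Submodule.span Rα (Set.range fun φ => leadingState u (pointColoring u φ)) ≤
      (S.restrictScalars Rα).comap ι := by
    rw [Submodule.span_le]
    rintro _ ⟨φ, rfl⟩
    have h2 : chainGen u (pointColoring u φ) ∈ S := Submodule.subset_span ⟨⟨u, φ⟩, rfl⟩
    have h3 : chainGen u (pointColoring u φ) =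
        algebraMap Rα RαD (stateScale u (pointColoring u φ)) •
          ι (leadingState u (pointColoring u φ)) := by
      change _ = _ • ((1 : RαD) ⊗ₜ[Rα] _)
      rw [TensorProduct.smul_tmul', smul_eq_mul, mul_one]
      rfl
    rw [h3] at h2
    exact (S.smul_mem_iff_of_isUnit (isUnit_stateScale _ _)).1 h2
  -- Only a multiple of the basis vector by a power of `α₀ - α₁` is known to lie in the span; this
  -- factor is `colorScale 0`, a unit in `RαD`.
  have h2 := h1 (smul_homBasis_mem_span u x)
  rw [Submodule.mem_comap, map_smul] at h2
  rw [← algebraMap_smul RαD, map_pow] at h2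
  exact (S.smul_mem_iff_of_isUnit ((isUnit_colorScale 0).pow _)).1 h2

variable (D) in
/-- The chain complex is a cube complex of colourings. -/
theorem exists_basis_isCubeDifferential :
    ∃ b : Module.Basis {x : (D.Crossing → Bool) × (D.Point → Fin 2) //
        CubeCompat BaseCompat (fun Φ (c : D.Crossing) s => D.SectorCompat Φ c.1 s) x} RαD
        (RαD ⊗[Rα] D.Chain),
      IsCubeDifferential b (fun u c => algebraMap Rα RαD (D.edgeSign u c)) D.dαD := by
  classical
  obtain ⟨b', hb'⟩ := exists_basis_of_span ((Pi.basis fun u => D.homBasis u).baseChange RαD) _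
    (top_le_span_chainGen D)
  have hb : ∀ u Φ, cubeGen (b'.reindex (colorEquiv D)) u Φ =
      if D.Compat u Φ then chainGen u Φ else 0 := by
    intro u Φ
    by_cases h : D.Compat u Φ
    · rw [if_pos h, cubeGen_of_compat _ (cubeCompat_iff.2 h), Module.Basis.reindex_apply, hb']
      change chainGen u (pointColoring u fun c => Φ (Quot.out c)) = _
      congr 1
      exact funext fun x => h.apply_out x
    · rw [if_neg h, cubeGen_of_not_compat _ fun h' => h (cubeCompat_iff.1 h')]
  refine ⟨b'.reindex (colorEquiv D), fun u Φ h => ?_⟩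
  have hu := cubeCompat_iff.1 h
  simp only [hb]
  rw [if_pos hu, dαD_chainGen hu]

variable (D) in
theorem dαD_comp_dαD : D.dαD ∘ₗ D.dαD = 0 := by
  obtain ⟨b, hb⟩ := exists_basis_isCubeDifferential D
  exact hb.comp_self (isCubeSign_edgeSign D)

variable (D) in
theorem free_Kh_and_finrank_Kh : Module.Free RαD D.Kh ∧
    Module.finrank RαD D.Kh = 2 ^ Nat.card (LinkComponents D) := by
  obtain ⟨b, hb⟩ := exists_basis_isCubeDifferential D
  obtain ⟨e⟩ := hb.nonempty_homology_equiv (isCubeSign_edgeSign D)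
  refine ⟨Module.Free.of_equiv e.symm, ?_⟩
  rw [e.finrank_eq, ← card_cubeIsolated]
  have : Nontrivial RαD := (IsLocalization.injective RαD
    (powers_le_nonZeroDivisors_of_noZeroDivisors (pow_ne_zero 2 alpha_sub_ne_zero))).nontrivial
  have := Fintype.ofFinite {Φ : D.Point → Fin 2 // CubeIsolated BaseCompat
      (fun Φ (c : D.Crossing) s => D.SectorCompat Φ c.1 s) Φ}
  rw [Module.finrank_finsupp_self, Nat.card_eq_fintype_card]

end Diagram

/-! ### Partitions into closed connected sets -/

/-- Since the family is finite, the union of all `B k'` other than a given `B k` is closed, and a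
preconnected set cannot meet two disjoint closed sets that cover it. -/
theorem exists_subset_of_closed_cover {X κ : Type*} [TopologicalSpace X] [Finite κ] {A : Set X}
    {B : κ → Set X} (hA : IsPreconnected A) (hA' : A.Nonempty) (hB : ∀ k, IsClosed (B k))
    (hd : ∀ k k', k ≠ k' → Disjoint (B k) (B k')) (hAB : A ⊆ ⋃ k, B k) : ∃ k, A ⊆ B k := by
  obtain ⟨a, ha⟩ := hA'
  obtain ⟨k, hk⟩ := Set.mem_iUnion.1 (hAB ha)
  refine ⟨k, ?_⟩
  have hcl : IsClosed (⋃ k' : {k' // k' ≠ k}, B k') := isClosed_iUnion_of_finite fun k' => hB k'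
  have hdis : Disjoint (B k) (⋃ k' : {k' // k' ≠ k}, B k') :=
    Set.disjoint_iUnion_right.2 fun k' => hd _ _ k'.2.symm
  refine (isPreconnected_iff_subset_of_disjoint_closed.1 hA _ _ (hB k) hcl ?_ ?_).resolve_right ?_
  · intro x hx
    obtain ⟨k', hk'⟩ := Set.mem_iUnion.1 (hAB hx)
    by_cases h : k' = k
    · exact Or.inl (h ▸ hk')
    · exact Or.inr (Set.mem_iUnion.2 ⟨⟨k', h⟩, hk'⟩)
  · rw [hdis.inter_eq, Set.inter_empty]
  · intro h
    exact Set.disjoint_left.1 hdis hk (h ha)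

/-- The number of sets in a finite partition into closed connected sets. -/
theorem card_eq_of_closed_partitions {X ι κ : Type*} [TopologicalSpace X] [Finite ι] [Finite κ]
    {A : ι → Set X} {B : κ → Set X} (hA : ∀ i, IsPreconnected (A i)) (hB : ∀ k, IsPreconnected (B k))
    (hA' : ∀ i, (A i).Nonempty) (hB' : ∀ k, (B k).Nonempty) (hAc : ∀ i, IsClosed (A i))
    (hBc : ∀ k, IsClosed (B k)) (hAd : ∀ i i', i ≠ i' → Disjoint (A i) (A i'))
    (hBd : ∀ k k', k ≠ k' → Disjoint (B k) (B k')) (hAB : ⋃ i, A i = ⋃ k, B k) :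
    Nat.card ι = Nat.card κ := by
  have h1 : ∀ i, ∃ k, A i ⊆ B k := fun i =>
    exists_subset_of_closed_cover (hA i) (hA' i) hBc hBd (hAB ▸ Set.subset_iUnion A i)
  have h2 : ∀ k, ∃ i, B k ⊆ A i := fun k =>
    exists_subset_of_closed_cover (hB k) (hB' k) hAc hAd (hAB ▸ Set.subset_iUnion B k)
  choose f hf using h1
  choose g hg using h2
  refine Nat.card_congr ⟨f, g, fun i => ?_, fun k => ?_⟩
  · by_contra h
    obtain ⟨a, ha⟩ := hA' i
    exact Set.disjoint_left.1 (hAd _ _ h) (hg _ (hf i ha)) ha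
  · by_contra h
    obtain ⟨b, hb⟩ := hB' k
    exact Set.disjoint_left.1 (hBd _ _ h) (hf _ (hg k hb)) hb

namespace Diagram

variable (D : Diagram)

/-! ### Coordinates on the thickened annulus -/

/-- The point with given coordinates. -/
def linkPoint (t x h : ℝ) : ThickenedAnnulus :=
  (⟨((2 - 1 / (max x 0 + 2) : ℝ) : ℂ) *
      Complex.exp (((2 * Real.pi * t / (D.N + 1) : ℝ) : ℂ) * Complex.I), by
    have h0 : 0 ≤ max x 0 := le_max_right _ _
    have h1 : 0 < 1 / (max x 0 + 2) := by positivity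
    have h2 : 1 / (max x 0 + 2) ≤ 1 := by
      rw [div_le_one (by positivity)]
      linarith
    rw [norm_mul, Complex.norm_exp_ofReal_mul_I, mul_one, Complex.norm_real, Real.norm_eq_abs,
      abs_of_nonneg (by linarith)]
    constructor <;> linarith⟩, Set.projIcc 0 1 zero_le_one h)

theorem continuous_linkPoint : Continuous fun z : ℝ × ℝ × ℝ => D.linkPoint z.1 z.2.1 z.2.2 := by
  refine Continuous.prodMk (Continuous.subtype_mk ?_ _) (continuous_projIcc.comp (by fun_prop))
  refine Continuous.mul (Complex.continuous_ofReal.comp ?_) (by fun_prop)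
  refine continuous_const.sub (continuous_const.div (by fun_prop) fun z => ?_)
  have h0 : 0 ≤ max z.2.1 0 := le_max_right _ _
  positivity

variable {D}

/-- The truncations of `x` and `h` in `linkPoint` make it a continuous map on all of `ℝ³`; in the
range of parameters that occurs on links they do nothing. -/
theorem hasCoords_iff {y : ThickenedAnnulus} {t x h : ℝ} (hx : 0 ≤ x) (hh : 0 ≤ h ∧ h ≤ 1) :
    D.HasCoords y t x h ↔ y = D.linkPoint t x h := by
  have hp : ((Set.projIcc (0 : ℝ) 1 zero_le_one h : unitInterval) : ℝ) = h := by
    rw [Set.projIcc_of_mem zero_le_one ⟨hh.1, hh.2⟩]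
  constructor
  · rintro ⟨h1, h2⟩
    refine Prod.ext (Subtype.ext ?_) (Subtype.ext ?_)
    · simp only [h1, linkPoint, max_eq_left hx]
    · rw [h2, linkPoint, hp]
  · rintro rfl
    refine ⟨?_, hp⟩
    simp only [linkPoint, max_eq_left hx]

/-- The modulus determines `x`, because `2 - 1/(x + 2)` is injective and positive for `x ≥ 0`, and
the argument determines `t` up to multiples of the period `N + 1`. -/
theorem HasCoords.unique {y : ThickenedAnnulus} {t x h t' x' h' : ℝ} (H : D.HasCoords y t x h)
    (H' : D.HasCoords y t' x' h') (hx : 0 ≤ x) (hx' : 0 ≤ x') :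
    x = x' ∧ h = h' ∧ ∃ n : ℤ, t = t' + n * (D.N + 1) := by
  obtain ⟨h1, h2⟩ := H
  obtain ⟨h1', h2'⟩ := H'
  have hr : ∀ x : ℝ, 0 ≤ x → 0 < 2 - 1 / (x + 2) := fun x hx => by
    have : 1 / (x + 2) ≤ 1 := by
      rw [div_le_one (by positivity)]
      linarith
    linarith
  have heq := h1.symm.trans h1'
  have hn := congrArg norm heq
  rw [norm_mul, norm_mul, Complex.norm_exp_ofReal_mul_I, Complex.norm_exp_ofReal_mul_I, mul_one,
    mul_one, Complex.norm_real, Complex.norm_real, Real.norm_eq_abs, Real.norm_eq_abs,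
    abs_of_pos (hr x hx), abs_of_pos (hr x' hx')] at hn
  have hxx : x = x' := by
    have h3 : 1 / (x + 2) = 1 / (x' + 2) := by linarith
    have h4 : x + 2 = x' + 2 := by
      rw [one_div, one_div] at h3
      exact inv_injective h3
    linarith
  refine ⟨hxx, h2.symm.trans h2', ?_⟩
  subst hxx
  have hne : (((2 - 1 / (x + 2) : ℝ)) : ℂ) ≠ 0 := by exact_mod_cast (hr x hx).ne'
  obtain ⟨n, hn⟩ := Complex.exp_eq_exp_iff_exists_int.1 (mul_left_cancel₀ hne heq)
  refine ⟨n, ?_⟩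
  have h5 : (((2 * Real.pi * t / (D.N + 1) : ℝ)) : ℂ) =
      ((2 * Real.pi * t' / (D.N + 1) + n * (2 * Real.pi) : ℝ) : ℂ) := by
    refine mul_right_cancel₀ Complex.I_ne_zero ?_
    rw [hn]
    push_cast
    ring
  have h6 := Complex.ofReal_injective h5
  have hN : (0 : ℝ) < D.N + 1 := by positivity
  have hpi := Real.pi_pos
  field_simp at h6
  linarith

theorem linkPoint_add_period (t x h : ℝ) : D.linkPoint (t + (D.N + 1)) x h = D.linkPoint t x h := by
  refine Prod.ext (Subtype.ext ?_) rfl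
  simp only [linkPoint]
  congr 1
  rw [Complex.exp_eq_exp_iff_exists_int]
  refine ⟨1, ?_⟩
  have hN : (D.N + 1 : ℂ) ≠ 0 := by exact_mod_cast Nat.succ_ne_zero D.N
  push_cast
  field_simp

variable (D) in
/-- The point of the link at which it meets a ray. -/
def rayPoint (a : D.Point) : ThickenedAnnulus := D.linkPoint (a.1.1 : ℕ) (a.1.2 : ℕ) (1 / 2)

theorem linkPoint_add_one (j : Fin (D.N + 1)) (x h : ℝ) :
    D.linkPoint ((j : ℕ) + 1) x h = D.linkPoint ((j + 1 : Fin (D.N + 1)) : ℕ) x h := by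
  by_cases hj : j = Fin.last D.N
  · subst hj
    rw [Fin.last_add_one, Fin.val_last]
    have := linkPoint_add_period (D := D) 0 x h
    simpa using this
  · rw [Fin.val_add_one_of_lt (Fin.lt_last_iff_ne_last.2 hj)]
    push_cast
    rfl

/-! ### The arcs of the link in one sector -/

open scoped Classical in
/-- The arc of the link inside one sector that joins two points. -/
def ArcCurve (a b : D.Point) (γ : ℝ → ThickenedAnnulus) : Prop :=
  ∃ j : Fin (D.N + 1),
    ((a.1.1 = j ∧ b.1.1 = j + 1 ∧ (D.slab j).Strand a.1.2 b.1.2) ∧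
      γ = fun s => D.linkPoint ((j : ℕ) + s) ((1 - s) * a.1.2 + s * b.1.2)
        (1 / 2 + if (D.slab j).Over a.1.2 b.1.2 then s * (1 - s) else 0)) ∨
    ((a.1.1 = j ∧ b.1.1 = j ∧ D.slab j = Slab.death a.1.2 ∧ b.1.2 = a.1.2 + 1) ∧
      γ = fun s => D.linkPoint ((j : ℕ) + (1 - |2 * s - 1|) / 2) (a.1.2 + s) (1 / 2)) ∨
    ((a.1.1 = j + 1 ∧ b.1.1 = j + 1 ∧ D.slab j = Slab.birth a.1.2 ∧ b.1.2 = a.1.2 + 1) ∧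
      γ = fun s => D.linkPoint ((j : ℕ) + (1 + |2 * s - 1|) / 2) (a.1.2 + s) (1 / 2))

theorem LinkArc.exists_arcCurve {a b : D.Point} (h : LinkArc a b) : ∃ γ, ArcCurve a b γ := by
  obtain ⟨j, h | h | h⟩ := h
  exacts [⟨_, j, Or.inl ⟨h, rfl⟩⟩, ⟨_, j, Or.inr (Or.inl ⟨h, rfl⟩)⟩,
    ⟨_, j, Or.inr (Or.inr ⟨h, rfl⟩)⟩]

theorem ArcCurve.continuous {a b : D.Point} {γ : ℝ → ThickenedAnnulus} (h : ArcCurve a b γ) :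
    Continuous γ := by
  classical
  obtain ⟨j, ⟨-, rfl⟩ | ⟨-, rfl⟩ | ⟨-, rfl⟩⟩ := h
  · refine (continuous_linkPoint D).comp (f := fun s : ℝ => ((j : ℕ) + s, (1 - s) * a.1.2 + s * b.1.2,
      1 / 2 + if (D.slab j).Over a.1.2 b.1.2 then s * (1 - s) else 0)) ?_
    split_ifs <;> fun_prop
  · exact (continuous_linkPoint D).comp (f := fun s : ℝ => ((j : ℕ) + (1 - |2 * s - 1|) / 2,
      a.1.2 + s, 1 / 2)) (by fun_prop)
  · exact (continuous_linkPoint D).comp (f := fun s : ℝ => ((j : ℕ) + (1 + |2 * s - 1|) / 2,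
      a.1.2 + s, 1 / 2)) (by fun_prop)

theorem ArcCurve.apply_zero {a b : D.Point} {γ : ℝ → ThickenedAnnulus} (h : ArcCurve a b γ) :
    γ 0 = D.rayPoint a := by
  obtain ⟨j, ⟨h, rfl⟩ | ⟨h, rfl⟩ | ⟨h, rfl⟩⟩ := h
  · simp [rayPoint, h.1]
  · simp [rayPoint, h.1]
  · simp [rayPoint, h.1, linkPoint_add_one]

theorem ArcCurve.apply_one {a b : D.Point} {γ : ℝ → ThickenedAnnulus} (h : ArcCurve a b γ) :
    γ 1 = D.rayPoint b := by
  obtain ⟨j, ⟨h, rfl⟩ | ⟨h, rfl⟩ | ⟨h, rfl⟩⟩ := h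
  · simp [rayPoint, h.2.1, linkPoint_add_one]
  · have h1 : (1 - |(2 : ℝ) * 1 - 1|) / 2 = 0 := by norm_num
    simp only [h1, rayPoint, h.2.1, h.2.2.2, add_zero]
    push_cast
    rfl
  · have h1 : (1 + |(2 : ℝ) * 1 - 1|) / 2 = 1 := by norm_num
    simp only [h1, linkPoint_add_one, rayPoint, h.2.1, h.2.2.2]
    push_cast
    rfl

variable (D) in
theorem finite_arcCurves : {γ : ℝ → ThickenedAnnulus | ∃ a b : D.Point, ArcCurve a b γ}.Finite := by
  classical
  refine (Set.finite_range fun z : Fin (D.N + 1) × D.Point × D.Point × Fin 3 =>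
    if z.2.2.2 = 0 then fun s : ℝ => D.linkPoint ((z.1 : ℕ) + s)
        ((1 - s) * z.2.1.1.2 + s * z.2.2.1.1.2)
        (1 / 2 + if (D.slab z.1).Over z.2.1.1.2 z.2.2.1.1.2 then s * (1 - s) else 0)
    else if z.2.2.2 = 1 then fun s : ℝ =>
      D.linkPoint ((z.1 : ℕ) + (1 - |2 * s - 1|) / 2) (z.2.1.1.2 + s) (1 / 2)
    else fun s : ℝ =>
      D.linkPoint ((z.1 : ℕ) + (1 + |2 * s - 1|) / 2) (z.2.1.1.2 + s) (1 / 2)).subset ?_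
  rintro γ ⟨a, b, j, ⟨-, rfl⟩ | ⟨-, rfl⟩ | ⟨-, rfl⟩⟩
  · refine ⟨(j, a, b, 0), ?_⟩
    simp only [if_true]
  · refine ⟨(j, a, b, 1), ?_⟩
    simp
  · refine ⟨(j, a, b, 2), ?_⟩
    simp

/-- The part of the link presented by a diagram that belongs to one component. -/
def componentSet (κ : LinkComponents D) : Set ThickenedAnnulus :=
  {y | ∃ (a b : D.Point) (γ : ℝ → ThickenedAnnulus), ArcCurve a b γ ∧ Quot.mk _ a = κ ∧
    y ∈ γ '' Set.Icc 0 1}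

theorem isClosed_componentSet (κ : LinkComponents D) : IsClosed (componentSet κ) := by
  have h : componentSet κ = ⋃ γ ∈ {γ : ℝ → ThickenedAnnulus | ∃ a b : D.Point, ArcCurve a b γ ∧
      Quot.mk _ a = κ}, γ '' Set.Icc 0 1 := by
    ext y
    simp only [componentSet, Set.mem_ofPred_eq, Set.mem_iUnion]
    constructor
    · rintro ⟨a, b, γ, h1, h2, h3⟩
      exact ⟨γ, ⟨a, b, h1, h2⟩, h3⟩
    · rintro ⟨γ, ⟨a, b, h1, h2⟩, h3⟩
      exact ⟨a, b, γ, h1, h2, h3⟩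
  rw [h]
  refine Set.Finite.isClosed_biUnion ((finite_arcCurves D).subset ?_) ?_
  · rintro γ ⟨a, b, h1, -⟩
    exact ⟨a, b, h1⟩
  · rintro γ ⟨a, b, h1, -⟩
    exact (isCompact_Icc.image h1.continuous).isClosed

theorem ArcCurve.joinedIn {a b : D.Point} {γ : ℝ → ThickenedAnnulus} (h : ArcCurve a b γ)
    {s t : ℝ} (hs : s ∈ Set.Icc (0 : ℝ) 1) (ht : t ∈ Set.Icc (0 : ℝ) 1) :
    JoinedIn (componentSet (Quot.mk _ a)) (γ s) (γ t) := by
  have hI : IsPathConnected (Set.Icc (0 : ℝ) 1) :=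
    (convex_Icc 0 1).isPathConnected ⟨0, by simp⟩
  refine ((hI.image h.continuous).joinedIn _ ⟨s, hs, rfl⟩ _ ⟨t, ht, rfl⟩).mono ?_
  intro y hy
  exact ⟨a, b, γ, h, rfl, hy⟩

end Diagram

theorem Slab.linkArc_of_go {S : Slab} {m n p : ℕ} (hS : S.Fits m n) (hp : p < m) :
    (∃ q, q < n ∧ S.Strand p q) ∨ (∃ q, q < m ∧ (S = Slab.death p ∧ q = p + 1 ∨
      S = Slab.death q ∧ p = q + 1)) := by
  cases S with
  | id => exact Or.inl ⟨p, by rw [show n = m from hS]; exact hp, rfl⟩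
  | birth i =>
    obtain ⟨hi, rfl⟩ : i ≤ m ∧ n = m + 2 := hS
    exact Or.inl ⟨if p < i then p else p + 2, by split_ifs <;> omega, rfl⟩
  | death i =>
    obtain ⟨hi, rfl⟩ : i ≤ n ∧ m = n + 2 := hS
    by_cases h1 : p < i
    · exact Or.inl ⟨p, by omega, show p = if p < i then p else p + 2 by rw [if_pos h1]⟩
    by_cases h2 : p = i
    · exact Or.inr ⟨p + 1, by omega, Or.inl ⟨by rw [h2], rfl⟩⟩
    by_cases h3 : p = i + 1
    · exact Or.inr ⟨i, by omega, Or.inr ⟨rfl, h3⟩⟩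
    · refine Or.inl ⟨p - 2, by omega, show p = if p - 2 < i then p - 2 else p - 2 + 2 from ?_⟩
      rw [if_neg (by omega)]
      omega
  | cross i o =>
    obtain ⟨hi, rfl⟩ : i + 2 ≤ m ∧ n = m := hS
    left
    by_cases h2 : p = i
    · exact ⟨i + 1, by omega, Or.inl ⟨h2, rfl⟩⟩
    by_cases h3 : p = i + 1
    · exact ⟨i, by omega, Or.inr (Or.inl ⟨h3, rfl⟩)⟩
    · exact ⟨p, hp, Or.inr (Or.inr ⟨rfl, h2, h3⟩)⟩

namespace Diagram

variable {D : Diagram}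

theorem exists_linkArc (a : D.Point) : ∃ b, LinkArc a b ∨ LinkArc b a := by
  obtain ⟨⟨j, p⟩, hp⟩ := a
  rcases Slab.linkArc_of_go (D.fits j) hp with ⟨q, hq, h⟩ | ⟨q, hq, ⟨h, h'⟩ | ⟨h, h'⟩⟩
  · exact ⟨⟨(j + 1, q), hq⟩, Or.inl ⟨j, Or.inl ⟨rfl, rfl, h⟩⟩⟩
  · exact ⟨⟨(j, q), hq⟩, Or.inl ⟨j, Or.inr (Or.inl ⟨rfl, rfl, h, h'⟩)⟩⟩
  · exact ⟨⟨(j, q), hq⟩, Or.inr ⟨j, Or.inr (Or.inl ⟨rfl, rfl, h, h'⟩)⟩⟩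

theorem rayPoint_mem (a : D.Point) : D.rayPoint a ∈ componentSet (Quot.mk _ a) := by
  obtain ⟨b, h | h⟩ := exists_linkArc a
  · obtain ⟨γ, hγ⟩ := h.exists_arcCurve
    exact ⟨a, b, γ, hγ, rfl, 0, by simp, hγ.apply_zero⟩
  · obtain ⟨γ, hγ⟩ := h.exists_arcCurve
    exact ⟨b, a, γ, hγ, Quot.sound h, 1, by simp, hγ.apply_one⟩

/-- Points in one combinatorial component are connected by a chain of arcs, and the curves of these
arcs concatenate to a path. -/
theorem joinedIn_rayPoint {a b : D.Point}
    (h : (Quot.mk _ a : LinkComponents D) = Quot.mk _ b) :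
    JoinedIn (componentSet (Quot.mk _ a)) (D.rayPoint a) (D.rayPoint b) := by
  have h' := Quot.eqvGen_exact h
  clear h
  induction h' with
  | rel a b h =>
    obtain ⟨γ, hγ⟩ := h.exists_arcCurve
    have := hγ.joinedIn (s := 0) (t := 1) (by simp) (by simp)
    rwa [hγ.apply_zero, hγ.apply_one] at this
  | refl a => exact JoinedIn.refl (rayPoint_mem a)
  | symm a b h ih =>
    have : (Quot.mk _ a : LinkComponents D) = Quot.mk _ b := Quot.eqvGen_sound h
    rw [← this]
    exact ih.symm
  | trans a b c h1 h2 ih1 ih2 =>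
    have : (Quot.mk _ a : LinkComponents D) = Quot.mk _ b := Quot.eqvGen_sound h1
    rw [← this] at ih2
    exact ih1.trans ih2

theorem isPathConnected_componentSet (κ : LinkComponents D) : IsPathConnected (componentSet κ) := by
  obtain ⟨a, rfl⟩ := Quot.exists_rep κ
  refine ⟨D.rayPoint a, rayPoint_mem a, ?_⟩
  rintro _ ⟨b, b', γ, hγ, hb, s, hs, rfl⟩
  refine (joinedIn_rayPoint hb.symm).trans ?_
  rw [← hb, ← hγ.apply_zero]
  exact hγ.joinedIn (by simp) hs

/-! ### Disjointness of the components -/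

open scoped Classical in
/-- In sector `j`, the component `κ` contains a point with angle `τ`, radial coordinate `x` and
height `h`. -/
def OnArc (j : Fin (D.N + 1)) (κ : LinkComponents D) (τ x h : ℝ) : Prop :=
  (∃ (p q : ℕ) (hp : p < D.width j), q < D.width (j + 1) ∧ (D.slab j).Strand p q ∧
    κ = Quot.mk _ ⟨(j, p), hp⟩ ∧ x = (1 - τ) * p + τ * q ∧
    h = 1 / 2 + if (D.slab j).Over p q then τ * (1 - τ) else 0) ∨
  (∃ (i : ℕ) (hi : i < D.width j) (s : ℝ), 0 ≤ s ∧ s ≤ 1 ∧ D.slab j = Slab.death i ∧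
    κ = Quot.mk _ ⟨(j, i), hi⟩ ∧ τ = (1 - |2 * s - 1|) / 2 ∧ x = i + s ∧ h = 1 / 2) ∨
  (∃ (i : ℕ) (hi : i < D.width (j + 1)) (s : ℝ), 0 ≤ s ∧ s ≤ 1 ∧ D.slab j = Slab.birth i ∧
    κ = Quot.mk _ ⟨(j + 1, i), hi⟩ ∧ τ = (1 + |2 * s - 1|) / 2 ∧ x = i + s ∧ h = 1 / 2)

theorem OnArc.bounds {j : Fin (D.N + 1)} {κ : LinkComponents D} {τ x h : ℝ}
    (H : OnArc j κ τ x h) (h0 : 0 ≤ τ) (h1 : τ ≤ 1) : 0 ≤ x ∧ 0 ≤ h ∧ h ≤ 1 := by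
  obtain ⟨p, q, hp, hq, hs, -, rfl, rfl⟩ | ⟨i, hi, s, hs0, hs1, -, -, -, rfl, rfl⟩ |
    ⟨i, hi, s, hs0, hs1, -, -, -, rfl, rfl⟩ := H
  · have h2 : 0 ≤ τ * (1 - τ) := mul_nonneg h0 (by linarith)
    have h3 : τ * (1 - τ) ≤ 1 / 2 := by nlinarith [sq_nonneg (τ - 1 / 2)]
    have h4 : (0 : ℝ) ≤ 1 - τ := by linarith
    refine ⟨by positivity, ?_⟩
    split_ifs <;> constructor <;> linarith
  · refine ⟨by positivity, by norm_num, by norm_num⟩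
  · refine ⟨by positivity, by norm_num, by norm_num⟩

theorem abs_two_mul_sub_one_le {s : ℝ} (h0 : 0 ≤ s) (h1 : s ≤ 1) : |2 * s - 1| ≤ 1 :=
  abs_le.2 ⟨by linarith, by linarith⟩

theorem ArcCurve.exists_onArc {a b : D.Point} {γ : ℝ → ThickenedAnnulus} (H : ArcCurve a b γ)
    {s : ℝ} (hs : s ∈ Set.Icc (0 : ℝ) 1) :
    ∃ (j : Fin (D.N + 1)) (τ x h : ℝ), 0 ≤ τ ∧ τ ≤ 1 ∧ OnArc j (Quot.mk _ a) τ x h ∧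
      D.HasCoords (γ s) ((j : ℕ) + τ) x h := by
  classical
  obtain ⟨h0, h1⟩ := hs
  have habs := abs_two_mul_sub_one_le h0 h1
  have habs' := abs_nonneg (2 * s - 1)
  suffices h : ∃ (j : Fin (D.N + 1)) (τ x h : ℝ), 0 ≤ τ ∧ τ ≤ 1 ∧ OnArc j (Quot.mk _ a) τ x h ∧
      γ s = D.linkPoint ((j : ℕ) + τ) x h by
    obtain ⟨j, τ, x, h, hτ0, hτ1, h2, h3⟩ := h
    have h4 := h2.bounds hτ0 hτ1
    exact ⟨j, τ, x, h, hτ0, hτ1, h2, (hasCoords_iff h4.1 h4.2).2 h3⟩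
  obtain ⟨⟨ja, p⟩, hp⟩ := a
  obtain ⟨⟨jb, q⟩, hq⟩ := b
  obtain ⟨j, ⟨⟨e1, e2, h⟩, rfl⟩ | ⟨⟨e1, e2, h⟩, rfl⟩ | ⟨⟨e1, e2, h⟩, rfl⟩⟩ := H
  · dsimp only at e1 e2 h hp hq
    subst e1 e2
    refine ⟨ja, s, _, _, h0, h1, Or.inl ⟨p, q, hp, hq, h, rfl, rfl, rfl⟩, ?_⟩
    rfl
  · dsimp only at e1 e2 h hp hq
    subst e1 e2
    exact ⟨jb, _, _, _, by linarith, by linarith,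
      Or.inr (Or.inl ⟨p, hp, s, h0, h1, h.1, rfl, rfl, rfl, rfl⟩), rfl⟩
  · dsimp only at e1 e2 h hp hq
    subst e1 e2
    exact ⟨j, _, _, _, by linarith, by linarith,
      Or.inr (Or.inr ⟨p, hp, s, h0, h1, h.1, rfl, rfl, rfl, rfl⟩), rfl⟩

theorem OnArc.exists_curve {j : Fin (D.N + 1)} {κ : LinkComponents D} {τ x h : ℝ}
    {y : ThickenedAnnulus} (H : OnArc j κ τ x h) (h0 : 0 ≤ τ) (h1 : τ ≤ 1)
    (hy : D.HasCoords y ((j : ℕ) + τ) x h) : y ∈ componentSet κ := by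
  have hb := H.bounds h0 h1
  rw [hasCoords_iff hb.1 hb.2] at hy
  have hfit := D.fits j
  obtain ⟨p, q, hp, hq, hs, rfl, rfl, rfl⟩ | ⟨i, hi, s, hs0, hs1, hS, rfl, rfl, rfl, rfl⟩ |
    ⟨i, hi, s, hs0, hs1, hS, rfl, rfl, rfl, rfl⟩ := H
  · exact ⟨_, ⟨(j + 1, q), hq⟩, _, ⟨j, Or.inl ⟨⟨rfl, rfl, hs⟩, rfl⟩⟩, rfl, τ, ⟨h0, h1⟩, hy.symm⟩
  · rw [hS] at hfit
    have hi' : i + 1 < D.width j := by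
      have := hfit.1
      have := hfit.2
      omega
    exact ⟨_, ⟨(j, i + 1), hi'⟩, _, ⟨j, Or.inr (Or.inl ⟨⟨rfl, rfl, hS, rfl⟩, rfl⟩)⟩, rfl, s,
      ⟨hs0, hs1⟩, hy.symm⟩
  · rw [hS] at hfit
    have hi' : i + 1 < D.width (j + 1) := by
      have := hfit.1
      have := hfit.2
      omega
    exact ⟨_, ⟨(j + 1, i + 1), hi'⟩, _, ⟨j, Or.inr (Or.inr ⟨⟨rfl, rfl, hS, rfl⟩, rfl⟩)⟩, rfl, s,
      ⟨hs0, hs1⟩, hy.symm⟩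

variable (D) in
theorem link_eq_iUnion : D.link = ⋃ κ : LinkComponents D, componentSet κ := by
  ext y
  rw [Set.mem_iUnion]
  constructor
  · rintro ⟨j, s, h0, h1, ⟨p, q, hp, hq, hs, hy⟩ | ⟨i, hS, hy⟩ | ⟨i, hS, hy⟩⟩
    · refine ⟨Quot.mk _ ⟨(j, p), hp⟩, OnArc.exists_curve (j := j) (τ := s)
        (Or.inl ⟨p, q, hp, hq, hs, rfl, rfl, rfl⟩) h0 h1 hy⟩
    · have hfit := D.fits j
      rw [hS] at hfit
      have hi : i < D.width (j + 1) := by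
        have := hfit.1
        have := hfit.2
        omega
      have habs := abs_two_mul_sub_one_le h0 h1
      have habs' := abs_nonneg (2 * s - 1)
      exact ⟨Quot.mk _ ⟨(j + 1, i), hi⟩, OnArc.exists_curve (j := j)
        (Or.inr (Or.inr ⟨i, hi, s, h0, h1, hS, rfl, rfl, rfl, rfl⟩)) (by linarith) (by linarith) hy⟩
    · have hfit := D.fits j
      rw [hS] at hfit
      have hi : i < D.width j := by
        have := hfit.1
        have := hfit.2
        omega
      have habs := abs_two_mul_sub_one_le h0 h1
      have habs' := abs_nonneg (2 * s - 1)
      exact ⟨Quot.mk _ ⟨(j, i), hi⟩, OnArc.exists_curve (j := j)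
        (Or.inr (Or.inl ⟨i, hi, s, h0, h1, hS, rfl, rfl, rfl, rfl⟩)) (by linarith) (by linarith) hy⟩
  · rintro ⟨κ, a, b, γ, hγ, rfl, s, hs, rfl⟩
    obtain ⟨j, τ, x, h, h0, h1, ⟨p, q, hp, hq, hs, -, rfl, rfl⟩ |
      ⟨i, hi, s', hs0, hs1, hS, -, rfl, rfl, rfl⟩ |
      ⟨i, hi, s', hs0, hs1, hS, -, rfl, rfl, rfl⟩, hy⟩ := hγ.exists_onArc hs
    · exact ⟨j, τ, h0, h1, Or.inl ⟨p, q, hp, hq, hs, hy⟩⟩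
    · exact ⟨j, s', hs0, hs1, Or.inr (Or.inr ⟨i, hS, hy⟩)⟩
    · exact ⟨j, s', hs0, hs1, Or.inr (Or.inl ⟨i, hS, hy⟩)⟩

end Diagram

/-! ### Arcs in the interior of a sector do not meet. -/

theorem natCast_ne_add {i p : ℕ} {t : ℝ} (h0 : 0 < t) (h1 : t < 1) : (p : ℝ) ≠ i + t := by
  intro h
  have h2 : (i : ℝ) < p := by linarith
  have h3 : (p : ℝ) < (i + 1 : ℕ) := by
    push_cast
    linarith
  have h2' : i < p := by exact_mod_cast h2
  have h3' : p < i + 1 := by exact_mod_cast h3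
  omega

namespace Slab

open scoped Classical in
-- Without a crossing the strands keep their radial order. At a crossing the two exchanged strands
-- have different heights throughout the open sector, and their radial coordinate lies strictly
-- between `i` and `i + 1`, where no other strand runs.
theorem Strand.unique {S : Slab} {p q p' q' : ℕ} {τ : ℝ} (H : S.Strand p q) (H' : S.Strand p' q')
    (h0 : 0 < τ) (h1 : τ < 1)
    (hx : (1 - τ) * p + τ * q = (1 - τ) * p' + τ * q')
    (hh : (if S.Over p q then τ * (1 - τ) else 0) = if S.Over p' q' then τ * (1 - τ) else 0) :
    p = p' := by
  have hmono : ∀ {a b a' b' : ℕ}, a < a' → b ≤ b' →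
      (1 - τ) * a + τ * b < (1 - τ) * a' + τ * b' := fun {a b a' b'} ha hb => by
    have ha' : (a : ℝ) < a' := by exact_mod_cast ha
    have hb' : (b : ℝ) ≤ b' := by exact_mod_cast hb
    nlinarith
  cases S with
  | cross i o =>
    have hpos : τ * (1 - τ) ≠ 0 := (mul_pos h0 (by linarith)).ne'
    have hflip : ¬ ((if (cross i o).Over i (i + 1) then τ * (1 - τ) else 0) =
        if (cross i o).Over (i + 1) i then τ * (1 - τ) else 0) := by
      cases o <;> simp [Over, hpos, hpos.symm]
    have hni : ∀ n : ℕ, (1 - τ) * i + τ * (i + 1 : ℕ) ≠ (1 - τ) * n + τ * n := fun n h => by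
      push_cast at h
      exact natCast_ne_add (i := i) (p := n) h0 h1 (by linarith)
    have hni' : ∀ n : ℕ, (1 - τ) * (i + 1 : ℕ) + τ * i ≠ (1 - τ) * n + τ * n := fun n h => by
      push_cast at h
      exact natCast_ne_add (i := i) (p := n) (t := 1 - τ) (by linarith) (by linarith) (by linarith)
    obtain ⟨rfl, rfl⟩ | ⟨rfl, rfl⟩ | ⟨rfl, -⟩ := H <;>
      obtain ⟨rfl, rfl⟩ | ⟨rfl, rfl⟩ | ⟨rfl, -⟩ := H'
    · rfl
    · exact (hflip hh).elim
    · exact (hni _ hx).elim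
    · exact (hflip hh.symm).elim
    · rfl
    · exact (hni' _ hx).elim
    · exact (hni _ hx.symm).elim
    · exact (hni' _ hx.symm).elim
    · have : (p : ℝ) = p' := by linarith
      exact_mod_cast this
  | _ =>
    rcases lt_trichotomy p p' with h | h | h
    · refine (hmono h ?_).ne hx |>.elim
      simp only [Strand] at H H'
      grind
    · exact h
    · refine (hmono h ?_).ne' hx |>.elim
      simp only [Strand] at H H'
      grind

/-- Strands inside the cap stay at radial coordinate at most `i - 1`. A strand outside moves inwards
from `q + 2` to `q`, where `q ≥ i`; at the angle of the point `s` of the cap it is at `q + 1 + |2s -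
1|`, which exceeds `i + s`. -/
theorem Strand.ne_death {i p q : ℕ} {s : ℝ} (H : (death i).Strand p q) (h0 : 0 ≤ s) :
    (1 - (1 - |2 * s - 1|) / 2) * p + (1 - |2 * s - 1|) / 2 * q ≠ i + s := by
  intro h
  have ha := le_abs_self (2 * s - 1)
  have hb := neg_le_abs (2 * s - 1)
  simp only [Strand] at H
  split_ifs at H with hq
  · subst H
    have : (p : ℝ) + 1 ≤ i := by exact_mod_cast hq
    linarith
  · subst H
    have : (i : ℝ) ≤ q := by exact_mod_cast Nat.le_of_not_lt hq
    push_cast at h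
    linarith

theorem Strand.ne_birth {i p q : ℕ} {s : ℝ} (H : (birth i).Strand p q) (h0 : 0 ≤ s) :
    (1 - (1 + |2 * s - 1|) / 2) * p + (1 + |2 * s - 1|) / 2 * q ≠ i + s := by
  intro h
  have ha := le_abs_self (2 * s - 1)
  have hb := neg_le_abs (2 * s - 1)
  simp only [Strand] at H
  split_ifs at H with hq
  · subst H
    have : (q : ℝ) + 1 ≤ i := by exact_mod_cast hq
    linarith
  · subst H
    have : (i : ℝ) ≤ p := by exact_mod_cast Nat.le_of_not_lt hq
    push_cast at h
    linarith

end Slab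

namespace Diagram

variable {D : Diagram}

theorem OnArc.eq_of_interior {j : Fin (D.N + 1)} {κ κ' : LinkComponents D} {τ x h : ℝ}
    (H : OnArc j κ τ x h) (H' : OnArc j κ' τ x h) (h0 : 0 < τ) (h1 : τ < 1) : κ = κ' := by
  obtain ⟨p, q, hp, hq, hs, rfl, hx, hh⟩ | ⟨i, hi, s, hs0, hs1, hS, rfl, ht, hx, hh⟩ |
    ⟨i, hi, s, hs0, hs1, hS, rfl, ht, hx, hh⟩ := H <;>
  obtain ⟨p', q', hp', hq', hs', rfl, hx', hh'⟩ | ⟨i', hi', s', hs0', hs1', hS', rfl, ht', hx', hh'⟩ |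
    ⟨i', hi', s', hs0', hs1', hS', rfl, ht', hx', hh'⟩ := H'
  · obtain rfl := hs.unique hs' h0 h1 (hx ▸ hx') (by linarith)
    rfl
  · rw [hS'] at hs
    exact (hs.ne_death hs0' (by rw [← ht', ← hx, hx'])).elim
  · rw [hS'] at hs
    exact (hs.ne_birth hs0' (by rw [← ht', ← hx, hx'])).elim
  · rw [hS] at hs'
    exact (hs'.ne_death hs0 (by rw [← ht, ← hx', hx])).elim
  · rw [hS] at hS'
    obtain rfl := Slab.death.inj hS'
    rfl
  · rw [hS] at hS'
    cases hS'
  · rw [hS] at hs'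
    exact (hs'.ne_birth hs0 (by rw [← ht, ← hx', hx])).elim
  · rw [hS] at hS'
    cases hS'
  · rw [hS] at hS'
    obtain rfl := Slab.birth.inj hS'
    rfl

theorem OnArc.of_zero {j : Fin (D.N + 1)} {κ : LinkComponents D} {x h : ℝ}
    (H : OnArc j κ 0 x h) :
    ∃ (p : ℕ) (hp : p < D.width j), x = p ∧ κ = Quot.mk _ ⟨(j, p), hp⟩ := by
  have hfit := D.fits j
  obtain ⟨p, q, hp, hq, hs, rfl, hx, hh⟩ | ⟨i, hi, s, hs0, hs1, hS, rfl, ht, hx, hh⟩ |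
    ⟨i, hi, s, hs0, hs1, hS, rfl, ht, hx, hh⟩ := H
  · exact ⟨p, hp, by rw [hx]; ring, rfl⟩
  · rw [hS] at hfit
    have hi' : i + 1 < D.width j := by
      have := hfit.1
      have := hfit.2
      omega
    -- Angle `0` forces `|2s - 1| = 1`, so the point is one of the two ends of the cap, and these
    -- belong to the same component.
    rcases abs_choice (2 * s - 1) with h | h
    · exact ⟨i + 1, hi', by push_cast; linarith,
        Quot.sound ⟨j, Or.inr (Or.inl ⟨rfl, rfl, hS, rfl⟩)⟩⟩
    · exact ⟨i, hi, by linarith, rfl⟩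
  · have := abs_nonneg (2 * s - 1)
    linarith

theorem OnArc.of_one {j : Fin (D.N + 1)} {κ : LinkComponents D} {x h : ℝ}
    (H : OnArc j κ 1 x h) :
    ∃ (p : ℕ) (hp : p < D.width (j + 1)), x = p ∧ κ = Quot.mk _ ⟨(j + 1, p), hp⟩ := by
  have hfit := D.fits j
  obtain ⟨p, q, hp, hq, hs, rfl, hx, hh⟩ | ⟨i, hi, s, hs0, hs1, hS, rfl, ht, hx, hh⟩ |
    ⟨i, hi, s, hs0, hs1, hS, rfl, ht, hx, hh⟩ := H
  · exact ⟨q, hq, by rw [hx]; ring, Quot.sound ⟨j, Or.inl ⟨rfl, rfl, hs⟩⟩⟩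
  · have := abs_nonneg (2 * s - 1)
    linarith
  · rw [hS] at hfit
    have hi' : i + 1 < D.width (j + 1) := by
      have := hfit.1
      have := hfit.2
      omega
    rcases abs_choice (2 * s - 1) with h | h
    · exact ⟨i + 1, hi', by push_cast; linarith,
        Quot.sound ⟨j, Or.inr (Or.inr ⟨rfl, rfl, hS, rfl⟩)⟩⟩
    · exact ⟨i, hi, by linarith, rfl⟩

theorem fin_eq_of_eq_add_mul {j j' : Fin (D.N + 1)} {m : ℤ}
    (h : ((j : ℕ) : ℤ) = (j' : ℕ) + m * (D.N + 1)) :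
    j = j' := by
  refine Fin.ext ?_
  have h1 := congrArg (fun z : ℤ => z % (D.N + 1)) h
  simp only [Int.add_mul_emod_self_right] at h1
  have e : ((D.N : ℤ) + 1) = ((D.N + 1 : ℕ) : ℤ) := by push_cast; rfl
  rw [e, ← Int.natCast_mod, ← Int.natCast_mod, Nat.mod_eq_of_lt j.2, Nat.mod_eq_of_lt j'.2] at h1
  exact_mod_cast h1

theorem val_add_one_eq (j : Fin (D.N + 1)) :
    ∃ m : ℤ, (((j + 1 : Fin (D.N + 1)) : ℕ) : ℤ) = (j : ℕ) + 1 + m * (D.N + 1) := by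
  by_cases hj : j = Fin.last D.N
  · exact ⟨-1, by rw [hj, Fin.last_add_one, Fin.val_last]; simp⟩
  · exact ⟨0, by rw [Fin.val_add_one_of_lt (Fin.lt_last_iff_ne_last.2 hj)]; simp⟩

/-- A point of the link either lies on a ray, or strictly inside a sector. -/
theorem OnArc.ray_or_interior {j : Fin (D.N + 1)} {κ : LinkComponents D} {τ x h : ℝ}
    (H : OnArc j κ τ x h) (h0 : 0 ≤ τ) (h1 : τ ≤ 1) :
    (∃ (j₀ : Fin (D.N + 1)) (p : ℕ) (hp : p < D.width j₀) (m : ℤ),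
      (j : ℕ) + τ = (j₀ : ℕ) + m * (D.N + 1) ∧ x = p ∧ κ = Quot.mk _ ⟨(j₀, p), hp⟩) ∨
      0 < τ ∧ τ < 1 := by
  rcases h0.eq_or_lt with rfl | h0
  · obtain ⟨p, hp, hx, hκ⟩ := H.of_zero
    exact Or.inl ⟨j, p, hp, 0, by simp, hx, hκ⟩
  rcases h1.eq_or_lt with rfl | h1
  · obtain ⟨p, hp, hx, hκ⟩ := H.of_one
    obtain ⟨m, hm⟩ := val_add_one_eq j
    refine Or.inl ⟨j + 1, p, hp, -m, ?_, hx, hκ⟩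
    have hm' : (((j + 1 : Fin (D.N + 1)) : ℕ) : ℝ) = (j : ℕ) + 1 + m * (D.N + 1) := by
      exact_mod_cast hm
    rw [hm']
    push_cast
    ring
  · exact Or.inr ⟨h0, h1⟩

theorem intCast_ne_add {a b : ℤ} {t : ℝ} (h0 : 0 < t) (h1 : t < 1) : (a : ℝ) ≠ b + t := by
  intro h
  have h2 : (b : ℝ) < a := by linarith
  have h3 : (a : ℝ) < (b + 1 : ℤ) := by
    push_cast
    linarith
  have h2' : b < a := by exact_mod_cast h2
  have h3' : a < b + 1 := by exact_mod_cast h3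
  omega

/-- A point on a ray is a point of the diagram, determined by its ray and its integral radial
coordinate. Otherwise the angle is not an integer, its integral part determines the sector, and the
arcs inside one sector are disjoint. -/
theorem OnArc.unique {j j' : Fin (D.N + 1)} {κ κ' : LinkComponents D} {τ τ' x h : ℝ} {n : ℤ}
    (H : OnArc j κ τ x h) (H' : OnArc j' κ' τ' x h) (h0 : 0 ≤ τ) (h1 : τ ≤ 1) (h0' : 0 ≤ τ')
    (h1' : τ' ≤ 1) (hn : (j : ℕ) + τ = (j' : ℕ) + τ' + n * (D.N + 1)) : κ = κ' := by
  rcases H.ray_or_interior h0 h1 with ⟨j₀, p, hp, m, hm, hx, rfl⟩ | ⟨g0, g1⟩ <;>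
    rcases H'.ray_or_interior h0' h1' with ⟨j₀', p', hp', m', hm', hx', rfl⟩ | ⟨g0', g1'⟩
  · have hj : ((j₀ : ℕ) : ℤ) = (j₀' : ℕ) + (m' + n - m) * (D.N + 1) := by
      have : ((j₀ : ℕ) : ℝ) = (j₀' : ℕ) + (m' + n - m) * (D.N + 1) := by linarith
      exact_mod_cast this
    obtain rfl := fin_eq_of_eq_add_mul hj
    obtain rfl : p = p' := by
      rw [hx] at hx'
      exact_mod_cast hx'
    rfl
  · refine (intCast_ne_add (a := (j₀ : ℕ) + m * (D.N + 1) - n * (D.N + 1)) (b := (j' : ℕ)) g0' g1'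
      ?_).elim
    push_cast
    linarith
  · refine (intCast_ne_add (a := (j₀' : ℕ) + m' * (D.N + 1) + n * (D.N + 1)) (b := (j : ℕ)) g0 g1
      ?_).elim
    push_cast
    linarith
  · have hab : ∀ {a b : ℤ} {t t' : ℝ}, 0 < t → t < 1 → 0 < t' → t' < 1 → (a : ℝ) + t = b + t' →
        a = b := fun {a b t t'} _ _ _ _ hh => by
      have h2 : (a : ℝ) < (b + 1 : ℤ) := by push_cast; linarith
      have h3 : (b : ℝ) < (a + 1 : ℤ) := by push_cast; linarith
      have h2' : a < b + 1 := by exact_mod_cast h2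
      have h3' : b < a + 1 := by exact_mod_cast h3
      omega
    have hj : ((j : ℕ) : ℤ) = (j' : ℕ) + n * (D.N + 1) := hab g0 g1 g0' g1' (by
      push_cast
      linarith)
    obtain rfl : τ = τ' := by
      have : ((j : ℕ) : ℝ) = (j' : ℕ) + n * (D.N + 1) := by exact_mod_cast hj
      linarith
    obtain rfl := fin_eq_of_eq_add_mul hj
    exact H.eq_of_interior H' g0 g1

theorem disjoint_componentSet {κ κ' : LinkComponents D} (h : κ ≠ κ') :
    Disjoint (componentSet κ) (componentSet κ') := by
  refine Set.disjoint_left.2 ?_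
  rintro y ⟨a, b, γ, hγ, rfl, s, hs, rfl⟩ ⟨a', b', γ', hγ', rfl, s', hs', hy⟩
  obtain ⟨j, τ, x, z, h0, h1, H, hc⟩ := hγ.exists_onArc hs
  obtain ⟨j', τ', x', z', h0', h1', H', hc'⟩ := hγ'.exists_onArc hs'
  rw [hy] at hc'
  obtain ⟨rfl, rfl, n, hn⟩ := hc.unique hc' (H.bounds h0 h1).1 (H'.bounds h0' h1').1
  exact h (H.unique H' h0 h1 h0' h1' hn)

/-- The end of the isotopy is a homeomorphism, so the images of the `k` circles and the sets
`componentSet κ` are two finite partitions of `D.link` into nonempty closed connected sets. -/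
theorem card_linkComponents {k : ℕ} {L : Set ThickenedAnnulus} (hL : IsLink k L)
    (hD : D.IsDiagramOf L) : Nat.card (LinkComponents D) = k := by
  obtain ⟨f, hf, rfl⟩ := hL
  obtain ⟨H, -, -, hH⟩ := hD
  have hg : Continuous (H 1 ∘ f) := (H 1).continuous.comp hf.continuous
  have hinj : Function.Injective (H 1 ∘ f) := (H 1).injective.comp hf.injective
  have hcard := card_eq_of_closed_partitions
    (A := fun i : Fin k => (H 1 ∘ f) '' ({i} ×ˢ (Set.univ : Set Circle)))
    (B := fun κ : LinkComponents D => componentSet κ)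
    (fun i => (isPreconnected_singleton.prod isPreconnected_univ).image _ hg.continuousOn)
    (fun κ => (isPathConnected_componentSet κ).isConnected.isPreconnected)
    (fun i => ((Set.singleton_nonempty i).prod Set.univ_nonempty).image _)
    (fun κ => (isPathConnected_componentSet κ).nonempty)
    (fun i => ((isCompact_singleton.prod isCompact_univ).image hg).isClosed)
    isClosed_componentSet
    (fun i i' h => (Set.disjoint_image_iff hinj).2
      (Set.disjoint_prod.2 (Or.inl (Set.disjoint_singleton.2 h))))
    (fun κ κ' h => disjoint_componentSet h)
    (by
      rw [← Set.image_iUnion, ← Set.iUnion_prod_const, Set.iUnion_of_singleton,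
        Set.univ_prod_univ, Set.image_univ, Set.range_comp, hH, link_eq_iUnion])
  rw [← hcard, Nat.card_eq_fintype_card, Fintype.card_fin]

end Diagram

end AnnularKhovanov

end

/-! ### The theorem for a link with `k` components. -/

theorem mainTheorem3 (k : ℕ) (L : Set AnnularKhovanov.ThickenedAnnulus)
    (hL : AnnularKhovanov.IsLink k L)
    (D : AnnularKhovanov.Diagram) (hD : D.IsDiagramOf L) :
    D.dαD ∘ₗ D.dαD = 0 ∧
      Module.Free AnnularKhovanov.RαD D.Kh ∧
      Module.finrank AnnularKhovanov.RαD D.Kh = 2 ^ k := by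
  obtain ⟨hfree, hrank⟩ := D.free_Kh_and_finrank_Kh
  rw [AnnularKhovanov.Diagram.card_linkComponents hL hD] at hrank
  exact ⟨D.dαD_comp_dαD, hfree, hrank⟩
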